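/- Let $d,N\in\mathbb{N}$ with $d\ge 1$, $T,M_0\in(0,\infty)$, let $\omega\subset\mathbb{R}^d$ be open and bounded, $\ell\in[1,2]$, and let $K\in W^{1,\ell}(\mathbb{R}^d)$ satisfy $K(x)\ge 0$ for all $x$. Let $$\mathcal{U}=\{u\in L^2(\omega): u(x)\in[0,M_0]\ \text{for a.e. }x\in\omega\},$$ extend every $u\in L^2(\omega)$ by $0$ to $\mathbb{R}^d$, and put $(Su)(x)=\int_{\mathbb{R}^d}K(x-x')u(x')\,dx'$. Repeated indices are summed. Assume: (H1) $b\in L^\infty((0,T)\times\mathbb{R}^d\times[0,\infty);\mathbb{R}^d)$ is a Borel function, and $b(t,x,\cdot)$ is continuous on $[0,\infty)$ for a.e. $(t,x)\in(0,T)\times\mathbb{R}^d$. (H2) $\sigma\in C_b^2([0,T]\times\mathbb{R}^d\times[0,\infty);\mathbb{R}^{d\times N})$ (bounded, $C^2$ up to the boundary, with bounded derivatives up to order two), and with $q_{ij}=\sigma_{il}\sigma_{jl}$ there is $\gamma>0$ such that $q_{ij}(t,x,s)\xi_i\xi_j\ge\gamma|\xi|^2$ for all $t\in[0,T]$, $x,\xi\in\mathbb{R}^d$,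 $s\ge 0$. (H3) $\rho_0\in L^2(\mathbb{R}^d)\cap L^1(\mathbb{R}^d)$, $\rho_0\ge 0$ a.e., $\int_{\mathbb{R}^d}\rho_0\,dx=1$. (H4) $G\in L^2((0,T)\times\mathbb{R}^d)$ and $G_T\in L^2(\mathbb{R}^d)$ are nonnegative a.e.; $h:[0,M_0]\to[0,\infty)$ is convex and continuous, and there is $\alpha>0$ with $h(s)\ge\frac{\alpha}{2}s^2$ for all $s\in[0,M_0]$. For $u\in\mathcal{U}$, a weak solution of $$\partial_t\rho=-\nabla\cdot\big(b(t,x,(Su)(x))\rho\big)+\tfrac12\,\partial^2_{x_ix_j}\big(q_{ij}(t,x,(Su)(x))\rho\big)\ \text{ in }(0,T)\times\mathbb{R}^d,\qquad \rho(0,\cdot)=\rho_0,$$ is a function $\rho\in L^2(0,T;H^1(\mathbb{R}^d))\cap W^{1,2}([0,T];H^{-1}(\mathbb{R}^d))$ (a space contained in $C([0,T];L^2(\mathbb{R}^d))$, so that $\rho(t)$ is defined for every $t\in[0,T]$) with $\rho(0)=\rho_0$ a.e. in $\mathbb{R}^d$ such that, for a.e. $t\in(0,T)$ and all $\varphi\in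 H^1(\mathbb{R}^d)$, $$\Big\langle\frac{d\rho}{dt}(t),\varphi\Big\rangle_{H^{-1},H^1}=\int_{\mathbb{R}^d}\rho(t,x)\,b(t,x,(Su)(x))\cdot\nabla\varphi(x)\,dx-\frac12\int_{\mathbb{R}^d}\frac{\partial}{\partial x_j}\big(q_{ij}(t,x,(Su)(x))\rho(t,x)\big)\frac{\partial\varphi}{\partial x_i}(x)\,dx .$$ Then for every $u\in\mathcal{U}$ there is exactly one weak solution $\rho^u$, and there exists an optimal control: there is $u^*\in\mathcal{U}$ such that $J(u^*)\le J(u)$ for all $u\in\mathcal{U}$, where $$J(u)=\int_0^T\!\!\int_{\mathbb{R}^d}G(t,x)\rho^u(t,x)\,dx\,dt+\int_{\mathbb{R}^d}G_T(x)\rho^u(T,x)\,dx+\int_{\mathbb{R}^d}h(u(x))\,dx .$$ Here the last integral takes values in $[0,\infty]$ (it is infinite if $h(0)>0$). The same $u^*$ also minimizes over $\mathcal{U}$ the functional obtained from $J$ by replacing $\int_{\mathbb{R}^d}h(u(x))\,dx$ with $\int_{\omega}h(u(x))\,dx$. -/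

import Mathlib

open MeasureTheory Set
open scoped ENNReal

noncomputable section

namespace FPControl

/-- `ℝ^d` with the Euclidean norm. -/
abbrev Space (d : ℕ) : Type := EuclideanSpace ℝ (Fin d)

/-- `L²(ℝ^d)`, real valued, with respect to Lebesgue measure. -/
abbrev L2 (d : ℕ) : Type := Lp ℝ 2 (volume : Measure (Space d))

/-- `L²(ℝ^d; ℝ^d)`. -/
abbrev L2Vec (d : ℕ) : Type := Lp (Space d) 2 (volume : Measure (Space d))

/-- The classical partial derivative `∂φ/∂x_i`, used for test functions only. -/
def partialDeriv {d : ℕ} (i : Fin d) (φ : Space d → ℝ) (x : Space d) : ℝ :=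
  fderiv ℝ φ x (EuclideanSpace.single i 1)

/-- `g` is the `i`-th partial derivative of `f` in the sense of distributions on `ℝ^d`. -/
def HasWeakPartial {d : ℕ} (i : Fin d) (f g : Space d → ℝ) : Prop :=
  LocallyIntegrable f volume ∧ LocallyIntegrable g volume ∧
    ∀ φ : Space d → ℝ, ContDiff ℝ (⊤ : ℕ∞) φ → HasCompactSupport φ →
      ∫ x, f x * partialDeriv i φ x = - ∫ x, g x * φ x

/-- `g` is the gradient of `f` in the sense of distributions on `ℝ^d`. -/
def HasWeakGradient {d : ℕ} (f : Space d → ℝ) (g : Space d → Space d) : Prop :=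
  ∀ i, HasWeakPartial i f (fun x => g x i)

/-- `f ∈ W^{1,p}(ℝ^d)`. -/
def MemW1p {d : ℕ} (p : ℝ≥0∞) (f : Space d → ℝ) : Prop :=
  MemLp f p volume ∧ ∃ g : Space d → Space d, MemLp g p volume ∧ HasWeakGradient f g

section WeakDerivativeLemmas

variable {d : ℕ}

theorem continuous_partialDeriv (i : Fin d) {φ : Space d → ℝ} (hφ : ContDiff ℝ (⊤ : ℕ∞) φ) :
    Continuous (partialDeriv i φ) := by
  have h : Continuous (fderiv ℝ φ) := hφ.continuous_fderiv (by simp)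
  exact h.clm_apply continuous_const

theorem hasCompactSupport_partialDeriv (i : Fin d) {φ : Space d → ℝ}
    (hφ : HasCompactSupport φ) : HasCompactSupport (partialDeriv i φ) := by
  have h : HasCompactSupport (fderiv ℝ φ) := hφ.fderiv (𝕜 := ℝ)
  exact h.comp_left (g := fun L : Space d →L[ℝ] ℝ => L (EuclideanSpace.single i 1)) rfl

theorem integrable_mul_test {f ψ : Space d → ℝ} (hf : LocallyIntegrable f volume)
    (hψ : Continuous ψ) (hc : HasCompactSupport ψ) :
    Integrable (fun x => f x * ψ x) volume := by
  have := hf.integrable_smul_right_of_hasCompactSupport hψ hc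
  simpa [smul_eq_mul] using this

theorem HasWeakPartial.congr {i : Fin d} {f f' g g' : Space d → ℝ}
    (h : HasWeakPartial i f g) (hf : f =ᵐ[volume] f') (hg : g =ᵐ[volume] g') :
    HasWeakPartial i f' g' := by
  obtain ⟨h1, h2, h3⟩ := h
  refine ⟨h1.congr hf, h2.congr hg, fun φ hφ hc => ?_⟩
  have e1 : ∫ x, f' x * partialDeriv i φ x = ∫ x, f x * partialDeriv i φ x := by
    refine integral_congr_ae ?_
    filter_upwards [hf] with x hx
    rw [hx]
  have e2 : ∫ x, g' x * φ x = ∫ x, g x * φ x := by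
    refine integral_congr_ae ?_
    filter_upwards [hg] with x hx
    rw [hx]
  rw [e1, e2, h3 φ hφ hc]

theorem HasWeakPartial.add {i : Fin d} {f f' g g' : Space d → ℝ}
    (h : HasWeakPartial i f g) (h' : HasWeakPartial i f' g') :
    HasWeakPartial i (f + f') (g + g') := by
  obtain ⟨h1, h2, h3⟩ := h
  obtain ⟨h1', h2', h3'⟩ := h'
  refine ⟨h1.add h1', h2.add h2', fun φ hφ hc => ?_⟩
  have c := continuous_partialDeriv i hφ
  have k := hasCompactSupport_partialDeriv i hc
  simp only [Pi.add_apply, add_mul]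
  rw [integral_add (integrable_mul_test h1 c k) (integrable_mul_test h1' c k),
    integral_add (integrable_mul_test h2 hφ.continuous hc)
      (integrable_mul_test h2' hφ.continuous hc), h3 φ hφ hc, h3' φ hφ hc]
  ring

theorem HasWeakPartial.const_smul {i : Fin d} {f g : Space d → ℝ} (c : ℝ)
    (h : HasWeakPartial i f g) : HasWeakPartial i (c • f) (c • g) := by
  obtain ⟨h1, h2, h3⟩ := h
  refine ⟨h1.smul c, h2.smul c, fun φ hφ hc => ?_⟩
  simp only [Pi.smul_apply, smul_eq_mul, mul_assoc]
  rw [integral_const_mul, integral_const_mul, h3 φ hφ hc]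
  ring

theorem HasWeakPartial.zero (i : Fin d) :
    HasWeakPartial i (0 : Space d → ℝ) (0 : Space d → ℝ) :=
  ⟨locallyIntegrable_zero, locallyIntegrable_zero, fun φ _ _ => by simp⟩

end WeakDerivativeLemmas

/-- The Sobolev space `H¹(ℝ^d)`: the pairs `(f, ∇f) ∈ L²(ℝ^d) × L²(ℝ^d; ℝ^d)` where `∇f` is the
gradient of `f` in the sense of distributions, with the inner product
`∫ f g + ∫ ∇f · ∇g` inherited from the product. -/
def H1 (d : ℕ) : Submodule ℝ (WithLp 2 (L2 d × L2Vec d)) where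
  carrier := {p | HasWeakGradient (p.fst : Space d → ℝ) (p.snd : Space d → Space d)}
  zero_mem' := by
    intro i
    refine (HasWeakPartial.zero i).congr ?_ ?_
    · exact (Lp.coeFn_zero ℝ 2 (volume : Measure (Space d))).symm
    · filter_upwards [Lp.coeFn_zero (Space d) 2 (volume : Measure (Space d))] with x hx
      change (0 : ℝ) = ((0 : L2Vec d) : Space d → Space d) x i
      rw [hx]
      rfl
  add_mem' := by
    intro p q hp hq i
    refine ((hp i).add (hq i)).congr ?_ ?_
    · exact (Lp.coeFn_add p.fst q.fst).symm
    · filter_upwards [Lp.coeFn_add p.snd q.snd] with x hx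
      change p.snd x i + q.snd x i = ((p.snd + q.snd : L2Vec d) : Space d → Space d) x i
      rw [hx]
      rfl
  smul_mem' := by
    intro c p hp i
    refine ((hp i).const_smul c).congr ?_ ?_
    · exact (Lp.coeFn_smul c p.fst).symm
    · filter_upwards [Lp.coeFn_smul c p.snd] with x hx
      change c • (p.snd x i) = ((c • p.snd : L2Vec d) : Space d → Space d) x i
      rw [hx]
      rfl

/-- The inclusion `H¹(ℝ^d) ⊂ L²(ℝ^d)`. -/
def H1.toL2 (d : ℕ) : H1 d →L[ℝ] L2 d :=
  (WithLp.fstL 2 ℝ (L2 d) (L2Vec d)).comp (H1 d).subtypeL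

/-- The weak gradient of an element of `H¹(ℝ^d)`. -/
def H1.grad {d : ℕ} (f : H1 d) : L2Vec d := f.1.snd

/-- `H⁻¹(ℝ^d)`, the dual of `H¹(ℝ^d)`. -/
abbrev HNeg (d : ℕ) : Type := H1 d →L[ℝ] ℝ

/-- The inclusion `L²(ℝ^d) ⊂ H⁻¹(ℝ^d)` of the Gelfand triple: `f` acts by `φ ↦ ∫ f φ`. -/
def toHNeg {d : ℕ} (f : L2 d) : HNeg d := (innerSL ℝ f).comp (H1.toL2 d)

/-- `g` is the derivative `dρ/dt` of `ρ ∈ L²(0,T;H¹(ℝ^d)) ∩ W^{1,2}([0,T];H⁻¹(ℝ^d))`. An element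
of this space is given here by its representative in `C([0,T];L²(ℝ^d))`; values of `ρ` outside
`[0,T]` play no role. -/
def HasTimeDeriv {d : ℕ} (T : ℝ) (ρ : ℝ → L2 d) (g : ℝ → HNeg d) : Prop :=
  ContinuousOn ρ (Icc 0 T) ∧
  (∃ r : ℝ → H1 d, MemLp r 2 (volume.restrict (Ioo 0 T)) ∧
    ∀ᵐ t ∂(volume.restrict (Ioo 0 T)), H1.toL2 d (r t) = ρ t) ∧
  MemLp g 2 (volume.restrict (Ioo 0 T)) ∧
  ∀ t ∈ Icc 0 T, toHNeg (ρ t) = toHNeg (ρ 0) + ∫ τ in (0 : ℝ)..t, g τ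

/-- `f ∈ C_b²([0,T] × ℝ^d × [0,∞))`: `f` is `C²` up to the boundary and is bounded together with
its derivatives up to order two. -/
def MemCb2 {d : ℕ} (T : ℝ) (f : ℝ × Space d × ℝ → ℝ) : Prop :=
  ContDiffOn ℝ 2 f (Icc 0 T ×ˢ univ ×ˢ Ici 0) ∧
  ∃ C : ℝ, ∀ k : ℕ, k ≤ 2 → ∀ p ∈ (Icc 0 T ×ˢ univ ×ˢ Ici 0 : Set (ℝ × Space d × ℝ)),
    ‖iteratedFDerivWithin ℝ k f (Icc 0 T ×ˢ univ ×ˢ Ici 0) p‖ ≤ C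

/-- `L²(ω)`. -/
abbrev L2On {d : ℕ} (ω : Set (Space d)) : Type := Lp ℝ 2 (volume.restrict ω)

/-- The extension of `u ∈ L²(ω)` by `0` outside `ω`. -/
def extend {d : ℕ} {ω : Set (Space d)} (u : L2On ω) : Space d → ℝ :=
  ω.indicator (u : Space d → ℝ)

/-- The set `𝒰` of admissible controls. -/
def admissible {d : ℕ} (ω : Set (Space d)) (M₀ : ℝ) : Set (L2On ω) :=
  {u | ∀ᵐ x ∂(volume.restrict ω), u x ∈ Icc 0 M₀}

/-- `(S u)(x) = ∫ K (x - x') u(x') dx'`. -/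
def S {d : ℕ} {ω : Set (Space d)} (K : Space d → ℝ) (u : L2On ω) (x : Space d) : ℝ :=
  ∫ x', K (x - x') * extend u x'

/-- `q_{ij} = σ_{il} σ_{jl}`. -/
def diffusion {d N : ℕ} (σ : ℝ × Space d × ℝ → Matrix (Fin d) (Fin N) ℝ) (i j : Fin d)
    (p : ℝ × Space d × ℝ) : ℝ :=
  ∑ l, σ p i l * σ p j l

/-- `ρ` is a weak solution of
`∂_t ρ = -∇·(b(t,x,(Su)(x)) ρ) + ½ ∂²_{ij}(q_{ij}(t,x,(Su)(x)) ρ)`, `ρ(0) = ρ₀`.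
Here `D i j` is the weak derivative `∂_j (q_{ij}(t,·,Su) ρ(t))`. -/
def IsWeakSolution {d N : ℕ} {ω : Set (Space d)} (T : ℝ) (K : Space d → ℝ)
    (b : ℝ × Space d × ℝ → Space d) (σ : ℝ × Space d × ℝ → Matrix (Fin d) (Fin N) ℝ)
    (ρ₀ : Space d → ℝ) (u : L2On ω) (ρ : ℝ → L2 d) : Prop :=
  (∃ g : ℝ → HNeg d, HasTimeDeriv T ρ g ∧
    ∀ᵐ t ∂(volume.restrict (Ioo 0 T)), ∃ D : Fin d → Fin d → Space d → ℝ,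
      (∀ i j, MemLp (D i j) 2 volume ∧
        HasWeakPartial j (fun x => diffusion σ i j (t, x, S K u x) * ρ t x) (D i j)) ∧
      ∀ φ : H1 d,
        g t φ = (∫ x, inner ℝ (ρ t x • b (t, x, S K u x)) (H1.grad φ x))
          - (1 / 2) * ∑ i, ∑ j, ∫ x, D i j x * H1.grad φ x i) ∧
  (ρ 0 : Space d → ℝ) =ᵐ[volume] ρ₀

/-- The cost `∫₀ᵀ∫ G ρ + ∫ G_T ρ(T) + ∫_A h(u)`, where `u` is extended by `0`. The penalty
integrates a nonnegative function, so its value lies in `[0,∞]`. -/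
def cost {d : ℕ} {ω : Set (Space d)} (T : ℝ) (G : ℝ × Space d → ℝ) (GT : Space d → ℝ)
    (h : ℝ → ℝ) (A : Set (Space d)) (u : L2On ω) (ρ : ℝ → L2 d) : EReal :=
  (((∫ t in (0 : ℝ)..T, ∫ x, G (t, x) * ρ t x) + ∫ x, GT x * ρ T x : ℝ) : EReal)
    + ((∫⁻ x in A, ENNReal.ofReal (h (extend u x)) : ℝ≥0∞) : EReal)

end FPControl

end

/-! The proof is the direct method. The set of controls is bounded, closed and convex in the Hilbert
space `L2On ω`, so a minimizing sequence has a weakly convergent subsequence with admissible limit.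
The penalty over `ω` has closed convex sublevel sets, hence is weakly lower semicontinuous. What
remains is that the state depends continuously on the control when controls carry the weak topology
and states the topology of uniform convergence in time with values in L².

That continuity rests on the smoothing by `K`. For fixed `x`, the kernel `K (x - ·)` and its weak
partial derivatives are integrable on the bounded set `ω`, and controls are bounded by `M₀`; weak
convergence of controls therefore gives pointwise convergence of `S K u` and of its gradient. The
function `S K u` is C¹ although `K` is only Sobolev, so the product rule turns the equation into
divergence form with flux `ρ c + B ∇ρ`, where `c = -b + ½ ∂_j q_{ij}` and `B = ½ q`. These
coefficients are bounded uniformly in the control and converge almost everywhere. Dominated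
convergence yields, at almost every time, `A_n v → A v` in H¹ for each fixed `v`, where `A` is the
operator of the bilinear form, the dual of H¹ being identified with H¹ by Riesz.

The state equation becomes `ι* ρ(t) = ι* ρ₀ - ∫₀ᵗ A w`, with `ι : H¹ → L²` and `ι w = ρ` almost
everywhere. Existence comes from Lions' projection theorem together with Steklov averages, which
produce the representative continuous in L² and the energy identity
(`exists_continuous_representative`). The Gårding inequality, Young and Gronwall then bound `‖ρ -
ρ'‖²` by a multiple of `∫ ‖(A - A') w'‖²` (`IsVariationalSolution.norm_sub_sq_le`). With `A = A'`
this is uniqueness. With `A = A_n` and `w'` the fixed limit solution, strong convergence of the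
operators suffices, and no compactness of the states is needed.

Over the whole space the penalty gains the integral of `h 0` over the complement of `ω`, which may
be infinite but is the same for all controls; so one minimizer serves both costs. -/

noncomputable section

namespace FPControl

open Filter Topology
open scoped Convolution

/-! ### Steklov averages in time and their convergence in L². -/

section Steklov

variable {E : Type*} [NormedAddCommGroup E]

/-- Composition with measure preserving maps is continuous on L² jointly in the function and the
map; the translations are curried into a continuous family so that this applies. -/
theorem tendsto_eLpNorm_translate_sub {f : ℝ → E} (hf : MemLp f 2 volume) :
    Tendsto (fun s : ℝ => eLpNorm (fun t => f (t + s) - f t) 2 volume) (𝓝 0) (𝓝 0) := by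
  let g : C(ℝ, C(ℝ, ℝ)) := (ContinuousMap.mk (fun p : ℝ × ℝ => p.2 + p.1) (by fun_prop)).curry
  have hg : ∀ s, MeasurePreserving (g s) volume volume := fun s =>
    measurePreserving_add_right volume s
  have hlim := (tendsto_const_nhds (x := hf.toLp f) (f := 𝓝 (0 : ℝ))).compMeasurePreservingLp
    (g.continuous.tendsto 0) hg (hg 0) (by simp)
  have h0 : Lp.compMeasurePreserving (g 0) (hg 0) (hf.toLp f) = hf.toLp f := by
    refine Lp.ext ?_
    refine (Lp.coeFn_compMeasurePreserving _ (hg 0)).trans ?_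
    refine Eventually.of_forall fun t => ?_
    simp [g]
  rw [h0, tendsto_iff_edist_tendsto_0] at hlim
  refine hlim.congr fun s => ?_
  rw [Lp.edist_def]
  refine eLpNorm_congr_ae ?_
  have h1 := Lp.coeFn_compMeasurePreserving (hf.toLp f) (hg s)
  have h2 := (hg s).quasiMeasurePreserving.ae_eq_comp (hf.coeFn_toLp)
  filter_upwards [h1, h2, hf.coeFn_toLp] with t h1 h2 h3
  simp only [Pi.sub_apply]
  rw [h1, h2, h3]
  rfl

variable [NormedSpace ℝ E]

/-- The forward Steklov average `h⁻¹ ∫_t^{t+h} f`. -/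
def steklov (h : ℝ) (f : ℝ → E) (t : ℝ) : E := h⁻¹ • ∫ s in t..(t + h), f s

theorem steklov_congr_ae {f f' : ℝ → E} (h : ℝ) (hf : f =ᵐ[volume] f') :
    steklov h f = steklov h f' := by
  funext t
  simp only [steklov]
  congr 1
  exact intervalIntegral.integral_congr_ae (hf.mono fun x hx _ => hx)

/-- The error is the mean of `f (t + s) - f t` over `0 < s ≤ h`, and Cauchy–Schwarz bounds the
square of a mean by the mean of the squares. -/
theorem enorm_steklov_sub_sq_le [CompleteSpace E] {f : ℝ → E} (hf : StronglyMeasurable f)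
    (hfi : LocallyIntegrable f volume) {h : ℝ} (hh : 0 < h) (t : ℝ) :
    ‖steklov h f t - f t‖ₑ ^ 2 ≤
      ENNReal.ofReal h⁻¹ * ∫⁻ s in Ioc 0 h, ‖f (t + s) - f t‖ₑ ^ 2 := by
  have hm : StronglyMeasurable (fun s => f (t + s) - f t) :=
    (hf.comp_measurable (measurable_const_add t)).sub stronglyMeasurable_const
  have e1 : steklov h f t - f t = h⁻¹ • ∫ s in (0 : ℝ)..h, (f (t + s) - f t) := by
    rw [intervalIntegral.integral_sub, intervalIntegral.integral_comp_add_left (fun s => f s),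
      intervalIntegral.integral_const, smul_sub, steklov, smul_smul, add_zero, sub_zero,
      inv_mul_cancel₀ hh.ne', one_smul]
    · have := (hfi.integrableOn_isCompact (isCompact_uIcc (a := t) (b := t + h))).intervalIntegrable.comp_add_left t
      simpa using this
    · exact intervalIntegrable_const
  have e2 : ‖steklov h f t - f t‖ₑ ≤
      ENNReal.ofReal h⁻¹ * ∫⁻ s in Ioc 0 h, ‖f (t + s) - f t‖ₑ := by
    rw [e1, enorm_smul, intervalIntegral.integral_of_le hh.le]
    gcongr
    · rw [← ofReal_norm, Real.norm_of_nonneg (inv_nonneg.2 hh.le)]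
    · exact enorm_integral_le_lintegral_enorm _
  have e3 : (∫⁻ s in Ioc 0 h, ‖f (t + s) - f t‖ₑ) ^ 2 ≤
      ENNReal.ofReal h * ∫⁻ s in Ioc 0 h, ‖f (t + s) - f t‖ₑ ^ 2 := by
    have := eLpNorm_le_eLpNorm_mul_rpow_measure_univ (μ := volume.restrict (Ioc 0 h))
      (p := 1) (q := 2) (by norm_num) hm.aestronglyMeasurable
    rw [eLpNorm_one_eq_lintegral_enorm, eLpNorm_eq_lintegral_rpow_enorm_toReal (by simp) (by simp)]
      at this
    simp only [ENNReal.toReal_ofNat, ENNReal.rpow_ofNat, Measure.restrict_apply_univ,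
      Real.volume_Ioc, sub_zero, ENNReal.toReal_one] at this
    calc _ ≤ _ := pow_le_pow_left' this 2
      _ = _ := by
        rw [mul_pow, ← ENNReal.rpow_natCast, ← ENNReal.rpow_mul, ← ENNReal.rpow_natCast,
          ← ENNReal.rpow_mul, mul_comm]
        norm_num
  calc _ ≤ _ := pow_le_pow_left' e2 2
    _ = ENNReal.ofReal h⁻¹ * ENNReal.ofReal h⁻¹ * (∫⁻ s in Ioc 0 h, ‖f (t + s) - f t‖ₑ) ^ 2 := by
        ring
    _ ≤ ENNReal.ofReal h⁻¹ * ENNReal.ofReal h⁻¹ *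
        (ENNReal.ofReal h * ∫⁻ s in Ioc 0 h, ‖f (t + s) - f t‖ₑ ^ 2) := by gcongr
    _ = ENNReal.ofReal h⁻¹ * (ENNReal.ofReal h⁻¹ * ENNReal.ofReal h) *
          ∫⁻ s in Ioc 0 h, ‖f (t + s) - f t‖ₑ ^ 2 := by ring
    _ = _ := by
      rw [← ENNReal.ofReal_mul (inv_nonneg.2 hh.le), inv_mul_cancel₀ hh.ne']
      simp

/-- Integrating the pointwise bound in `t` and exchanging integrals bounds the error by the largest
translation error over shifts at most `h`. -/
theorem tendsto_eLpNorm_steklov_sub [CompleteSpace E] {f : ℝ → E} (hf : MemLp f 2 volume) :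
    Tendsto (fun h : ℝ => eLpNorm (fun t => steklov h f t - f t) 2 volume) (𝓝[>] 0) (𝓝 0) := by
  -- Averages ignore null sets, so a strongly measurable representative may be used; Tonelli needs
  -- the joint measurability of `f (t + s) - f t`.
  wlog hfm : StronglyMeasurable f generalizing f
  · obtain ⟨f', hf'm, hff'⟩ := hf.1
    have := this ((memLp_congr_ae hff').1 hf) hf'm
    refine this.congr fun h => ?_
    rw [steklov_congr_ae h hff']
    refine eLpNorm_congr_ae (hff'.mono fun x hx => ?_)
    simp only [hx]
  have hfi : LocallyIntegrable f volume := hf.locallyIntegrable (by norm_num)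
  rw [ENNReal.tendsto_nhds_zero]
  intro ε hε
  have h1 : ∀ᶠ s : ℝ in 𝓝 0, eLpNorm (fun t => f (t + s) - f t) 2 volume ≤ ε :=
    ENNReal.tendsto_nhds_zero.1 (tendsto_eLpNorm_translate_sub hf) ε hε
  obtain ⟨δ, hδ, hb⟩ := Metric.eventually_nhds_iff.1 h1
  have h2 : ∀ᶠ h : ℝ in 𝓝[>] (0 : ℝ), h ∈ Ioo (0 : ℝ) δ :=
    Ioo_mem_nhdsGT hδ
  filter_upwards [h2] with h hh
  rw [eLpNorm_eq_lintegral_rpow_enorm_toReal (by simp) (by simp)]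
  simp only [ENNReal.toReal_ofNat, ENNReal.rpow_ofNat]
  have hu : StronglyMeasurable (fun p : ℝ × ℝ => f (p.1 + p.2) - f p.1) :=
    (hfm.comp_measurable (measurable_fst.add measurable_snd)).sub
      (hfm.comp_measurable measurable_fst)
  have key : ∫⁻ t, ‖steklov h f t - f t‖ₑ ^ 2 ≤ ε ^ 2 := by
    calc ∫⁻ t, ‖steklov h f t - f t‖ₑ ^ 2
        ≤ ∫⁻ t, ENNReal.ofReal h⁻¹ * ∫⁻ s in Ioc 0 h, ‖f (t + s) - f t‖ₑ ^ 2 :=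
          lintegral_mono fun t => enorm_steklov_sub_sq_le hfm hfi hh.1 t
      _ = ENNReal.ofReal h⁻¹ * ∫⁻ t, ∫⁻ s in Ioc 0 h, ‖f (t + s) - f t‖ₑ ^ 2 := by
          rw [lintegral_const_mul' _ _ (by simp)]
      _ = ENNReal.ofReal h⁻¹ * ∫⁻ s in Ioc 0 h, ∫⁻ t, ‖f (t + s) - f t‖ₑ ^ 2 := by
          rw [lintegral_lintegral_swap]
          exact (hu.enorm.pow_const 2).aemeasurable
      _ ≤ ENNReal.ofReal h⁻¹ * ∫⁻ s in Ioc 0 h, ε ^ 2 := by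
          refine mul_le_mul_right ?_ _
          refine setLIntegral_mono' measurableSet_Ioc fun s hs => ?_
          have := hb (y := s) (by
            rw [dist_zero_right, Real.norm_of_nonneg hs.1.le]; exact hs.2.trans_lt hh.2)
          rw [eLpNorm_eq_lintegral_rpow_enorm_toReal (by simp) (by simp)] at this
          simp only [ENNReal.toReal_ofNat, ENNReal.rpow_ofNat] at this
          have h3 := pow_le_pow_left' this 2
          rw [← ENNReal.rpow_natCast, ← ENNReal.rpow_mul] at h3
          norm_num at h3
          exact h3
      _ = ε ^ 2 := by
          rw [setLIntegral_const, Real.volume_Ioc, sub_zero, mul_comm (ε ^ 2), ← mul_assoc,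
            ← ENNReal.ofReal_mul (inv_nonneg.2 hh.1.le), inv_mul_cancel₀ hh.1.ne']
          simp
  calc _ ≤ (ε ^ 2) ^ (1 / 2 : ℝ) := by gcongr
    _ = ε := by
      rw [← ENNReal.rpow_natCast, ← ENNReal.rpow_mul]; norm_num

theorem continuous_steklov [CompleteSpace E] {f : ℝ → E} (hf : LocallyIntegrable f volume) (h : ℝ) :
    Continuous (steklov h f) := by
  have hi : ∀ a b, IntervalIntegrable f volume a b := fun a b =>
    (hf.integrableOn_isCompact isCompact_uIcc).intervalIntegrable
  have e : steklov h f = fun t => h⁻¹ • ((∫ s in (0 : ℝ)..(t + h), f s) - ∫ s in (0 : ℝ)..t, f s) := by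
    funext t
    rw [intervalIntegral.integral_interval_sub_left (hi _ _) (hi _ _)]
    rfl
  rw [e]
  have := intervalIntegral.continuous_primitive hi 0
  exact ((this.comp (continuous_id.add continuous_const)).sub this).const_smul _

end Steklov

/-! ### Continuous representatives and the energy identity. -/

section LionsMagenes

/-- Only small steps are used later, so integrability is read off the convergence: once the error
has finite norm, the average is `f` plus an L² function. -/
theorem exists_memLp_steklov {E : Type*} [NormedAddCommGroup E] [NormedSpace ℝ E] [CompleteSpace E]
    {f : ℝ → E} (hf : MemLp f 2 volume) :
    ∃ δ > 0, ∀ h ∈ Ioo (0 : ℝ) δ, MemLp (steklov h f) 2 volume := by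
  have h1 : ∀ᶠ h : ℝ in 𝓝[>] 0, eLpNorm (fun t => steklov h f t - f t) 2 volume < 1 :=
    (tendsto_eLpNorm_steklov_sub hf).eventually_lt_const (by norm_num)
  obtain ⟨δ, hδ, hb⟩ := mem_nhdsGT_iff_exists_Ioo_subset.1 h1
  refine ⟨δ, hδ, fun h hh => ?_⟩
  have hm : AEStronglyMeasurable (steklov h f) volume :=
    (continuous_steklov (hf.locallyIntegrable (by norm_num)) h).aestronglyMeasurable
  have h2 : MemLp (fun t => steklov h f t - f t) 2 volume :=
    ⟨hm.sub hf.1, (hb hh).trans (by norm_num)⟩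
  have := h2.add hf
  refine (memLp_congr_ae (Eventually.of_forall fun t => ?_)).1 this
  simp

variable {V H : Type*} [NormedAddCommGroup V] [InnerProductSpace ℝ V] [CompleteSpace V]
  [NormedAddCommGroup H] [InnerProductSpace ℝ H] [CompleteSpace H] (ι : V →L[ℝ] H)

/-- By symmetry, `‖ι a‖² - ‖ι b‖² = ⟪ι*ι a - ι*ι b, a + b⟫`. Hence `w` need only be continuous in
`V`; differentiability is required only of its image `ι*ι w` in the dual. -/
theorem hasDerivAt_norm_sq_of_dual {w : ℝ → V} {G : V} {t : ℝ} (hw : ContinuousAt w t)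
    (hd : HasDerivAt (fun s => ι.adjoint (ι (w s))) G t) :
    HasDerivAt (fun s => ‖ι (w s)‖ ^ 2) (2 * inner ℝ G (w t)) t := by
  rw [hasDerivAt_iff_tendsto_slope] at hd ⊢
  have h1 : Tendsto (fun s => w s + w t) (𝓝[≠] t) (𝓝 (w t + w t)) :=
    (hw.tendsto.mono_left nhdsWithin_le_nhds).add tendsto_const_nhds
  have h2 := hd.inner h1 (𝕜 := ℝ)
  have e : (2 : ℝ) * inner ℝ G (w t) = inner ℝ G (w t + w t) := by
    rw [inner_add_right]; ring
  rw [e]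
  refine h2.congr fun s => ?_
  simp only [slope_def_module, inner_smul_left, RCLike.conj_to_real, smul_eq_mul]
  congr 1
  rw [← map_sub, ContinuousLinearMap.adjoint_inner_left, map_add, inner_add_right, inner_sub_left,
    inner_sub_left, real_inner_self_eq_norm_sq, real_inner_self_eq_norm_sq,
    real_inner_comm (ι (w t)) (ι (w s))]
  ring

variable {ι} {w g : ℝ → V} {W₀ : V} {T : ℝ}

/-- Averaging commutes with `ι*ι`, so the averaged function is a difference quotient of a primitive
of the continuous function `W`, which is classically differentiable. The restriction `t < T - h`
keeps the forward window inside `(0,T)`. -/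
theorem hasDerivAt_adjoint_steklov (hw : MemLp w 2 volume) (hg : MemLp g 2 volume)
    (hW : ∀ᵐ t ∂(volume.restrict (Ioo 0 T)), ι.adjoint (ι (w t)) = W₀ + ∫ τ in (0 : ℝ)..t, g τ)
    {h : ℝ} (hh : 0 < h) {t : ℝ} (ht : t ∈ Ioo 0 (T - h)) :
    HasDerivAt (fun s => ι.adjoint (ι (steklov h w s))) (steklov h g t) t := by
  have hwi : ∀ a b, IntervalIntegrable w volume a b := fun a b =>
    ((hw.locallyIntegrable (by norm_num)).integrableOn_isCompact isCompact_uIcc).intervalIntegrable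
  have hgi : ∀ a b, IntervalIntegrable g volume a b := fun a b =>
    ((hg.locallyIntegrable (by norm_num)).integrableOn_isCompact isCompact_uIcc).intervalIntegrable
  set W : ℝ → V := fun t => W₀ + ∫ τ in (0 : ℝ)..t, g τ with hWdef
  have hWc : Continuous W := continuous_const.add (intervalIntegral.continuous_primitive hgi 0)
  have hWi : ∀ a b, IntervalIntegrable W volume a b := fun a b => hWc.intervalIntegrable _ _
  have e1 : (fun s => ι.adjoint (ι (steklov h w s))) =ᶠ[𝓝 t]
      fun s => h⁻¹ • ((∫ τ in (0 : ℝ)..(s + h), W τ) - ∫ τ in (0 : ℝ)..s, W τ) := by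
    filter_upwards [Ioo_mem_nhds ht.1 ht.2] with s hs
    rw [intervalIntegral.integral_interval_sub_left (hWi _ _) (hWi _ _), steklov, map_smul, map_smul,
      ← ContinuousLinearMap.comp_apply, ← ContinuousLinearMap.intervalIntegral_comp_comm _ (hwi _ _)]
    congr 1
    refine intervalIntegral.integral_congr_ae ?_
    rw [ae_restrict_iff' measurableSet_Ioo] at hW
    filter_upwards [hW, Measure.ae_ne volume T] with τ hτ hne hmem
    rw [uIoc_of_le (by linarith)] at hmem
    exact hτ ⟨hs.1.trans hmem.1, lt_of_le_of_ne (hmem.2.trans (by linarith [hs.2])) hne⟩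
  refine HasDerivAt.congr_of_eventuallyEq ?_ e1
  have d1 : ∀ s, HasDerivAt (fun s => ∫ τ in (0 : ℝ)..s, W τ) (W s) s := fun s =>
    intervalIntegral.integral_hasDerivAt_right (hWi _ _)
      (hWc.stronglyMeasurableAtFilter _ _) hWc.continuousAt
  have d2 : HasDerivAt (fun s => ∫ τ in (0 : ℝ)..(s + h), W τ) (W (t + h)) t :=
    (d1 (t + h)).comp_add_const t h
  have e2 : steklov h g t = h⁻¹ • (W (t + h) - W t) := by
    simp only [hWdef, steklov, add_sub_add_left_eq_sub]
    rw [intervalIntegral.integral_interval_sub_left (hgi _ _) (hgi _ _)]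
  rw [e2]
  exact (d2.sub (d1 t)).const_smul _

theorem norm_sq_sub_eq_integral {z G : ℝ → V} (hz : Continuous z) (hG : Continuous G)
    (hd : ∀ t ∈ Ioo 0 T, HasDerivAt (fun s => ι.adjoint (ι (z s))) (G t) t)
    {s t : ℝ} (hs : s ∈ Icc 0 T) (ht : t ∈ Icc 0 T) :
    ‖ι (z t)‖ ^ 2 - ‖ι (z s)‖ ^ 2 = ∫ τ in s..t, 2 * inner ℝ (G τ) (z τ) := by
  refine (intervalIntegral.integral_eq_sub_of_hasDeriv_right
    (((ι.continuous.comp hz).norm.pow 2).continuousOn) (fun x hx => ?_) ?_).symm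
  · exact (hasDerivAt_norm_sq_of_dual ι hz.continuousAt (hd x
      ⟨(le_min hs.1 ht.1).trans_lt hx.1, hx.2.trans_le (max_le hs.2 ht.2)⟩)).hasDerivWithinAt
  · exact ((hG.inner hz).const_mul 2).intervalIntegrable _ _ 

theorem integral_norm_sq_eq {E : Type*} [NormedAddCommGroup E] [InnerProductSpace ℝ E]
    {α : Type*} [MeasurableSpace α] {μ : Measure α} {f : α → E} (hf : MemLp f 2 μ) :
    ∫ a, ‖f a‖ ^ 2 ∂μ = ‖hf.toLp‖ ^ 2 := by
  rw [← real_inner_self_eq_norm_sq, L2.inner_def]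
  refine integral_congr_ae (hf.coeFn_toLp.mono fun a ha => ?_)
  simp only [ha, real_inner_self_eq_norm_sq]

theorem integrable_norm_sq {E : Type*} [NormedAddCommGroup E]
    {α : Type*} [MeasurableSpace α] {μ : Measure α} {f : α → E} (hf : MemLp f 2 μ) :
    Integrable (fun a => ‖f a‖ ^ 2) μ := hf.integrable_norm_pow (by norm_num)

/-- The sup norm in `H` is controlled by the `L²` norms of the function and of its derivative. -/
theorem mul_norm_sq_le {z G : ℝ → V} (hz : Continuous z) (hG : Continuous G)
    (hzm : MemLp z 2 volume) (hGm : MemLp G 2 volume) (hT : 0 < T)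
    (hd : ∀ t ∈ Ioo 0 T, HasDerivAt (fun s => ι.adjoint (ι (z s))) (G t) t)
    {t : ℝ} (ht : t ∈ Icc 0 T) :
    T * ‖ι (z t)‖ ^ 2 ≤ ‖ι‖ ^ 2 * ‖hzm.toLp‖ ^ 2 + T * (‖hGm.toLp‖ ^ 2 + ‖hzm.toLp‖ ^ 2) := by
  set C := ‖hGm.toLp‖ ^ 2 + ‖hzm.toLp‖ ^ 2
  have hi : Integrable (fun τ => ‖G τ‖ ^ 2 + ‖z τ‖ ^ 2) volume :=
    (integrable_norm_sq hGm).add (integrable_norm_sq hzm)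
  have hC : ∫ τ, (‖G τ‖ ^ 2 + ‖z τ‖ ^ 2) = C := by
    rw [integral_add (integrable_norm_sq hGm) (integrable_norm_sq hzm), integral_norm_sq_eq hGm,
      integral_norm_sq_eq hzm]
  -- The value at `t` is compared with the value at every `s` through the energy identity and
  -- `2⟪G,z⟫ ≤ ‖G‖² + ‖z‖²`; averaging over `s` then removes the need for an initial value.
  have h1 : ∀ s ∈ Icc 0 T, ‖ι (z t)‖ ^ 2 ≤ ‖ι‖ ^ 2 * ‖z s‖ ^ 2 + C := by
    intro s hs
    have h2 := norm_sq_sub_eq_integral hz hG hd hs ht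
    have h3 : ‖∫ τ in s..t, 2 * inner ℝ (G τ) (z τ)‖ ≤ C := by
      rw [← hC, intervalIntegral.norm_intervalIntegral_eq]
      refine (norm_integral_le_integral_norm _).trans ?_
      refine (setIntegral_mono_on ?_ hi.integrableOn measurableSet_uIoc
        (fun τ _ => ?_)).trans (setIntegral_le_integral hi
          (Eventually.of_forall fun τ => by positivity))
      · exact (((hG.inner hz).const_mul 2).norm.integrableOn_uIcc).mono_set uIoc_subset_uIcc
      · rw [norm_mul, Real.norm_ofNat]
        have := norm_inner_le_norm (𝕜 := ℝ) (G τ) (z τ)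
        nlinarith [sq_nonneg (‖G τ‖ - ‖z τ‖)]
    have h4 : ‖ι (z s)‖ ^ 2 ≤ ‖ι‖ ^ 2 * ‖z s‖ ^ 2 := by
      rw [← mul_pow]; exact pow_le_pow_left₀ (norm_nonneg _) (ι.le_opNorm _) 2
    have h5 := (le_abs_self _).trans h3
    linarith
  have h2 : ∫ s in Icc 0 T, ‖ι (z t)‖ ^ 2 ≤ ∫ s in Icc 0 T, (‖ι‖ ^ 2 * ‖z s‖ ^ 2 + C) :=
    setIntegral_mono_on (integrableOn_const (by simp)) (((hz.norm.pow 2).const_mul _).add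
      continuous_const).integrableOn_Icc measurableSet_Icc h1
  have h3 : ∫ s in Icc 0 T, (‖ι‖ ^ 2 * ‖z s‖ ^ 2 + C) = ‖ι‖ ^ 2 * (∫ s in Icc 0 T, ‖z s‖ ^ 2) + T * C := by
    have hzi : IntegrableOn (fun s => ‖ι‖ ^ 2 * ‖z s‖ ^ 2) (Icc 0 T) volume :=
      ((hz.norm.pow 2).const_mul _).integrableOn_Icc
    rw [integral_add hzi (integrableOn_const (by simp)), integral_const_mul]
    simp [hT.le]
  have h4 : ∫ s in Icc 0 T, ‖z s‖ ^ 2 ≤ ‖hzm.toLp‖ ^ 2 := by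
    rw [← integral_norm_sq_eq hzm]
    exact setIntegral_le_integral (integrable_norm_sq hzm)
      (Eventually.of_forall fun τ => by positivity)
  rw [h3] at h2
  simp only [integral_const, MeasurableSet.univ, measureReal_restrict_apply, univ_inter,
    Real.volume_real_Icc_of_le hT.le, sub_zero, smul_eq_mul] at h2
  nlinarith [mul_le_mul_of_nonneg_left h4 (sq_nonneg ‖ι‖)]

/-- A square integrable `w` with values in `V` whose image in the dual of `V` has a square
integrable derivative has a representative which is continuous with values in `H`, and satisfies
the energy identity. -/
theorem exists_continuous_representative (hw : MemLp w 2 volume) (hg : MemLp g 2 volume)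
    (hW : ∀ᵐ t ∂(volume.restrict (Ioo 0 T)), ι.adjoint (ι (w t)) = W₀ + ∫ τ in (0 : ℝ)..t, g τ)
    {T' : ℝ} (hT' : 0 < T') (hTT' : T' < T) :
    ∃ ρ : ℝ → H, ContinuousOn ρ (Icc 0 T') ∧
      (∀ᵐ t ∂(volume.restrict (Ioo 0 T')), ι (w t) = ρ t) ∧
      (∀ t ∈ Icc 0 T', ι.adjoint (ρ t) = W₀ + ∫ τ in (0 : ℝ)..t, g τ) ∧
      ∀ t ∈ Icc 0 T', ‖ρ t‖ ^ 2 = ‖ρ 0‖ ^ 2 + 2 * ∫ τ in (0 : ℝ)..t, inner ℝ (g τ) (w τ) := by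
  have hwl := hw.locallyIntegrable (by norm_num)
  have hgl := hg.locallyIntegrable (by norm_num)
  obtain ⟨δ₁, hδ₁, hm₁⟩ := exists_memLp_steklov hw
  obtain ⟨δ₂, hδ₂, hm₂⟩ := exists_memLp_steklov hg
  -- Besides integrability of both averages, `h < T - T'` makes the averaged equation valid on all
  -- of `(0,T')`.
  obtain ⟨δ, hδ, hδa⟩ : ∃ δ > 0, δ ≤ δ₁ ∧ δ ≤ δ₂ ∧ δ ≤ T - T' :=
    ⟨min δ₁ (min δ₂ (T - T')), lt_min hδ₁ (lt_min hδ₂ (by linarith)), min_le_left _ _,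
      (min_le_right _ _).trans (min_le_left _ _), (min_le_right _ _).trans (min_le_right _ _)⟩
  obtain ⟨hδ1, hδ2, hδ3⟩ := hδa
  -- a sequence of steps along which the averages converge almost everywhere
  obtain ⟨h, hh0, hhδ, hlim, hae⟩ : ∃ h : ℕ → ℝ, (∀ n, 0 < h n) ∧ (∀ n, h n < δ) ∧
      Tendsto h atTop (𝓝[>] 0) ∧
      ∀ᵐ t, Tendsto (fun n => steklov (h n) w t) atTop (𝓝 (w t)) := by
    obtain ⟨h, -, hh, hlim⟩ := exists_seq_strictAnti_tendsto' (x := (0 : ℝ)) hδ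
    have hlim' : Tendsto h atTop (𝓝[>] 0) :=
      tendsto_nhdsWithin_iff.2 ⟨hlim, Eventually.of_forall fun n => (hh n).1⟩
    have := (tendsto_eLpNorm_steklov_sub hw).comp hlim'
    obtain ⟨ns, hns, hns'⟩ := (tendstoInMeasure_of_tendsto_eLpNorm (p := 2) (by norm_num)
      (f := fun n => steklov (h n) w) (fun n => (continuous_steklov hwl _).aestronglyMeasurable)
      hw.1 this).exists_seq_tendsto_ae
    exact ⟨h ∘ ns, fun n => (hh _).1, fun n => (hh _).2, hlim'.comp hns.tendsto_atTop, hns'⟩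
  have hmw : ∀ n, MemLp (steklov (h n) w) 2 volume := fun n =>
    hm₁ _ ⟨hh0 n, (hhδ n).trans_le hδ1⟩
  have hmg : ∀ n, MemLp (steklov (h n) g) 2 volume := fun n =>
    hm₂ _ ⟨hh0 n, (hhδ n).trans_le hδ2⟩
  have hcw : ∀ n, Continuous (steklov (h n) w) := fun n => continuous_steklov hwl _
  have hcg : ∀ n, Continuous (steklov (h n) g) := fun n => continuous_steklov hgl _
  have hder : ∀ n, ∀ t ∈ Ioo 0 T', HasDerivAt (fun s => ι.adjoint (ι (steklov (h n) w s)))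
      (steklov (h n) g t) t := fun n t ht =>
    hasDerivAt_adjoint_steklov hw hg hW (hh0 n) ⟨ht.1, by linarith [ht.2, hhδ n]⟩
  have hLw : Tendsto (fun n => (hmw n).toLp) atTop (𝓝 hw.toLp) :=
    (Lp.tendsto_Lp_iff_tendsto_eLpNorm'' _ hmw _ hw).2
      ((tendsto_eLpNorm_steklov_sub hw).comp hlim)
  have hLg : Tendsto (fun n => (hmg n).toLp) atTop (𝓝 hg.toLp) :=
    (Lp.tendsto_Lp_iff_tendsto_eLpNorm'' _ hmg _ hg).2
      ((tendsto_eLpNorm_steklov_sub hg).comp hlim)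
  have hcauchy : UniformCauchySeqOn (fun n t => ι (steklov (h n) w t)) atTop (Icc 0 T') := by
    rw [Metric.uniformCauchySeqOn_iff]
    intro ε hε
    have hε2 : 0 < T' * ε ^ 2 / (‖ι‖ ^ 2 + 2 * T') := by positivity
    -- `mul_norm_sq_le` with both L² norms equal to `η` has right side `η² (‖ι‖² + 2T')`, which is
    -- made equal to `T' ε²`.
    set η := Real.sqrt (T' * ε ^ 2 / (‖ι‖ ^ 2 + 2 * T')) with hη
    have hη0 : 0 < η := Real.sqrt_pos.2 hε2
    have hη2 : η ^ 2 * (‖ι‖ ^ 2 + 2 * T') = T' * ε ^ 2 := by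
      rw [hη, Real.sq_sqrt hε2.le]
      field_simp
    obtain ⟨N₁, hN₁⟩ := Metric.cauchySeq_iff.1 hLw.cauchySeq η hη0
    obtain ⟨N₂, hN₂⟩ := Metric.cauchySeq_iff.1 hLg.cauchySeq η hη0
    refine ⟨max N₁ N₂, fun m hm n hn t ht => ?_⟩
    have k1 := hN₁ m (le_of_max_le_left hm) n (le_of_max_le_left hn)
    have k2 := hN₂ m (le_of_max_le_right hm) n (le_of_max_le_right hn)
    rw [dist_eq_norm, ← MemLp.toLp_sub] at k1 k2
    have k3 := mul_norm_sq_le (ι := ι) ((hcw m).sub (hcw n)) ((hcg m).sub (hcg n))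
      ((hmw m).sub (hmw n)) ((hmg m).sub (hmg n)) hT' (fun t ht => by
        have := (hder m t ht).sub (hder n t ht)
        refine this.congr_of_eventuallyEq (Eventually.of_forall fun s => ?_)
        simp) ht
    have k1' := pow_lt_pow_left₀ k1 (norm_nonneg _) (n := 2) (by norm_num)
    have k2' := pow_lt_pow_left₀ k2 (norm_nonneg _) (n := 2) (by norm_num)
    rw [dist_eq_norm, ← map_sub]
    simp only [Pi.sub_apply] at k3
    have k4 : T' * ‖ι (steklov (h m) w t - steklov (h n) w t)‖ ^ 2 < T' * ε ^ 2 := by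
      rw [← hη2]
      nlinarith [mul_le_mul_of_nonneg_left k1'.le (sq_nonneg ‖ι‖)]
    exact lt_of_pow_lt_pow_left₀ 2 hε.le (lt_of_mul_lt_mul_left k4 hT'.le)
  have hptw : ∀ t, ∃ x, t ∈ Icc 0 T' → Tendsto (fun n => ι (steklov (h n) w t)) atTop (𝓝 x) := by
    intro t
    by_cases ht : t ∈ Icc 0 T'
    · obtain ⟨x, hx⟩ := cauchySeq_tendsto_of_complete (hcauchy.cauchySeq ht)
      exact ⟨x, fun _ => hx⟩
    · exact ⟨0, fun h => absurd h ht⟩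
  choose ρ hρ using hptw
  have hρc : ContinuousOn ρ (Icc 0 T') :=
    (hcauchy.tendstoUniformlyOn_of_tendsto hρ).continuousOn
      (Frequently.of_forall fun n => (ι.continuous.comp (hcw n)).continuousOn)
  have hρae : ∀ᵐ t ∂(volume.restrict (Ioo 0 T')), ι (w t) = ρ t := by
    filter_upwards [ae_restrict_of_ae hae, ae_restrict_mem measurableSet_Ioo] with t h1 h2
    exact tendsto_nhds_unique ((ι.continuous.tendsto _).comp h1) (hρ t (Ioo_subset_Icc_self h2))
  have hgi : ∀ a b, IntervalIntegrable g volume a b := fun a b =>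
    (hgl.integrableOn_isCompact isCompact_uIcc).intervalIntegrable
  refine ⟨ρ, hρc, hρae, ?_, fun t ht => ?_⟩
  -- Both sides are continuous on `[0,T']` and agree almost everywhere, hence everywhere.
  · refine Measure.eqOn_Icc_of_ae_eq volume hT'.ne ?_ (ι.adjoint.continuous.comp_continuousOn hρc)
      (continuous_const.add (intervalIntegral.continuous_primitive hgi 0)).continuousOn
    rw [← restrict_Ioo_eq_restrict_Icc]
    have := ae_restrict_of_ae_restrict_of_subset (Ioo_subset_Ioo_right hTT'.le) hW
    filter_upwards [this, hρae] with t h1 h2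
    rw [← h2, h1]
  · have h0 : (0 : ℝ) ∈ Icc 0 T' := ⟨le_rfl, hT'.le⟩
    -- The averages satisfy the identity classically. The left side converges pointwise, and the
    -- right side is an inner product in `L²(0,t;V)` of two strongly convergent sequences.
    have lim1 := ((hρ t ht).norm.pow 2).sub ((hρ 0 h0).norm.pow 2)
    have hrw : ∀ n, MemLp (steklov (h n) w) 2 (volume.restrict (Ioc 0 t)) := fun n =>
      (hmw n).restrict _
    have hrg : ∀ n, MemLp (steklov (h n) g) 2 (volume.restrict (Ioc 0 t)) := fun n =>
      (hmg n).restrict _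
    have rLw : Tendsto (fun n => (hrw n).toLp) atTop (𝓝 (hw.restrict (Ioc 0 t)).toLp) :=
      (Lp.tendsto_Lp_iff_tendsto_eLpNorm'' _ hrw _ (hw.restrict _)).2
        (tendsto_of_tendsto_of_tendsto_of_le_of_le tendsto_const_nhds
          ((tendsto_eLpNorm_steklov_sub hw).comp hlim) (fun _ => zero_le)
          fun n => eLpNorm_mono_measure _ Measure.restrict_le_self)
    have rLg : Tendsto (fun n => (hrg n).toLp) atTop (𝓝 (hg.restrict (Ioc 0 t)).toLp) :=
      (Lp.tendsto_Lp_iff_tendsto_eLpNorm'' _ hrg _ (hg.restrict _)).2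
        (tendsto_of_tendsto_of_tendsto_of_le_of_le tendsto_const_nhds
          ((tendsto_eLpNorm_steklov_sub hg).comp hlim) (fun _ => zero_le)
          fun n => eLpNorm_mono_measure _ Measure.restrict_le_self)
    have e : ∀ {a b : ℝ → V} (ha : MemLp a 2 (volume.restrict (Ioc 0 t)))
        (hb : MemLp b 2 (volume.restrict (Ioc 0 t))),
        inner ℝ ha.toLp hb.toLp = ∫ τ in (0 : ℝ)..t, inner ℝ (a τ) (b τ) := by
      intro a b ha hb
      rw [L2.inner_def, intervalIntegral.integral_of_le ht.1]
      refine integral_congr_ae ?_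
      filter_upwards [ha.coeFn_toLp, hb.coeFn_toLp] with τ h1 h2
      rw [h1, h2]
    have lim2 := (rLg.inner rLw (𝕜 := ℝ)).const_mul 2
    rw [e] at lim2
    have := tendsto_nhds_unique lim1 (lim2.congr fun n => ?_)
    · linarith
    · rw [e, norm_sq_sub_eq_integral (hcw n) (hcg n) (hder n) h0 ht,
        intervalIntegral.integral_const_mul]

end LionsMagenes

/-! ### Time-dependent coercive operators. -/

section Elliptic

variable {V H : Type*} [NormedAddCommGroup V] [InnerProductSpace ℝ V]
  [NormedAddCommGroup H] [InnerProductSpace ℝ H]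

/-- A measurable family of bounded operators on `V` which is coercive up to a multiple of the norm
of `H`. -/
structure IsElliptic (ι : V →L[ℝ] H) (A : ℝ → V →L[ℝ] V) (M κ c : ℝ) : Prop where
  meas : ∀ v, StronglyMeasurable fun t => A t v
  norm_le : ∀ t, ‖A t‖ ≤ M
  coercive : ∀ t v, c * ‖v‖ ^ 2 ≤ inner ℝ (A t v) v + κ * ‖ι v‖ ^ 2

variable {ι : V →L[ℝ] H} {A : ℝ → V →L[ℝ] V} {M κ c : ℝ}

/-- A Carathéodory argument: measurability in `t` and continuity in `v` give joint measurability
because `V` is separable. -/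
theorem aestronglyMeasurable_apply [SecondCountableTopology V]
    (hA : ∀ v, StronglyMeasurable fun t => A t v) {μ : Measure ℝ}
    {f : ℝ → V} (hf : AEStronglyMeasurable f μ) : AEStronglyMeasurable (fun t => A t (f t)) μ := by
  borelize V
  have h1 : StronglyMeasurable (Function.uncurry fun (v : V) (t : ℝ) => A t v) :=
    stronglyMeasurable_uncurry_of_continuous_of_stronglyMeasurable
      (fun t => (A t).continuous) hA
  obtain ⟨f', hf', hff'⟩ := hf
  refine ⟨fun t => A t (f' t), ?_, hff'.mono fun t ht => by simp only [ht]⟩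
  exact h1.comp_measurable (hf'.measurable.prodMk measurable_id)

theorem memLp_apply [SecondCountableTopology V]
    (hA : ∀ v, StronglyMeasurable fun t => A t v) (hM : ∀ t, ‖A t‖ ≤ M) {μ : Measure ℝ}
    {f : ℝ → V} (hf : MemLp f 2 μ) : MemLp (fun t => A t (f t)) 2 μ := by
  refine hf.of_le_mul (c := M) (aestronglyMeasurable_apply hA hf.1) (Eventually.of_forall fun t => ?_)
  exact (A t).le_of_opNorm_le (hM t) _

variable [SecondCountableTopology V]

/-- The operator on `L²(μ; V)` induced by a measurable bounded family of operators. -/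
def lpOperator (μ : Measure ℝ) (hA : ∀ v, StronglyMeasurable fun t => A t v)
    (hM : ∀ t, ‖A t‖ ≤ M) : Lp V 2 μ →L[ℝ] Lp V 2 μ :=
  LinearMap.mkContinuous
    { toFun := fun f => (memLp_apply hA hM (Lp.memLp f)).toLp
      map_add' := fun f g => by
        rw [← MemLp.toLp_add]
        refine MemLp.toLp_congr _ _ ?_
        filter_upwards [Lp.coeFn_add f g] with t ht
        simp only [ht, Pi.add_apply, map_add]
      map_smul' := fun a f => by
        rw [RingHom.id_apply, ← MemLp.toLp_const_smul]
        refine MemLp.toLp_congr _ _ ?_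
        filter_upwards [Lp.coeFn_smul a f] with t ht
        simp only [ht, Pi.smul_apply, map_smul] } M
    (fun f => by
      refine Lp.norm_le_mul_norm_of_ae_le_mul ?_
      filter_upwards [(memLp_apply hA hM (Lp.memLp f)).coeFn_toLp] with t ht
      simp only [LinearMap.coe_mk, AddHom.coe_mk]
      rw [ht]
      exact (A t).le_of_opNorm_le (hM t) _)

theorem coeFn_lpOperator (μ : Measure ℝ) (hA : ∀ v, StronglyMeasurable fun t => A t v)
    (hM : ∀ t, ‖A t‖ ≤ M) (f : Lp V 2 μ) :
    lpOperator μ hA hM f =ᵐ[μ] fun t => A t (f t) :=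
  (memLp_apply hA hM (Lp.memLp f)).coeFn_toLp

end Elliptic

/-! ### Lions' projection theorem. -/

section Lions

/-- Lions' projection theorem: a functional that is bounded by the image norm of a linear map `K`
is represented through `K`. -/
theorem exists_inner_eq_of_abs_le {X Φ : Type*} [NormedAddCommGroup X] [InnerProductSpace ℝ X]
    [CompleteSpace X] [AddCommGroup Φ] [Module ℝ Φ] (K : Φ →ₗ[ℝ] X) (L : Φ →ₗ[ℝ] ℝ) (C : ℝ)
    (h : ∀ φ, |L φ| ≤ C * ‖K φ‖) : ∃ w : X, ∀ φ, inner ℝ w (K φ) = L φ := by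
  have hker : LinearMap.ker K ≤ LinearMap.ker L := by
    intro φ hφ
    have := h φ
    rw [LinearMap.mem_ker.1 hφ, norm_zero, mul_zero] at this
    exact abs_nonpos_iff.1 this
  let L' : LinearMap.range K →ₗ[ℝ] ℝ :=
    ((LinearMap.ker K).liftQ L hker).comp K.quotKerEquivRange.symm.toLinearMap
  have hL' : ∀ φ, L' ⟨K φ, LinearMap.mem_range_self K φ⟩ = L φ := by
    intro φ
    have : K.quotKerEquivRange.symm ⟨K φ, LinearMap.mem_range_self K φ⟩ =
        (LinearMap.ker K).mkQ φ := by
      rw [LinearEquiv.symm_apply_eq]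
      rfl
    simp only [L', LinearMap.comp_apply, LinearEquiv.coe_coe, this]
    rfl
  let L'' : LinearMap.range K →L[ℝ] ℝ := L'.mkContinuous C (by
    rintro ⟨_, φ, rfl⟩
    rw [hL']
    exact h φ)
  -- The range of `K` need not be closed; Hahn–Banach extends the functional to all of `X`, where
  -- Riesz represents it.
  obtain ⟨g, hg, -⟩ := exists_extension_norm_eq (LinearMap.range K) L''
  refine ⟨(InnerProductSpace.toDual ℝ X).symm g, fun φ => ?_⟩
  rw [InnerProductSpace.toDual_symm_apply]
  exact (hg ⟨K φ, LinearMap.mem_range_self K φ⟩).trans (hL' φ)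

end Lions

/-! ### Test functions with prescribed derivative and zero final value. -/

section Primitive

variable {V : Type*} [NormedAddCommGroup V] 

theorem memLp_Ioo_of_continuous {f : ℝ → V} (hf : Continuous f) (a b : ℝ) (p : ℝ≥0∞) :
    MemLp f p (volume.restrict (Ioo a b)) := by
  obtain ⟨C, hC⟩ := (isCompact_Icc (a := a) (b := b)).exists_bound_of_continuousOn hf.continuousOn
  refine MemLp.of_bound hf.aestronglyMeasurable C ?_
  filter_upwards [ae_restrict_mem measurableSet_Ioo] with t ht using hC t (Ioo_subset_Icc_self ht)

variable [NormedSpace ℝ V]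

/-- The class of a continuous function in `L²(a,b)`. -/
def contToLp (a b : ℝ) : C(ℝ, V) →ₗ[ℝ] Lp V 2 (volume.restrict (Ioo a b)) where
  toFun ψ := (memLp_Ioo_of_continuous ψ.continuous a b 2).toLp
  map_add' _ _ := rfl
  map_smul' _ _ := rfl

theorem coeFn_contToLp (a b : ℝ) (ψ : C(ℝ, V)) :
    contToLp a b ψ =ᵐ[volume.restrict (Ioo a b)] ψ :=
  (memLp_Ioo_of_continuous ψ.continuous a b 2).coeFn_toLp

variable [CompleteSpace V]

/-- The primitive `t ↦ ∫_t^b ψ`. -/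
def primitiveTo (b : ℝ) : C(ℝ, V) →ₗ[ℝ] C(ℝ, V) where
  toFun ψ := ⟨fun t => ∫ s in t..b, ψ s, by
    simp_rw [fun t => intervalIntegral.integral_symm (μ := volume) (f := ψ) b t]
    exact (intervalIntegral.continuous_primitive (fun _ _ => ψ.continuous.intervalIntegrable _ _) b).neg⟩
  map_add' ψ ψ' := by
    ext t
    exact intervalIntegral.integral_add (ψ.continuous.intervalIntegrable _ _)
      (ψ'.continuous.intervalIntegrable _ _)
  map_smul' a ψ := by
    ext t
    exact intervalIntegral.integral_smul a _

theorem hasDerivAt_primitiveTo (b : ℝ) (ψ : C(ℝ, V)) (t : ℝ) :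
    HasDerivAt (primitiveTo b ψ) (-ψ t) t :=
  intervalIntegral.integral_hasDerivAt_left (ψ.continuous.intervalIntegrable _ _)
    (ψ.continuous.stronglyMeasurableAtFilter _ _) ψ.continuous.continuousAt

/-- Fubini's theorem on the triangle `{t < s}`. -/
theorem integral_primitive_smul {θ : ℝ → ℝ} (hθ : Continuous θ) {T : ℝ} 
    {F : ℝ → V} (hF : Integrable F (volume.restrict (Ioo 0 T))) :
    ∫ t in Ioo 0 T, (∫ s in t..T, θ s) • F t = ∫ s in Ioo 0 T, θ s • ∫ t in (0 : ℝ)..s, F t := by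
  have hθi : Integrable θ (volume.restrict (Ioo 0 T)) :=
    (memLp_Ioo_of_continuous hθ 0 T 1).integrable le_rfl
  have hS : MeasurableSet {p : ℝ × ℝ | p.1 < p.2} := measurableSet_lt measurable_fst measurable_snd
  have hint : Integrable ({p : ℝ × ℝ | p.1 < p.2}.indicator fun p => θ p.2 • F p.1)
      ((volume.restrict (Ioo 0 T)).prod (volume.restrict (Ioo 0 T))) := by
    refine Integrable.indicator ?_ hS
    exact (Integrable.smul_prod hθi hF).swap
  have hsw := integral_integral_swap (f := fun t s =>
    ({p : ℝ × ℝ | p.1 < p.2}.indicator fun p => θ p.2 • F p.1) (t, s)) hint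
  have e1 : ∀ t ∈ Ioo 0 T, ∫ s in Ioo 0 T,
      ({p : ℝ × ℝ | p.1 < p.2}.indicator fun p => θ p.2 • F p.1) (t, s) =
        (∫ s in t..T, θ s) • F t := by
    intro t ht
    have : (fun s => ({p : ℝ × ℝ | p.1 < p.2}.indicator fun p => θ p.2 • F p.1) (t, s)) =
        (Ioi t).indicator fun s => θ s • F t := by
      funext s
      simp [indicator_apply]
    rw [this, setIntegral_indicator measurableSet_Ioi, integral_smul_const,
      intervalIntegral.integral_of_le ht.2.le, integral_Ioc_eq_integral_Ioo]
    congr 3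
    ext s
    simp only [mem_inter_iff, mem_Ioo, mem_Ioi]
    exact ⟨fun h => ⟨h.2, h.1.2⟩, fun h => ⟨⟨ht.1.trans h.1, h.2⟩, h.1⟩⟩
  have e2 : ∀ s ∈ Ioo 0 T, ∫ t in Ioo 0 T,
      ({p : ℝ × ℝ | p.1 < p.2}.indicator fun p => θ p.2 • F p.1) (t, s) =
        θ s • ∫ t in (0 : ℝ)..s, F t := by
    intro s hs
    have : (fun t => ({p : ℝ × ℝ | p.1 < p.2}.indicator fun p => θ p.2 • F p.1) (t, s)) =
        (Iio s).indicator fun t => θ s • F t := by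
      funext t
      simp [indicator_apply]
    rw [this, setIntegral_indicator measurableSet_Iio, integral_smul,
      intervalIntegral.integral_of_le hs.1.le, integral_Ioc_eq_integral_Ioo]
    congr 3
    ext t
    simp only [mem_inter_iff, mem_Ioo, mem_Iio]
    exact ⟨fun h => ⟨h.1.1, h.2⟩, fun h => ⟨⟨h.1, h.2.trans hs.2⟩, h.2⟩⟩
  rw [← setIntegral_congr_fun measurableSet_Ioo e1, hsw, setIntegral_congr_fun measurableSet_Ioo e2]

end Primitive

theorem integrable_inner_of_memLp {E : Type*} [NormedAddCommGroup E] [InnerProductSpace ℝ E]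
    {α : Type*} [MeasurableSpace α] {μ : Measure α} {f g : α → E} (hf : MemLp f 2 μ)
    (hg : MemLp g 2 μ) : Integrable (fun a => inner ℝ (f a) (g a)) μ := by
  refine (L2.integrable_inner (𝕜 := ℝ) hf.toLp hg.toLp).congr ?_
  filter_upwards [hf.coeFn_toLp, hg.coeFn_toLp] with a h1 h2
  rw [h1, h2]

/-! ### Existence of variational solutions. -/

section Existence

variable {V H : Type*} [NormedAddCommGroup V] [InnerProductSpace ℝ V] [CompleteSpace V]
  [SecondCountableTopology V]
  [NormedAddCommGroup H] [InnerProductSpace ℝ H] [CompleteSpace H]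
  {ι : V →L[ℝ] H} {A : ℝ → V →L[ℝ] V} {M κ c : ℝ}

/-- The operator representing `(w, ψ) ↦ ∫ (ι w, ι ψ) + ⟪A w, φ⟫` for `φ = ∫_t^T ψ`. -/
def lionsMap (ι : V →L[ℝ] H) (hA : IsElliptic ι A M κ c) (T : ℝ) :
    C(ℝ, V) →ₗ[ℝ] Lp V 2 (volume.restrict (Ioo 0 T)) :=
  ((ι.adjoint.comp ι).compLpL 2 (volume.restrict (Ioo 0 T))).toLinearMap.comp (contToLp 0 T) +
    (lpOperator (volume.restrict (Ioo 0 T)) hA.meas hA.norm_le).adjoint.toLinearMap.comp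
      ((contToLp 0 T).comp (primitiveTo T))

theorem inner_lionsMap (hA : IsElliptic ι A M κ c) (T : ℝ) (ψ : C(ℝ, V))
    (w : Lp V 2 (volume.restrict (Ioo 0 T))) :
    inner ℝ w (lionsMap ι hA T ψ) = ∫ t in Ioo 0 T,
      (inner ℝ (ι (w t)) (ι (ψ t)) + inner ℝ (A t (w t)) (primitiveTo T ψ t)) := by
  simp only [lionsMap, LinearMap.add_apply, LinearMap.comp_apply, ContinuousLinearMap.coe_coe]
  rw [inner_add_right, ContinuousLinearMap.adjoint_inner_right, L2.inner_def, L2.inner_def,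
    ← integral_add (L2.integrable_inner _ _) (L2.integrable_inner _ _)]
  refine integral_congr_ae ?_
  filter_upwards [coeFn_contToLp 0 T ψ, coeFn_contToLp 0 T (primitiveTo T ψ),
    (ι.adjoint.comp ι).coeFn_compLpL (p := 2) (contToLp 0 T ψ),
    coeFn_lpOperator (volume.restrict (Ioo 0 T)) hA.meas hA.norm_le w] with t h1 h2 h3 h4
  rw [h2, h3, h4, h1, ContinuousLinearMap.comp_apply, ContinuousLinearMap.adjoint_inner_right]

/-- Pair `lionsMap ι hA T ψ` with `e^{2κt} φ`, where `φ` is the primitive of `ψ`, so `φ' = -ψ` and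
`φ T = 0`. Integrating the derivative of `-e^{2κt} ‖ι φ‖² / 2` leaves `‖ι (φ 0)‖² / 2` and a gain `κ
e^{2κt} ‖ι φ‖²`, which exactly pays for the defect in the coercivity of `A`. -/
theorem lionsMap_lower_bound (hA : IsElliptic ι A M κ c) (hc : 0 < c) (hκ : 0 ≤ κ) {T : ℝ}
    (hT : 0 < T) (ψ : C(ℝ, V)) :
    ‖ι (primitiveTo T ψ 0)‖ ^ 2 / 2 + c * ‖contToLp 0 T (primitiveTo T ψ)‖ ^ 2 ≤
      Real.exp (2 * κ * T) * ‖contToLp 0 T (primitiveTo T ψ)‖ * ‖lionsMap ι hA T ψ‖ := by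
  set φ := primitiveTo T ψ with hφ
  set η : C(ℝ, V) := ⟨fun t => Real.exp (2 * κ * t) • φ t, by fun_prop⟩ with hη
  have hηn : ‖contToLp 0 T η‖ ≤ Real.exp (2 * κ * T) * ‖contToLp 0 T φ‖ := by
    refine Lp.norm_le_mul_norm_of_ae_le_mul ?_
    filter_upwards [coeFn_contToLp 0 T η, coeFn_contToLp 0 T φ,
      ae_restrict_mem measurableSet_Ioo] with t h1 h2 h3
    rw [h1, h2]
    simp only [hη, ContinuousMap.coe_mk, norm_smul, Real.norm_eq_abs, Real.abs_exp]
    gcongr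
    exact h3.2.le
  have hCS : inner ℝ (contToLp 0 T η) (lionsMap ι hA T ψ) ≤
      Real.exp (2 * κ * T) * ‖contToLp 0 T φ‖ * ‖lionsMap ι hA T ψ‖ :=
    (real_inner_le_norm _ _).trans (by gcongr)
  refine le_trans ?_ hCS
  rw [inner_lionsMap]
  have hderiv : ∀ t, HasDerivAt (fun t => -(Real.exp (2 * κ * t) * ‖ι (φ t)‖ ^ 2) / 2)
      (Real.exp (2 * κ * t) * (inner ℝ (ι (φ t)) (ι (ψ t)) - κ * ‖ι (φ t)‖ ^ 2)) t := by
    intro t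
    have d1 : HasDerivAt (fun t => Real.exp (2 * κ * t)) (Real.exp (2 * κ * t) * (2 * κ)) t := by
      have := ((hasDerivAt_id t).const_mul (2 * κ)).exp
      simpa using this
    have d2 : HasDerivAt (fun t => ι (φ t)) (ι (-ψ t)) t :=
      ι.hasFDerivAt.comp_hasDerivAt t (hasDerivAt_primitiveTo T ψ t)
    have d3 := d2.norm_sq
    have : HasDerivAt (fun t => -(Real.exp (2 * κ * t) * ‖ι (φ t)‖ ^ 2) / 2) _ t :=
      (d1.mul d3).neg.div_const 2
    refine this.congr_deriv ?_
    rw [map_neg, inner_neg_right]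
    ring
  have hcont : Continuous fun t =>
      Real.exp (2 * κ * t) * (inner ℝ (ι (φ t)) (ι (ψ t)) - κ * ‖ι (φ t)‖ ^ 2) := by fun_prop
  have hFTC := intervalIntegral.integral_eq_sub_of_hasDerivAt (fun t _ => hderiv t)
    (hcont.intervalIntegrable 0 T)
  have hφT : φ T = 0 := by
    simp [hφ, primitiveTo]
  rw [hφT, intervalIntegral.integral_of_le hT.le, integral_Ioc_eq_integral_Ioo] at hFTC
  simp only [map_zero, norm_zero, mul_zero, Real.exp_zero, one_mul] at hFTC
  have hn : ‖contToLp 0 T φ‖ ^ 2 = ∫ t in Ioo 0 T, ‖φ t‖ ^ 2 :=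
    (integral_norm_sq_eq (memLp_Ioo_of_continuous φ.continuous 0 T 2)).symm
  have hi1 : IntegrableOn (fun t =>
      Real.exp (2 * κ * t) * (inner ℝ (ι (φ t)) (ι (ψ t)) - κ * ‖ι (φ t)‖ ^ 2)) (Ioo 0 T) :=
    hcont.integrableOn_Icc.mono_set Ioo_subset_Icc_self
  have hi2 : IntegrableOn (fun t => c * ‖φ t‖ ^ 2) (Ioo 0 T) :=
    (Continuous.integrableOn_Icc (by fun_prop)).mono_set Ioo_subset_Icc_self
  have e : ‖ι (φ 0)‖ ^ 2 / 2 + c * ‖contToLp 0 T φ‖ ^ 2 = ∫ t in Ioo 0 T, 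
      (Real.exp (2 * κ * t) * (inner ℝ (ι (φ t)) (ι (ψ t)) - κ * ‖ι (φ t)‖ ^ 2) + c * ‖φ t‖ ^ 2) := by
    rw [integral_add hi1 hi2, hFTC, integral_const_mul, hn]
    ring
  rw [e]
  have hi3 : Integrable (fun t => inner ℝ (ι (contToLp 0 T η t)) (ι (ψ t)) +
      inner ℝ (A t (contToLp 0 T η t)) (φ t)) (volume.restrict (Ioo 0 T)) := by
    have m1 := memLp_apply hA.meas hA.norm_le (Lp.memLp (contToLp 0 T η))
    have m2 : MemLp (fun t => ι (contToLp 0 T η t)) 2 (volume.restrict (Ioo 0 T)) :=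
      (Lp.memLp (contToLp 0 T η)).continuousLinearMap_comp ι
    have m3 := memLp_Ioo_of_continuous (ι.continuous.comp ψ.continuous) 0 T 2
    have m4 := memLp_Ioo_of_continuous φ.continuous 0 T 2
    exact (integrable_inner_of_memLp m2 m3).add (integrable_inner_of_memLp m1 m4)
  refine integral_mono_ae (hi1.add hi2) hi3 ?_
  filter_upwards [coeFn_contToLp 0 T η, ae_restrict_mem measurableSet_Ioo] with t h1 h2
  rw [h1]
  simp only [hη, ContinuousMap.coe_mk, map_smul, inner_smul_left, RCLike.conj_to_real]
  have hco := hA.coercive t (φ t)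
  have he : 1 ≤ Real.exp (2 * κ * t) := Real.one_le_exp (by have := h2.1; positivity)
  have h0 : 0 ≤ c * ‖φ t‖ ^ 2 := by positivity
  nlinarith [mul_le_mul_of_nonneg_left hco (zero_le_one.trans he)]

/-- The lower bound controls the value at time `0` of the primitive by the norm of `lionsMap`; the
initial-value functional is therefore admissible in the projection theorem, and the representing
vector is the solution tested against functions vanishing at `T`. -/
theorem exists_lions_solution (hA : IsElliptic ι A M κ c) (hc : 0 < c) (hκ : 0 ≤ κ) {T : ℝ}
    (hT : 0 < T) (ρ₀ : H) :
    ∃ w : Lp V 2 (volume.restrict (Ioo 0 T)), ∀ ψ : C(ℝ, V),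
      ∫ t in Ioo 0 T, (inner ℝ (ι (w t)) (ι (ψ t)) + inner ℝ (A t (w t)) (primitiveTo T ψ t)) =
        inner ℝ ρ₀ (ι (primitiveTo T ψ 0)) := by
  let L : C(ℝ, V) →ₗ[ℝ] ℝ :=
    { toFun := fun ψ => inner ℝ ρ₀ (ι (primitiveTo T ψ 0))
      map_add' := fun ψ ψ' => by simp [inner_add_right]
      map_smul' := fun a ψ => by simp [inner_smul_right] }
  set E := Real.exp (2 * κ * T)
  have hE : 0 < E := Real.exp_pos _
  obtain ⟨w, hw⟩ := exists_inner_eq_of_abs_le (lionsMap ι hA T) L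
    (‖ρ₀‖ * Real.sqrt (2 * E ^ 2 / c)) (fun ψ => by
      have hb := lionsMap_lower_bound hA hc hκ hT ψ
      set x := ‖contToLp 0 T (primitiveTo T ψ)‖
      set y := ‖lionsMap ι hA T ψ‖
      set z := ‖ι (primitiveTo T ψ 0)‖
      have hx : 0 ≤ x := norm_nonneg _
      have hy : 0 ≤ y := norm_nonneg _
      -- The estimate `z²/2 + c x² ≤ E x y` gives `c x ≤ E y`; inserting this into `z² ≤ 2 E x y`
      -- produces the constant.
      have hz : z ^ 2 ≤ 2 * E ^ 2 / c * y ^ 2 := by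
        have h1 : x * c ≤ E * y := by
          rcases hx.eq_or_lt with h | h
          · rw [← h]; simp only [zero_mul]; positivity
          · refine le_of_mul_le_mul_left ?_ h
            nlinarith [sq_nonneg z]
        have h2 : z ^ 2 ≤ 2 * (E * x * y) := by nlinarith [sq_nonneg x]
        have h3 : E * x * y ≤ E ^ 2 / c * y ^ 2 := by
          rw [div_mul_eq_mul_div, le_div_iff₀ hc]
          nlinarith [mul_le_mul_of_nonneg_left h1 (mul_nonneg hE.le hy)]
        calc z ^ 2 ≤ 2 * (E * x * y) := h2
          _ ≤ 2 * (E ^ 2 / c * y ^ 2) := by linarith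
          _ = _ := by ring
      have hz' : z ≤ Real.sqrt (2 * E ^ 2 / c) * y := by
        rw [← Real.sqrt_sq hy, ← Real.sqrt_mul (by positivity)]
        exact Real.le_sqrt_of_sq_le hz
      calc |L ψ| ≤ ‖ρ₀‖ * z := abs_real_inner_le_norm _ _
        _ ≤ ‖ρ₀‖ * (Real.sqrt (2 * E ^ 2 / c) * y) := by gcongr
        _ = _ := by ring)
  exact ⟨w, fun ψ => by rw [← inner_lionsMap hA, hw ψ]; rfl⟩

/-- The solution satisfies the integrated equation almost everywhere. -/
theorem exists_ae_solution (hA : IsElliptic ι A M κ c) (hc : 0 < c) (hκ : 0 ≤ κ) {T : ℝ}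
    (hT : 0 < T) (ρ₀ : H) :
    ∃ w : ℝ → V, MemLp w 2 volume ∧ ∀ᵐ t ∂(volume.restrict (Ioo 0 T)),
      ι.adjoint (ι (w t)) = ι.adjoint ρ₀ + ∫ τ in (0 : ℝ)..t, -A τ (w τ) := by
  obtain ⟨w, hw⟩ := exists_lions_solution hA hc hκ hT ρ₀
  have hwm : MemLp w 2 (volume.restrict (Ioo 0 T)) := Lp.memLp w
  have hF : MemLp (fun t => A t (w t)) 2 (volume.restrict (Ioo 0 T)) :=
    memLp_apply hA.meas hA.norm_le hwm
  have hFi : Integrable (fun t => A t (w t)) (volume.restrict (Ioo 0 T)) :=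
    hF.integrable (by norm_num)
  have hιw : Integrable (fun t => ι.adjoint (ι (w t))) (volume.restrict (Ioo 0 T)) :=
    ((hwm.continuousLinearMap_comp ι).continuousLinearMap_comp ι.adjoint).integrable (by norm_num)
  set P : ℝ → V := fun s => ∫ t in (0 : ℝ)..s, (Ioo 0 T).indicator (fun t => A t (w t)) t with hP
  have hPc : Continuous P := intervalIntegral.continuous_primitive
    (fun a b => (integrable_indicator_iff measurableSet_Ioo |>.2 hFi).intervalIntegrable) 0
  have hPe : ∀ s ∈ Ioo 0 T, P s = ∫ t in (0 : ℝ)..s, A t (w t) := by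
    intro s hs
    refine intervalIntegral.integral_congr_ae (Eventually.of_forall fun t ht => ?_)
    rw [uIoc_of_le hs.1.le] at ht
    exact indicator_of_mem (show t ∈ Ioo 0 T from ⟨ht.1, ht.2.trans_lt hs.2⟩) _
  set Y : ℝ → V := fun s => ι.adjoint (ι (w s)) + P s - ι.adjoint ρ₀ with hY
  have hPi : Integrable P (volume.restrict (Ioo 0 T)) :=
    (memLp_Ioo_of_continuous hPc 0 T 1).integrable le_rfl
  have hYi : Integrable Y (volume.restrict (Ioo 0 T)) :=
    (hιw.add hPi).sub (integrable_const _)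
  -- `Y` is the defect of the integrated equation; it vanishes if its integral against every scalar
  -- test function on `(0,T)` does, and that may be checked against each `v`.
  have hY0 : ∀ᵐ s, s ∈ Ioo 0 T → Y s = 0 := by
    refine isOpen_Ioo.ae_eq_zero_of_integral_contDiff_smul_eq_zero
      (show IntegrableOn Y (Ioo 0 T) volume from hYi).locallyIntegrableOn fun θ hθ hθc hθs => ?_
    have hθc' : Continuous θ := hθ.continuous
    have hθb : ∀ {f : ℝ → V}, Integrable f (volume.restrict (Ioo 0 T)) →
        Integrable (fun s => θ s • f s) (volume.restrict (Ioo 0 T)) := by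
      intro f hf
      obtain ⟨C, hC⟩ := hθc'.bounded_above_of_compact_support hθc
      exact hf.bdd_smul C hθc'.aestronglyMeasurable (Eventually.of_forall hC)
    have e0 : ∫ s, θ s • Y s = ∫ s in Ioo 0 T, θ s • Y s := by
      refine (setIntegral_eq_integral_of_forall_compl_eq_zero fun s hs => ?_).symm
      rw [image_eq_zero_of_notMem_tsupport (fun h => hs (hθs h)), zero_smul]
    rw [e0]
    refine ext_inner_right ℝ fun v => ?_
    rw [inner_zero_left]
    -- The primitive of this test function is `(∫_t^T θ) v`. Fubini on the triangle transfers that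
    -- integral to `A t (w t)`, and its value at `0` supplies the term with `ρ₀`.
    let ψ : C(ℝ, V) := ⟨fun t => θ t • v, by fun_prop⟩
    have hψ : ∀ t, primitiveTo T ψ t = (∫ s in t..T, θ s) • v := fun t =>
      intervalIntegral.integral_smul_const θ v
    have h1 := hw ψ
    have hθp : Continuous fun t => ∫ s in t..T, θ s := by
      have := (primitiveTo (V := ℝ) T ⟨θ, hθc'⟩).continuous
      exact this
    have hpF : Integrable (fun t => (∫ s in t..T, θ s) • A t (w t)) (volume.restrict (Ioo 0 T)) := by
      obtain ⟨C, hC⟩ := (isCompact_Icc (a := 0) (b := T)).exists_bound_of_continuousOn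
        hθp.continuousOn
      refine hFi.bdd_smul C hθp.aestronglyMeasurable ?_
      filter_upwards [ae_restrict_mem measurableSet_Ioo] with t ht
        using hC t (Ioo_subset_Icc_self ht)
    have e1 : ∀ t, inner ℝ (ι (w t)) (ι (ψ t)) + inner ℝ (A t (w t)) (primitiveTo T ψ t) =
        inner ℝ v (θ t • ι.adjoint (ι (w t)) + (∫ s in t..T, θ s) • A t (w t)) := by
      intro t
      rw [hψ, real_inner_comm]
      simp only [ψ, ContinuousMap.coe_mk, map_smul, inner_smul_right, inner_add_right,
        inner_smul_left, RCLike.conj_to_real, ContinuousLinearMap.adjoint_inner_right]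
      rw [real_inner_comm v]
    simp_rw [e1] at h1
    have hsum : Integrable (fun t => θ t • ι.adjoint (ι (w t)) + (∫ s in t..T, θ s) • A t (w t))
        (volume.restrict (Ioo 0 T)) := (hθb hιw).add hpF
    have hsum' : Integrable (fun t => θ t • ι.adjoint (ι (w t)) + θ t • P t)
        (volume.restrict (Ioo 0 T)) := (hθb hιw).add (hθb hPi)
    have hPθ : ∫ s in Ioo 0 T, θ s • ∫ t in (0 : ℝ)..s, A t (w t) = ∫ s in Ioo 0 T, θ s • P s :=
      setIntegral_congr_fun measurableSet_Ioo fun s hs => by simp only [hPe s hs]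
    rw [integral_inner hsum, integral_add (hθb hιw) hpF,
      integral_primitive_smul hθc' hFi, hψ, map_smul, inner_smul_right,
      ← ContinuousLinearMap.adjoint_inner_left,
      hPθ,
      intervalIntegral.integral_of_le hT.le, integral_Ioc_eq_integral_Ioo] at h1
    have e2 : ∫ s in Ioo 0 T, θ s • Y s = (∫ s in Ioo 0 T, θ s • ι.adjoint (ι (w s))) +
        (∫ s in Ioo 0 T, θ s • P s) - (∫ s in Ioo 0 T, θ s) • ι.adjoint ρ₀ := by
      rw [← integral_smul_const, ← integral_add (hθb hιw) (hθb hPi),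
        ← integral_sub hsum' (hθb (integrable_const _))]
      refine integral_congr_ae (Eventually.of_forall fun s => ?_)
      simp only [hY, smul_sub, smul_add]
    rw [e2, inner_sub_left, real_inner_comm, h1, inner_smul_left, RCLike.conj_to_real, sub_self]
  -- Extension by zero gives a square integrable function on the line, as the Steklov averages
  -- require.
  refine ⟨(Ioo 0 T).indicator w, (memLp_indicator_iff_restrict measurableSet_Ioo).2 hwm, ?_⟩
  filter_upwards [ae_restrict_of_ae hY0, ae_restrict_mem measurableSet_Ioo] with s hs hsm
  have h1 := hs hsm
  simp only [hY] at h1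
  rw [indicator_of_mem hsm, intervalIntegral.integral_neg]
  have h2 : ∫ τ in (0 : ℝ)..s, A τ ((Ioo 0 T).indicator w τ) = P s := by
    refine intervalIntegral.integral_congr fun τ _ => ?_
    by_cases hτ : τ ∈ Ioo 0 T <;> simp [hτ]
  rw [h2, ← sub_eq_zero, ← h1]
  abel

/-- `ρ` is the solution of `∂ₜ ρ + A ρ = 0` with initial value `ρ₀`, and `w` is `ρ` seen as a
function with values in `V`. -/
structure IsVariationalSolution (ι : V →L[ℝ] H) (A : ℝ → V →L[ℝ] V) (T : ℝ) (ρ₀ : H) (ρ : ℝ → H)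
    (w : ℝ → V) : Prop where
  cont : ContinuousOn ρ (Icc 0 T)
  memLp : MemLp w 2 (volume.restrict (Ioo 0 T))
  ae_eq : ∀ᵐ t ∂(volume.restrict (Ioo 0 T)), ι (w t) = ρ t
  init : ρ 0 = ρ₀
  eqn : ∀ t ∈ Icc 0 T, ι.adjoint (ρ t) = ι.adjoint ρ₀ + ∫ τ in (0 : ℝ)..t, -A τ (w τ)

/-- The problem is solved up to time `T + 1`, since forward averages give the continuous
representative only strictly before the final time. Injectivity of `ι*` turns the initial condition
in the dual into one in `H`. -/
theorem exists_isVariationalSolution (hA : IsElliptic ι A M κ c) (hc : 0 < c) (hκ : 0 ≤ κ)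
    (hι : Function.Injective ι.adjoint) {T : ℝ} (hT : 0 < T) (ρ₀ : H) :
    ∃ ρ w, IsVariationalSolution ι A T ρ₀ ρ w := by
  obtain ⟨w, hw, heq⟩ := exists_ae_solution hA hc hκ (T := T + 1) (by linarith) ρ₀
  obtain ⟨ρ, hρc, hρae, hρeq, -⟩ := exists_continuous_representative hw
    (memLp_apply hA.meas hA.norm_le hw).neg heq hT (lt_add_one T)
  refine ⟨ρ, w, hρc, hw.restrict _, hρae, hι ?_, fun t ht => hρeq t ht⟩
  rw [hρeq 0 ⟨le_rfl, hT.le⟩]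
  simp

end Existence

/-! ### Energy estimates and dependence on the operators. -/

section Stability

variable {V H : Type*} [NormedAddCommGroup V] [InnerProductSpace ℝ V] [CompleteSpace V]
  [NormedAddCommGroup H] [InnerProductSpace ℝ H] [CompleteSpace H]
  {ι : V →L[ℝ] H}

/-- On each `[0,T']` with `T' < T`, a given continuous `ρ` coincides with the representative built
from averages and inherits its identity. Both sides are continuous up to `T`, so the final time is
included. -/
theorem energy_identity {T : ℝ} (hT : 0 < T) {ρ : ℝ → H} {w g : ℝ → V} {W₀ : V}
    (hρ : ContinuousOn ρ (Icc 0 T))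
    (hw : MemLp w 2 (volume.restrict (Ioo 0 T))) (hg : MemLp g 2 (volume.restrict (Ioo 0 T)))
    (hae : ∀ᵐ t ∂(volume.restrict (Ioo 0 T)), ι (w t) = ρ t)
    (heq : ∀ t ∈ Icc 0 T, ι.adjoint (ρ t) = W₀ + ∫ τ in (0 : ℝ)..t, g τ) :
    ∀ t ∈ Icc 0 T, ‖ρ t‖ ^ 2 = ‖ρ 0‖ ^ 2 + 2 * ∫ τ in (0 : ℝ)..t, inner ℝ (g τ) (w τ) := by
  set w' := (Ioo 0 T).indicator w with hw'
  set g' := (Ioo 0 T).indicator g with hg'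
  have hwm : MemLp w' 2 volume := (memLp_indicator_iff_restrict measurableSet_Ioo).2 hw
  have hgm : MemLp g' 2 volume := (memLp_indicator_iff_restrict measurableSet_Ioo).2 hg
  have hae_ind : ∀ t ∈ Icc 0 T, ∀ᵐ τ : ℝ, τ ∈ uIoc 0 t → g' τ = g τ ∧ w' τ = w τ := by
    intro t ht
    filter_upwards [Measure.ae_ne volume T] with τ hτ hm
    rw [uIoc_of_le ht.1] at hm
    have : τ ∈ Ioo 0 T := ⟨hm.1, lt_of_le_of_ne (hm.2.trans ht.2) hτ⟩
    exact ⟨indicator_of_mem this _, indicator_of_mem this _⟩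
  have hG : ∀ t ∈ Icc 0 T, ∫ τ in (0 : ℝ)..t, g' τ = ∫ τ in (0 : ℝ)..t, g τ := fun t ht =>
    intervalIntegral.integral_congr_ae ((hae_ind t ht).mono fun τ h hm => (h hm).1)
  have hGW : ∀ t ∈ Icc 0 T, ∫ τ in (0 : ℝ)..t, inner ℝ (g' τ) (w' τ) =
      ∫ τ in (0 : ℝ)..t, inner ℝ (g τ) (w τ) := fun t ht =>
    intervalIntegral.integral_congr_ae ((hae_ind t ht).mono fun τ h hm => by
      rw [(h hm).1, (h hm).2])
  have hW : ∀ᵐ t ∂(volume.restrict (Ioo 0 T)),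
      ι.adjoint (ι (w' t)) = W₀ + ∫ τ in (0 : ℝ)..t, g' τ := by
    filter_upwards [hae, ae_restrict_mem measurableSet_Ioo] with t h1 h2
    rw [hw', indicator_of_mem h2, h1, heq t (Ioo_subset_Icc_self h2), hG t (Ioo_subset_Icc_self h2)]
  have hgwi : Integrable (fun τ => inner ℝ (g' τ) (w' τ)) := integrable_inner_of_memLp hgm hwm
  have hlt : ∀ T' ∈ Ioo 0 T, ∀ t ∈ Icc 0 T',
      ‖ρ t‖ ^ 2 = ‖ρ 0‖ ^ 2 + 2 * ∫ τ in (0 : ℝ)..t, inner ℝ (g' τ) (w' τ) := by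
    intro T' hT' 
    obtain ⟨r, hrc, hrae, -, hre⟩ := exists_continuous_representative hwm hgm hW hT'.1 hT'.2
    have hEq : EqOn ρ r (Icc 0 T') := by
      refine Measure.eqOn_Icc_of_ae_eq volume hT'.1.ne ?_
        (hρ.mono (Icc_subset_Icc_right hT'.2.le)) hrc
      rw [← restrict_Ioo_eq_restrict_Icc]
      filter_upwards [hrae, ae_restrict_of_ae_restrict_of_subset
        (Ioo_subset_Ioo_right hT'.2.le) hae, ae_restrict_mem measurableSet_Ioo] with t h1 h2 h3
      rw [← h2, ← h1, hw', indicator_of_mem (Ioo_subset_Ioo_right hT'.2.le h3)]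
    intro t ht
    rw [hEq ht, hEq ⟨le_rfl, hT'.1.le⟩, hre t ht]
  have hall : EqOn (fun t => ‖ρ t‖ ^ 2)
      (fun t => ‖ρ 0‖ ^ 2 + 2 * ∫ τ in (0 : ℝ)..t, inner ℝ (g' τ) (w' τ)) (Icc 0 T) := by
    refine Measure.eqOn_Icc_of_ae_eq volume hT.ne ?_ (hρ.norm.pow 2) ?_
    · rw [← restrict_Ioo_eq_restrict_Icc]
      filter_upwards [ae_restrict_mem measurableSet_Ioo] with t ht
      exact hlt t ht t ⟨ht.1.le, le_rfl⟩
    · exact (continuous_const.add (continuous_const.mul (intervalIntegral.continuous_primitive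
        (fun _ _ => hgwi.intervalIntegrable) 0))).continuousOn
  intro t ht
  have := hall ht
  simp only at this
  rw [this, hGW t ht]

/-- Gronwall's inequality in integral form. -/
theorem le_mul_exp_of_le_integral {T κ E : ℝ} (hT : 0 < T) (hκ : 0 < κ) {y : ℝ → ℝ}
    (hy : ContinuousOn y (Icc 0 T)) (hy0 : ∀ t ∈ Icc 0 T, 0 ≤ y t)
    (h : ∀ t ∈ Icc 0 T, y t ≤ κ * (∫ τ in (0 : ℝ)..t, y τ) + E) :
    ∀ t ∈ Icc 0 T, y t ≤ E * Real.exp (κ * T) := by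
  -- A continuous extension of `y` to the line makes its primitive differentiable also at the
  -- endpoints.
  set z : ℝ → ℝ := IccExtend hT.le ((Icc 0 T).domRestrict y) with hz
  have hzc : Continuous z := (continuousOn_iff_continuous_domRestrict.1 hy).Icc_extend'
  have hzy : ∀ t ∈ Icc 0 T, z t = y t := fun t ht => IccExtend_of_mem _ _ ht
  set Y : ℝ → ℝ := fun t => ∫ τ in (0 : ℝ)..t, z τ with hY
  have hYy : ∀ t ∈ Icc 0 T, Y t = ∫ τ in (0 : ℝ)..t, y τ := by
    intro t ht
    refine intervalIntegral.integral_congr fun τ hτ => hzy τ ?_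
    rw [uIcc_of_le ht.1] at hτ
    exact ⟨hτ.1, hτ.2.trans ht.2⟩
  have hz0 : ∀ τ, 0 ≤ z τ := fun τ => hy0 _ (projIcc 0 T hT.le τ).2
  have hY0 : ∀ t ∈ Icc 0 T, 0 ≤ Y t := fun t ht =>
    intervalIntegral.integral_nonneg ht.1 fun τ _ => hz0 τ
  have hd : ∀ t, HasDerivAt Y (z t) t := fun t =>
    intervalIntegral.integral_hasDerivAt_right (hzc.intervalIntegrable _ _)
      (hzc.stronglyMeasurableAtFilter _ _) hzc.continuousAt
  have hE : 0 ≤ E := by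
    have := h 0 ⟨le_rfl, hT.le⟩
    rw [intervalIntegral.integral_same, mul_zero, zero_add] at this
    exact (hy0 0 ⟨le_rfl, hT.le⟩).trans this
  -- Gronwall is applied to the primitive, for which `Y' ≤ κ Y + E` and `Y 0 = 0`; the bound on `Y`
  -- is then put back into the hypothesis on `y`.
  have key := norm_le_gronwallBound_of_norm_deriv_right_le (f := Y) (f' := z) (δ := 0) (K := κ)
    (ε := E) (a := 0) (b := T) (fun t _ => (hd t).continuousAt.continuousWithinAt)
    (fun t _ => (hd t).hasDerivWithinAt) (by simp [hY]) (fun t ht => by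
      have ht' := Ico_subset_Icc_self ht
      rw [Real.norm_of_nonneg (hz0 t), Real.norm_of_nonneg (hY0 t ht'), hzy t ht', hYy t ht']
      exact h t ht')
  intro t ht
  have h1 := key t ht
  rw [Real.norm_of_nonneg (hY0 t ht), gronwallBound_of_K_ne_0 hκ.ne', hYy t ht] at h1
  have h2 := h t ht
  have h3 : κ * (∫ τ in (0 : ℝ)..t, y τ) ≤ E * (Real.exp (κ * t) - 1) := by
    calc _ ≤ κ * (0 * Real.exp (κ * (t - 0)) + E / κ * (Real.exp (κ * (t - 0)) - 1)) := by gcongr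
      _ = _ := by field_simp; ring_nf
  calc y t ≤ E * (Real.exp (κ * t) - 1) + E := by linarith
    _ = E * Real.exp (κ * t) := by ring
    _ ≤ E * Real.exp (κ * T) := by gcongr; exact ht.2

variable [SecondCountableTopology V] {A A' : ℝ → V →L[ℝ] V} {M M' κ κ' c c' : ℝ}

/-- Continuous dependence of the solution on the operators. -/
theorem IsVariationalSolution.norm_sub_sq_le (hA : IsElliptic ι A M κ c)
    (hA' : IsElliptic ι A' M' κ' c') (hc : 0 < c) (hκ : 0 < κ) {T : ℝ} (hT : 0 < T) {ρ₀ : H}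
    {ρ ρ' : ℝ → H} {w w' : ℝ → V} (hs : IsVariationalSolution ι A T ρ₀ ρ w)
    (hs' : IsVariationalSolution ι A' T ρ₀ ρ' w') {t : ℝ} (ht : t ∈ Icc 0 T) :
    ‖ρ t - ρ' t‖ ^ 2 ≤
      (∫ τ in Ioo 0 T, ‖A τ (w' τ) - A' τ (w' τ)‖ ^ 2) / (2 * c) * Real.exp (2 * κ * T) := by
  -- The splitting `A w - A' w' = A (w - w') + e` measures the difference of the operators only
  -- along `w'`.
  set e : ℝ → V := fun τ => A τ (w' τ) - A' τ (w' τ) with he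
  have hAw := memLp_apply hA.meas hA.norm_le hs.memLp
  have hAw' := memLp_apply hA.meas hA.norm_le hs'.memLp
  have hAw'' := memLp_apply hA'.meas hA'.norm_le hs'.memLp
  have hem : MemLp e 2 (volume.restrict (Ioo 0 T)) := hAw'.sub hAw''
  have hsub : ∀ t ∈ Icc 0 T, uIoc 0 t ⊆ Ioc 0 T := fun t ht => by
    rw [uIoc_of_le ht.1]; exact Ioc_subset_Ioc_right ht.2
  have hint : ∀ {f : ℝ → V}, MemLp f 2 (volume.restrict (Ioo 0 T)) → ∀ t ∈ Icc 0 T,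
      IntervalIntegrable f volume 0 t := by
    intro f hf t ht
    rw [intervalIntegrable_iff]
    refine IntegrableOn.mono_set ?_ (hsub t ht)
    rw [integrableOn_Ioc_iff_integrableOn_Ioo]
    exact hf.integrable (by norm_num)
  have hnA : MemLp (fun τ => -A τ (w τ)) 2 (volume.restrict (Ioo 0 T)) := hAw.neg
  have hnA' : MemLp (fun τ => -A' τ (w' τ)) 2 (volume.restrict (Ioo 0 T)) := hAw''.neg
  have hen := energy_identity (ι := ι) hT (ρ := fun t => ρ t - ρ' t) (w := fun t => w t - w' t)
    (g := fun t => -A t (w t) - -A' t (w' t)) (W₀ := 0) (hs.cont.sub hs'.cont)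
    (hs.memLp.sub hs'.memLp) (hnA.sub hnA') (by
      filter_upwards [hs.ae_eq, hs'.ae_eq] with t h1 h2
      rw [map_sub, h1, h2]) (fun t ht => by
      rw [map_sub, hs.eqn t ht, hs'.eqn t ht,
        intervalIntegral.integral_sub (hint hnA t ht) (hint hnA' t ht)]
      abel)
  have hyc : ContinuousOn (fun t => ‖ρ t - ρ' t‖ ^ 2) (Icc 0 T) :=
    ((hs.cont.sub hs'.cont).norm.pow 2)
  have hei : IntegrableOn (fun τ => ‖e τ‖ ^ 2) (Ioo 0 T) := integrable_norm_sq hem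
  have hgr := le_mul_exp_of_le_integral (E := (∫ τ in Ioo 0 T, ‖e τ‖ ^ 2) / (2 * c))
    (κ := 2 * κ) hT (by positivity) hyc (fun t _ => by positivity) (fun t ht => by
      rw [hen t ht, hs.init, hs'.init, sub_self, norm_zero, zero_pow two_ne_zero, zero_add,
        intervalIntegral.integral_of_le ht.1, intervalIntegral.integral_of_le ht.1,
        integral_Ioc_eq_integral_Ioo, integral_Ioc_eq_integral_Ioo]
      have hst : Ioo 0 t ⊆ Ioo 0 T := Ioo_subset_Ioo_right ht.2
      have hi1 : IntegrableOn (fun τ => inner ℝ (-A τ (w τ) - -A' τ (w' τ)) (w τ - w' τ)) (Ioo 0 t) :=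
        IntegrableOn.mono_set (integrable_inner_of_memLp (hnA.sub hnA')
          (hs.memLp.sub hs'.memLp)) hst
      have hi2 : IntegrableOn (fun τ => ‖ρ τ - ρ' τ‖ ^ 2) (Ioo 0 t) :=
        (hyc.integrableOn_Icc).mono_set (hst.trans Ioo_subset_Icc_self)
      have hi3 : IntegrableOn (fun τ => ‖e τ‖ ^ 2 / (2 * c)) (Ioo 0 t) :=
        IntegrableOn.mono_set (hei.div_const _) hst
      have h1 : ∫ τ in Ioo 0 t, 2 * inner ℝ (-A τ (w τ) - -A' τ (w' τ)) (w τ - w' τ) ≤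
          ∫ τ in Ioo 0 t, (2 * κ * ‖ρ τ - ρ' τ‖ ^ 2 + ‖e τ‖ ^ 2 / (2 * c)) := by
        refine integral_mono_ae (hi1.const_mul 2) ((hi2.const_mul _).add hi3) ?_
        filter_upwards [ae_restrict_of_ae_restrict_of_subset hst hs.ae_eq,
          ae_restrict_of_ae_restrict_of_subset hst hs'.ae_eq] with τ h1 h2
        have h3 : -A τ (w τ) - -A' τ (w' τ) = -(A τ (w τ - w' τ)) - e τ := by
          simp only [he, map_sub]; abel
        have h4 := hA.coercive τ (w τ - w' τ)
        rw [map_sub ι, h1, h2] at h4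
        have h5 := neg_le_of_abs_le (abs_real_inner_le_norm (e τ) (w τ - w' τ))
        -- Young's inequality, weighted so that the first term is absorbed by twice the coercivity
        -- of `A`.
        have h6 : 2 * (‖e τ‖ * ‖w τ - w' τ‖) ≤ 2 * c * ‖w τ - w' τ‖ ^ 2 + ‖e τ‖ ^ 2 / (2 * c) := by
          have h7 : 0 ≤ (2 * c * ‖w τ - w' τ‖ - ‖e τ‖) ^ 2 / (2 * c) := by positivity
          have h8 : (2 * c * ‖w τ - w' τ‖ - ‖e τ‖) ^ 2 / (2 * c) = 2 * c * ‖w τ - w' τ‖ ^ 2 +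
            ‖e τ‖ ^ 2 / (2 * c) - 2 * (‖e τ‖ * ‖w τ - w' τ‖) := by field_simp; ring
          linarith
        rw [h3, inner_sub_left, inner_neg_left]
        linarith
      rw [integral_const_mul, integral_add (hi2.const_mul _) hi3, integral_const_mul,
        integral_div] at h1
      refine h1.trans ?_
      gcongr
      exact ae_of_all _ fun τ => by positivity)
  exact hgr t ht

end Stability

/-! ### Mollification on `ℝ^d`. -/

section Mollify

variable {d : ℕ}

/-- A sequence of bump functions shrinking to the origin. -/
def bumpSeq (d n : ℕ) : ContDiffBump (0 : Space d) where
  rIn := 1 / 2 * (1 / ((n : ℝ) + 1))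
  rOut := 1 / ((n : ℝ) + 1)
  rIn_pos := by positivity
  rIn_lt_rOut := by
    have : (0 : ℝ) < 1 / ((n : ℝ) + 1) := by positivity
    linarith

theorem bumpSeq_rOut_le (n : ℕ) : (bumpSeq d n).rOut ≤ 1 := by
  change 1 / ((n : ℝ) + 1) ≤ 1
  rw [div_le_one (by positivity)]
  linarith [n.cast_nonneg (α := ℝ)]

theorem tendsto_bumpSeq_rOut : Tendsto (fun n => (bumpSeq d n).rOut) atTop (𝓝 0) :=
  tendsto_one_div_add_atTop_nhds_zero_nat

/-- Convolution with the `n`-th bump function. -/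
def mollify {F : Type*} [NormedAddCommGroup F] [NormedSpace ℝ F] (n : ℕ) (f : Space d → F) :
    Space d → F :=
  ((bumpSeq d n).normed volume ⋆[ContinuousLinearMap.lsmul ℝ ℝ, volume] f)

section

variable {F : Type*} [NormedAddCommGroup F] [NormedSpace ℝ F]

theorem mollify_apply (n : ℕ) (f : Space d → F) (x : Space d) :
    mollify n f x = ∫ t, (bumpSeq d n).normed volume t • f (x - t) := rfl

theorem norm_mollify_le {f : Space d → F} {C : ℝ} (hC : ∀ᵐ x, ‖f x‖ ≤ C) (n : ℕ) (x : Space d) :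
    ‖mollify n f x‖ ≤ C := by
  rw [mollify_apply]
  have hb : ∀ᵐ t, ‖(bumpSeq d n).normed volume t • f (x - t)‖ ≤
      (bumpSeq d n).normed volume t * C := by
    have := (Measure.measurePreserving_sub_left (volume : Measure (Space d)) x
      ).quasiMeasurePreserving.ae hC
    filter_upwards [this] with t ht
    rw [norm_smul, Real.norm_of_nonneg ((bumpSeq d n).nonneg_normed t)]
    exact mul_le_mul_of_nonneg_left ht ((bumpSeq d n).nonneg_normed t)
  refine (norm_integral_le_of_norm_le ?_ hb).trans_eq ?_
  · exact ((bumpSeq d n).integrable_normed).mul_const C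
  · rw [integral_mul_const, (bumpSeq d n).integral_normed, one_mul]

theorem mollify_eq_zero {f : Space d → F} {R : ℝ} (hf : ∀ x, R < ‖x‖ → f x = 0) (n : ℕ)
    {x : Space d} (hx : R + 1 < ‖x‖) : mollify n f x = 0 := by
  rw [mollify_apply]
  refine integral_eq_zero_of_ae (Eventually.of_forall fun t => ?_)
  by_cases ht : (bumpSeq d n).normed volume t = 0
  · simp [ht]
  · have : t ∈ Function.support ((bumpSeq d n).normed volume) := ht
    rw [ContDiffBump.support_normed_eq, mem_ball_zero_iff] at this
    have h1 := bumpSeq_rOut_le (d := d) n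
    have h2 := norm_sub_norm_le x t
    simp [hf (x - t) (by linarith)]

theorem hasCompactSupport_mollify {f : Space d → F} {R : ℝ} (hf : ∀ x, R < ‖x‖ → f x = 0)
    (n : ℕ) : HasCompactSupport (mollify n f) :=
  HasCompactSupport.intro (isCompact_closedBall (0 : Space d) (R + 1)) fun x hx =>
    mollify_eq_zero hf n (by simpa using hx)

theorem contDiff_mollify {f : Space d → F} (hf : LocallyIntegrable f volume) (n : ℕ) :
    ContDiff ℝ (⊤ : ℕ∞) (mollify n f) :=
  (bumpSeq d n).hasCompactSupport_normed.contDiff_convolution_left _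
    (bumpSeq d n).contDiff_normed hf

variable [CompleteSpace F]

theorem tendsto_mollify {f : Space d → F} (hf : Continuous f) (x : Space d) :
    Tendsto (fun n => mollify n f x) atTop (𝓝 (f x)) :=
  ContDiffBump.convolution_tendsto_right_of_continuous tendsto_bumpSeq_rOut hf x

theorem ae_tendsto_mollify {f : Space d → F} (hf : LocallyIntegrable f volume) :
    ∀ᵐ x, Tendsto (fun n => mollify n f x) atTop (𝓝 (f x)) :=
  ContDiffBump.ae_convolution_tendsto_right_of_locallyIntegrable (K := 2) tendsto_bumpSeq_rOut
    (Eventually.of_forall fun n => by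
      -- Almost everywhere convergence needs the ratio of outer to inner radius to stay bounded;
      -- here it is `2`.
      change 1 / ((n : ℝ) + 1) ≤ 2 * (1 / 2 * (1 / ((n : ℝ) + 1)))
      rw [← mul_assoc]; norm_num) hf

end

theorem partialDeriv_mollify {ψ : Space d → ℝ} (hψ : ContDiff ℝ 1 ψ) (hc : HasCompactSupport ψ)
    (i : Fin d) (n : ℕ) (x : Space d) :
    partialDeriv i (mollify n ψ) x = mollify n (partialDeriv i ψ) x := by
  have hb : LocallyIntegrable ((bumpSeq d n).normed volume) volume :=
    (bumpSeq d n).integrable_normed.locallyIntegrable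
  have h := hc.hasFDerivAt_convolution_right (ContinuousLinearMap.lsmul ℝ ℝ) hb hψ x
  rw [partialDeriv, mollify, h.fderiv, mollify]
  rw [convolution_precompR_apply _ hb (hc.fderiv (𝕜 := ℝ)) (hψ.continuous_fderiv one_ne_zero)]
  rfl

theorem exists_eq_zero_of_hasCompactSupport {F : Type*} [Zero F] {ψ : Space d → F}
    (hc : HasCompactSupport ψ) : ∃ R : ℝ, ∀ x, R < ‖x‖ → ψ x = 0 := by
  obtain ⟨R, hR⟩ := hc.isCompact.isBounded.subset_closedBall (0 : Space d)
  refine ⟨R, fun x hx => image_eq_zero_of_notMem_tsupport fun h => ?_⟩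
  have := hR h
  rw [mem_closedBall_zero_iff] at this
  linarith

theorem continuous_partialDeriv_one (i : Fin d) {φ : Space d → ℝ} (hφ : ContDiff ℝ 1 φ) :
    Continuous (partialDeriv i φ) :=
  (hφ.continuous_fderiv one_ne_zero).clm_apply continuous_const

theorem tendsto_integral_mul_mollify {f ψ : Space d → ℝ} (hf : LocallyIntegrable f volume)
    (hψ : Continuous ψ) (hc : HasCompactSupport ψ) :
    Tendsto (fun n => ∫ x, f x * mollify n ψ x) atTop (𝓝 (∫ x, f x * ψ x)) := by
  obtain ⟨R, hR⟩ := exists_eq_zero_of_hasCompactSupport hc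
  obtain ⟨C, hC⟩ := hψ.bounded_above_of_compact_support hc
  have hfi : IntegrableOn f (Metric.closedBall 0 (R + 1)) volume :=
    hf.integrableOn_isCompact (isCompact_closedBall _ _)
  refine tendsto_integral_of_dominated_convergence
    ((Metric.closedBall (0 : Space d) (R + 1)).indicator fun x => ‖f x‖ * C) (fun n => ?_) ?_
    (fun n => Eventually.of_forall fun x => ?_) (Eventually.of_forall fun x => ?_)
  · exact hf.aestronglyMeasurable.mul
      (contDiff_mollify (hψ.locallyIntegrable) n).continuous.aestronglyMeasurable
  · exact (integrable_indicator_iff measurableSet_closedBall).2 (hfi.norm.mul_const C)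
  · by_cases hx : x ∈ Metric.closedBall (0 : Space d) (R + 1)
    · rw [indicator_of_mem hx, norm_mul]
      exact mul_le_mul_of_nonneg_left (norm_mollify_le (Eventually.of_forall hC) n x) (norm_nonneg _)
    · rw [indicator_of_notMem hx, mollify_eq_zero hR n (by simpa using hx)]
      simp
  · exact (tendsto_mollify hψ x).const_mul _

end Mollify

/-! ### Calculus of weak partial derivatives. -/

section WeakPartial

variable {d : ℕ} {i : Fin d} {f g : Space d → ℝ}

/-- C¹ test functions are reached by mollifying `ψ`, which commutes with differentiation and keeps
the supports in one ball. The diffusion coefficients composed with `S K u` are only C¹, so smooth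
tests do not suffice. -/
theorem HasWeakPartial.integral_mul_eq (h : HasWeakPartial i f g) {ψ : Space d → ℝ}
    (hψ : ContDiff ℝ 1 ψ) (hc : HasCompactSupport ψ) :
    ∫ x, f x * partialDeriv i ψ x = - ∫ x, g x * ψ x := by
  obtain ⟨R, hR⟩ := exists_eq_zero_of_hasCompactSupport hc
  have h1 := tendsto_integral_mul_mollify h.1 (continuous_partialDeriv_one i hψ)
    (hasCompactSupport_partialDeriv i hc)
  have h2 := (tendsto_integral_mul_mollify h.2.1 hψ.continuous hc).neg
  refine tendsto_nhds_unique h1 (h2.congr fun n => ?_)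
  rw [← h.2.2 _ (contDiff_mollify hψ.continuous.locallyIntegrable n)
    (hasCompactSupport_mollify hR n)]
  simp only [partialDeriv_mollify hψ hc]

theorem partialDeriv_mul {a φ : Space d → ℝ} {x : Space d} (ha : DifferentiableAt ℝ a x)
    (hφ : DifferentiableAt ℝ φ x) :
    partialDeriv i (fun x => a x * φ x) x = a x * partialDeriv i φ x + φ x * partialDeriv i a x := by
  simp only [partialDeriv]
  rw [fderiv_fun_mul ha hφ]
  simp

/-- The product `a φ` is used as a C¹ test function for `f`. -/
theorem HasWeakPartial.contDiff_mul (h : HasWeakPartial i f g) {a : Space d → ℝ}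
    (ha : ContDiff ℝ 1 a) :
    HasWeakPartial i (fun x => a x * f x) (fun x => partialDeriv i a x * f x + a x * g x) := by
  have hda := continuous_partialDeriv_one i ha
  have l1 : LocallyIntegrable (fun x => partialDeriv i a x * f x) volume := by
    simpa using h.1.continuous_smul hda
  have l2 : LocallyIntegrable (fun x => a x * g x) volume := by
    simpa using h.2.1.continuous_smul ha.continuous
  refine ⟨by simpa using h.1.continuous_smul ha.continuous, l1.add l2, fun φ hφ hc => ?_⟩
  have hφ1 : ContDiff ℝ 1 φ := hφ.of_le (by exact_mod_cast le_top)
  have hdφ := continuous_partialDeriv_one i hφ1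
  have hcd := hasCompactSupport_partialDeriv i hc
  have key := h.integral_mul_eq (ha.mul hφ1) hc.mul_left
  have e1 : ∀ x, f x * partialDeriv i (fun x => a x * φ x) x =
      a x * f x * partialDeriv i φ x + partialDeriv i a x * f x * φ x := fun x => by
    rw [partialDeriv_mul (ha.differentiable one_ne_zero x) (hφ1.differentiable one_ne_zero x)]
    ring
  have i1 : Integrable (fun x => a x * f x * partialDeriv i φ x) volume :=
    integrable_mul_test (by simpa using h.1.continuous_smul ha.continuous) hdφ hcd
  have i2 : Integrable (fun x => partialDeriv i a x * f x * φ x) volume :=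
    integrable_mul_test l1 hφ.continuous hc
  have i3 : Integrable (fun x => a x * g x * φ x) volume := integrable_mul_test l2 hφ.continuous hc
  simp_rw [e1] at key
  rw [integral_add i1 i2] at key
  simp_rw [add_mul]
  rw [integral_add i2 i3]
  have e2 : ∫ x, g x * (a x * φ x) = ∫ x, a x * g x * φ x := by
    congr 1; ext x; ring
  rw [e2] at key
  linarith

/-- The weak formulation asks only for some `D i j`; this identifies it with the one given by the
product rule. -/
theorem HasWeakPartial.ae_unique {g' : Space d → ℝ} (h : HasWeakPartial i f g)
    (h' : HasWeakPartial i f g') : g =ᵐ[volume] g' := by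
  refine ae_eq_of_integral_contDiff_smul_eq h.2.1 h'.2.1 fun φ hφ hc => ?_
  have h1 := h.2.2 φ hφ hc
  rw [h'.2.2 φ hφ hc, neg_inj] at h1
  simp only [smul_eq_mul, mul_comm (φ _)]
  exact h1.symm

theorem hasWeakPartial_of_contDiff {ψ : Space d → ℝ} (hψ : ContDiff ℝ 1 ψ) (i : Fin d) :
    HasWeakPartial i ψ (partialDeriv i ψ) := by
  have hd := continuous_partialDeriv_one i hψ
  refine ⟨hψ.continuous.locallyIntegrable, hd.locallyIntegrable, fun φ hφ hc => ?_⟩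
  have hφ1 : ContDiff ℝ 1 φ := hφ.of_le (by exact_mod_cast le_top)
  exact integral_mul_fderiv_eq_neg_fderiv_mul_of_integrable
    (integrable_mul_test hd.locallyIntegrable hφ.continuous hc)
    (integrable_mul_test hψ.continuous.locallyIntegrable (continuous_partialDeriv_one i hφ1)
      (hasCompactSupport_partialDeriv i hc))
    (integrable_mul_test hψ.continuous.locallyIntegrable hφ.continuous hc)
    (fun x _ => hψ.differentiable one_ne_zero x) (fun x _ => hφ1.differentiable one_ne_zero x)

end WeakPartial

/-! ### Completeness and separability of H¹, and its density in L². -/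

section SobolevSpace

variable {d : ℕ}

theorem memLp_of_continuous {F : Type*} [NormedAddCommGroup F] {ψ : Space d → F}
    (hψ : Continuous ψ) (hc : HasCompactSupport ψ) : MemLp ψ 2 volume :=
  hψ.memLp_of_hasCompactSupport hc

theorem exists_H1_of_test {φ : Space d → ℝ} (hφ : ContDiff ℝ (⊤ : ℕ∞) φ)
    (hc : HasCompactSupport φ) : ∃ v : H1 d, H1.toL2 d v =ᵐ[volume] φ := by
  have hφ1 : ContDiff ℝ 1 φ := hφ.of_le (by exact_mod_cast le_top)
  let G : Space d → Space d := fun x => WithLp.toLp 2 fun i => partialDeriv i φ x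
  have hG : Continuous G := (PiLp.continuous_toLp 2 _).comp
    (continuous_pi fun i => continuous_partialDeriv_one i hφ1)
  have hGc : HasCompactSupport G := by
    refine hc.mono' fun x hx => ?_
    by_contra hx'
    apply hx
    have : fderiv ℝ φ x = 0 := image_eq_zero_of_notMem_tsupport
      (fun h => hx' (tsupport_fderiv_subset ℝ h))
    ext i
    simp [G, partialDeriv, this]
  refine ⟨⟨WithLp.toLp 2 ((memLp_of_continuous hφ.continuous hc).toLp φ,
    (memLp_of_continuous hG hGc).toLp G), fun i => ?_⟩, ?_⟩
  · refine (hasWeakPartial_of_contDiff hφ1 i).congr ?_ ?_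
    · exact (memLp_of_continuous hφ.continuous hc).coeFn_toLp.symm
    · filter_upwards [(memLp_of_continuous hG hGc).coeFn_toLp] with x hx
      change _ = ((memLp_of_continuous hG hGc).toLp G) x i
      rw [hx]
  · exact (memLp_of_continuous hφ.continuous hc).coeFn_toLp

/-- Smooth compactly supported functions lie in H¹ and separate the points of L². Thus an L²
function is determined by its action on H¹. -/
theorem adjoint_toL2_injective [CompleteSpace (H1 d)] :
    Function.Injective (H1.toL2 d).adjoint := by
  rw [injective_iff_map_eq_zero]
  intro f hf
  refine Lp.ext ?_
  refine EventuallyEq.trans ?_ (Lp.coeFn_zero ℝ 2 volume).symm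
  refine ae_eq_zero_of_integral_contDiff_smul_eq_zero ((Lp.memLp f).locallyIntegrable (by norm_num))
    fun φ hφ hc => ?_
  obtain ⟨v, hv⟩ := exists_H1_of_test hφ hc
  have h1 : inner ℝ ((H1.toL2 d).adjoint f) v = 0 := by rw [hf, inner_zero_left]
  rw [ContinuousLinearMap.adjoint_inner_left, L2.inner_def] at h1
  rw [← h1]
  refine integral_congr_ae ?_
  filter_upwards [hv] with x hx
  rw [hx]
  rfl

theorem integral_mul_eq_inner {ψ : Space d → ℝ} (hψ : MemLp ψ 2 volume) (f : L2 d) :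
    ∫ x, f x * ψ x = inner ℝ hψ.toLp f := by
  rw [L2.inner_def]
  refine integral_congr_ae ?_
  filter_upwards [hψ.coeFn_toLp] with x hx
  rw [hx]
  rfl

theorem integral_coord_mul_eq_inner {ψ : Space d → ℝ} (hψ : MemLp ψ 2 volume) (i : Fin d)
    (f : L2Vec d) :
    ∫ x, f x i * ψ x = inner ℝ
      ((hψ.continuousLinearMap_comp (ContinuousLinearMap.toSpanSingleton ℝ
        (EuclideanSpace.single i (1 : ℝ)))).toLp) f := by
  rw [L2.inner_def]
  refine integral_congr_ae ?_
  filter_upwards [(hψ.continuousLinearMap_comp (ContinuousLinearMap.toSpanSingleton ℝ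
        (EuclideanSpace.single i (1 : ℝ)))).coeFn_toLp] with x hx
  rw [hx]
  simp [inner_smul_left, mul_comm, EuclideanSpace.inner_single_left]

theorem locallyIntegrable_coord (f : L2Vec d) (i : Fin d) :
    LocallyIntegrable (fun x => f x i) volume :=
  (((Lp.memLp f).continuousLinearMap_comp (EuclideanSpace.proj (𝕜 := ℝ) i)).locallyIntegrable
    (by norm_num))

/-- For each test function, both sides of the defining identity are inner products with a fixed L²
function, hence continuous; H¹ is an intersection of closed sets. -/
theorem isClosed_H1 : IsClosed (H1 d : Set (WithLp 2 (L2 d × L2Vec d))) := by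
  have e : (H1 d : Set (WithLp 2 (L2 d × L2Vec d))) = ⋂ (i : Fin d) (φ : Space d → ℝ)
      (_ : ContDiff ℝ (⊤ : ℕ∞) φ) (_ : HasCompactSupport φ),
      {p | ∫ x, p.fst x * partialDeriv i φ x = - ∫ x, p.snd x i * φ x} := by
    ext p
    simp only [mem_iInter, mem_ofPred_eq]
    constructor
    · intro h i φ hφ hc
      exact (h i).2.2 φ hφ hc
    · intro h i
      exact ⟨(Lp.memLp p.fst).locallyIntegrable (by norm_num), locallyIntegrable_coord _ i, h i⟩
  rw [e]
  refine isClosed_iInter fun i => isClosed_iInter fun φ => isClosed_iInter fun hφ =>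
    isClosed_iInter fun hc => ?_
  have m1 := memLp_of_continuous (continuous_partialDeriv i hφ) (hasCompactSupport_partialDeriv i hc)
  have m2 := memLp_of_continuous hφ.continuous hc
  simp_rw [integral_mul_eq_inner m1, integral_coord_mul_eq_inner m2 i]
  exact isClosed_eq (continuous_const.inner (WithLp.continuous_fst 2 _ _))
    (continuous_const.inner (WithLp.continuous_snd 2 _ _)).neg

instance : CompleteSpace (H1 d) := isClosed_H1.completeSpace_coe

instance : SecondCountableTopology (WithLp 2 (L2 d × L2Vec d)) :=
  haveI : Fact ((2 : ℝ≥0∞) ≠ ∞) := ⟨by norm_num⟩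
  haveI : SecondCountableTopology (L2 d) := Lp.SecondCountableTopology
  haveI : SecondCountableTopology (L2Vec d) := Lp.SecondCountableTopology
  (WithLp.homeomorphProd 2 (L2 d) (L2Vec d)).isInducing.secondCountableTopology

instance : SecondCountableTopology (H1 d) := inferInstance

end SobolevSpace

/-! ### Measurability of L²-valued maps. -/

section StrongMeasurability

/-- An open set is the union of the balls centred at a dense sequence with radius the distance to
the complement, so preimages of balls are enough. -/
theorem measurable_of_dist {α X : Type*} [MeasurableSpace α] [MetricSpace X]
    [SecondCountableTopology X] [MeasurableSpace X] [BorelSpace X] {f : α → X}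
    (h : ∀ x, Measurable fun a => dist (f a) x) : Measurable f := by
  refine measurable_of_isOpen fun U hU => ?_
  rcases (Uᶜ).eq_empty_or_nonempty with hne | hne
  · rw [compl_empty_iff.1 hne]; exact MeasurableSet.univ
  rcases isEmpty_or_nonempty X with hX | hX
  · exact hne.elim fun x => (hX.false x).elim
  have e : f ⁻¹' U = ⋃ n : ℕ, {a | dist (f a) (TopologicalSpace.denseSeq X n) <
      Metric.infDist (TopologicalSpace.denseSeq X n) Uᶜ} := by
    ext a
    simp only [mem_preimage, mem_iUnion, mem_ofPred_eq]
    constructor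
    · intro ha
      have hδ : 0 < Metric.infDist (f a) Uᶜ :=
        (hU.isClosed_compl.notMem_iff_infDist_pos hne).1 (by simpa using ha)
      obtain ⟨n, hn⟩ := (TopologicalSpace.denseRange_denseSeq X).exists_dist_lt (f a) (half_pos hδ)
      refine ⟨n, ?_⟩
      have := Metric.infDist_le_infDist_add_dist (s := Uᶜ) (x := f a)
        (y := TopologicalSpace.denseSeq X n)
      linarith
    · rintro ⟨n, hn⟩
      by_contra ha
      have := Metric.infDist_le_dist_of_mem (x := TopologicalSpace.denseSeq X n)
        (show f a ∈ Uᶜ from ha)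
      rw [dist_comm] at this
      linarith
  rw [e]
  exact MeasurableSet.iUnion fun n => measurableSet_lt (h _) measurable_const

/-- The distance to a fixed element is a power of a parameter integral of a jointly measurable
function, hence measurable by Tonelli; separability of L² concludes. -/
theorem stronglyMeasurable_toLp {α β E : Type*} [MeasurableSpace α] [MeasurableSpace β]
    {μ : Measure β} [SFinite μ] [IsSeparable μ] [NormedAddCommGroup E] [SecondCountableTopology E]
    {F : α → β → E} (hF : StronglyMeasurable (Function.uncurry F)) (hm : ∀ a, MemLp (F a) 2 μ) :
    StronglyMeasurable fun a => (hm a).toLp := by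
  have : Fact ((2 : ℝ≥0∞) ≠ ∞) := ⟨by norm_num⟩
  have : SecondCountableTopology (Lp E 2 μ) := Lp.SecondCountableTopology
  borelize ↥(Lp E 2 μ)
  refine Measurable.stronglyMeasurable (measurable_of_dist fun g => ?_)
  have e : (fun a => dist (hm a).toLp g) =
      fun a => ((∫⁻ x, ‖F a x - g x‖ₑ ^ (2 : ℝ) ∂μ) ^ (1 / (2 : ℝ))).toReal := by
    funext a
    rw [dist_eq_norm, Lp.norm_def, eLpNorm_congr_ae (g := fun x => F a x - g x),
      eLpNorm_eq_lintegral_rpow_enorm_toReal (by norm_num) (by norm_num)]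
    · simp
    · filter_upwards [Lp.coeFn_sub (hm a).toLp g, (hm a).coeFn_toLp] with x h1 h2
      rw [h1, Pi.sub_apply, h2]
  rw [e]
  have hs : StronglyMeasurable (fun p : α × β => F p.1 p.2 - g p.2) :=
    hF.sub ((Lp.stronglyMeasurable g).comp_measurable measurable_snd)
  exact ((Measurable.lintegral_prod_right' (hs.enorm.pow_const _)).pow_const _).ennreal_toReal

end StrongMeasurability

/-! ### Divergence form operators on H¹. -/

section Flux

variable {d : ℕ}

/-- The weak gradient as a continuous linear map. -/
def H1.gradL (d : ℕ) : H1 d →L[ℝ] L2Vec d :=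
  (WithLp.sndL 2 ℝ (L2 d) (L2Vec d)).comp (H1 d).subtypeL

theorem H1.gradL_apply (v : H1 d) : H1.gradL d v = H1.grad v := rfl

theorem H1.norm_sq (v : H1 d) : ‖v‖ ^ 2 = ‖H1.toL2 d v‖ ^ 2 + ‖H1.gradL d v‖ ^ 2 :=
  WithLp.prod_norm_sq_eq_of_L2 v.1

theorem H1.norm_toL2_le (v : H1 d) : ‖H1.toL2 d v‖ ≤ ‖v‖ := by
  have := H1.norm_sq v
  nlinarith [norm_nonneg v, norm_nonneg (H1.toL2 d v), sq_nonneg ‖H1.gradL d v‖]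

theorem H1.norm_gradL_le (v : H1 d) : ‖H1.gradL d v‖ ≤ ‖v‖ := by
  have := H1.norm_sq v
  nlinarith [norm_nonneg v, norm_nonneg (H1.gradL d v), sq_nonneg ‖H1.toL2 d v‖]

/-- Measurable coefficients bounded by `M`: a drift and a diffusion matrix. -/
structure BddCoeff {α : Type*} [MeasurableSpace α] (c : α → Space d)
    (B : α → Space d →L[ℝ] Space d) (M : ℝ) : Prop where
  meas_c : StronglyMeasurable c
  meas_B : StronglyMeasurable B
  le_c : ∀ p, ‖c p‖ ≤ M
  le_B : ∀ p, ‖B p‖ ≤ M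

variable {M : ℝ} {c c' : Space d → Space d} {B B' : Space d → Space d →L[ℝ] Space d}

theorem BddCoeff.nonneg (h : BddCoeff c B M) : 0 ≤ M := (norm_nonneg _).trans (h.le_c 0)

theorem BddCoeff.slice {c : ℝ × Space d → Space d} {B : ℝ × Space d → Space d →L[ℝ] Space d}
    (h : BddCoeff c B M) (t : ℝ) : BddCoeff (fun x => c (t, x)) (fun x => B (t, x)) M where
  meas_c := h.meas_c.comp_measurable measurable_prodMk_left
  meas_B := h.meas_B.comp_measurable measurable_prodMk_left
  le_c _ := h.le_c _
  le_B _ := h.le_B _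

theorem stronglyMeasurable_clm_apply {α : Type*} [MeasurableSpace α]
    {B : α → Space d →L[ℝ] Space d} {f : α → Space d} (hB : StronglyMeasurable B)
    (hf : StronglyMeasurable f) : StronglyMeasurable fun a => B a (f a) :=
  isBoundedBilinearMap_apply.continuous.comp_stronglyMeasurable (hB.prodMk hf)

theorem BddCoeff.memLp (h : BddCoeff c B M) (v : H1 d) :
    MemLp (fun x => H1.toL2 d v x • c x + B x (H1.gradL d v x)) 2 volume := by
  refine MemLp.add ?_ ?_
  · refine (Lp.memLp (H1.toL2 d v)).of_le_mul (c := M)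
      (show StronglyMeasurable fun x => H1.toL2 d v x • c x from
        (Lp.stronglyMeasurable (H1.toL2 d v)).smul h.meas_c).aestronglyMeasurable
      (Eventually.of_forall fun x => ?_)
    rw [norm_smul, mul_comm]
    exact mul_le_mul_of_nonneg_right (h.le_c x) (norm_nonneg _)
  · refine (Lp.memLp (H1.gradL d v)).of_le_mul (c := M)
      (stronglyMeasurable_clm_apply h.meas_B (Lp.stronglyMeasurable _)).aestronglyMeasurable
      (Eventually.of_forall fun x => (B x).le_of_opNorm_le (h.le_B x) _)

theorem norm_toLp_le_of_sq {f : Space d → Space d} (hf : MemLp f 2 volume) {v : H1 d}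
    (hM : 0 ≤ M) (h : ∀ x, ‖f x‖ ≤ M * (‖H1.toL2 d v x‖ + ‖H1.gradL d v x‖)) :
    ‖hf.toLp‖ ≤ 2 * M * ‖v‖ := by
  have m1 := (Lp.memLp (H1.toL2 d v)).norm
  have m2 := (Lp.memLp (H1.gradL d v)).norm
  have h1 : ‖hf.toLp‖ ≤ M * ‖m1.toLp + m2.toLp‖ := by
    refine Lp.norm_le_mul_norm_of_ae_le_mul ?_
    filter_upwards [hf.coeFn_toLp, Lp.coeFn_add m1.toLp m2.toLp, m1.coeFn_toLp, m2.coeFn_toLp]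
      with x h1 h2 h3 h4
    rw [h1, h2, Pi.add_apply, h3, h4, Real.norm_of_nonneg (by positivity)]
    exact h x
  have h2 : ‖m1.toLp‖ = ‖H1.toL2 d v‖ := by
    rw [Lp.norm_toLp, eLpNorm_norm, Lp.norm_def]
  have h3 : ‖m2.toLp‖ = ‖H1.gradL d v‖ := by
    rw [Lp.norm_toLp, eLpNorm_norm, Lp.norm_def]
  calc _ ≤ _ := h1
    _ ≤ M * (‖H1.toL2 d v‖ + ‖H1.gradL d v‖) := by
        rw [← h2, ← h3]; gcongr; exact norm_add_le _ _
    _ ≤ M * (‖v‖ + ‖v‖) := by gcongr; exacts [H1.norm_toL2_le v, H1.norm_gradL_le v]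
    _ = _ := by ring

/-- The flux `v ↦ v c + B ∇v`. -/
def flux (h : BddCoeff c B M) : H1 d →L[ℝ] L2Vec d :=
  LinearMap.mkContinuous
    { toFun := fun v => (h.memLp v).toLp
      map_add' := fun v w => by
        rw [← MemLp.toLp_add]
        refine MemLp.toLp_congr _ _ ?_
        rw [map_add, map_add]
        filter_upwards [Lp.coeFn_add (H1.toL2 d v) (H1.toL2 d w),
          Lp.coeFn_add (H1.gradL d v) (H1.gradL d w)] with x h1 h2
        simp only [h1, h2, Pi.add_apply, add_smul, map_add]
        abel
      map_smul' := fun a v => by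
        rw [RingHom.id_apply, ← MemLp.toLp_const_smul]
        refine MemLp.toLp_congr _ _ ?_
        rw [map_smul, map_smul]
        filter_upwards [Lp.coeFn_smul a (H1.toL2 d v),
          Lp.coeFn_smul a (H1.gradL d v)] with x h1 h2
        simp only [h1, h2, Pi.smul_apply, map_smul, smul_add, smul_assoc] } (2 * M)
    (fun v => norm_toLp_le_of_sq (h.memLp v) h.nonneg fun x => by
      refine (norm_add_le _ _).trans ?_
      rw [norm_smul, mul_add, mul_comm]
      exact add_le_add (mul_le_mul_of_nonneg_right (h.le_c x) (norm_nonneg _))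
        ((B x).le_of_opNorm_le (h.le_B x) _))

theorem coeFn_flux (h : BddCoeff c B M) (v : H1 d) :
    flux h v =ᵐ[volume] fun x => H1.toL2 d v x • c x + B x (H1.gradL d v x) :=
  (h.memLp v).coeFn_toLp

theorem norm_flux_le (h : BddCoeff c B M) : ‖flux h‖ ≤ 2 * M :=
  LinearMap.mkContinuous_norm_le _ (by have := h.nonneg; positivity) _

/-- The operator of the bilinear form `∫ (v c + B ∇v) · ∇φ`. -/
def divOperator (h : BddCoeff c B M) : H1 d →L[ℝ] H1 d := (H1.gradL d).adjoint.comp (flux h)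

theorem inner_divOperator (h : BddCoeff c B M) (v φ : H1 d) :
    inner ℝ (divOperator h v) φ = inner ℝ (flux h v) (H1.gradL d φ) := by
  rw [divOperator, ContinuousLinearMap.comp_apply, ContinuousLinearMap.adjoint_inner_left]

theorem norm_gradL_adjoint_le : ‖(H1.gradL d).adjoint‖ ≤ 1 := by
  rw [LinearIsometryEquiv.norm_map]
  exact ContinuousLinearMap.opNorm_le_bound _ zero_le_one fun v => by
    rw [one_mul]; exact H1.norm_gradL_le v

theorem norm_divOperator_le (h : BddCoeff c B M) : ‖divOperator h‖ ≤ 2 * M := by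
  refine (ContinuousLinearMap.opNorm_comp_le _ _).trans ?_
  calc _ ≤ 1 * (2 * M) :=
        mul_le_mul norm_gradL_adjoint_le (norm_flux_le h) (flux h).opNorm_nonneg zero_le_one
    _ = _ := one_mul _

/-- Gårding's inequality. Young bounds the drift term by `γ/4 ‖∇v‖² + M²/γ |v|²`, which costs half
of the ellipticity; a further `γ/4` times the L² norm squared completes the H¹ norm. -/
theorem divOperator_coercive (h : BddCoeff c B M) {γ : ℝ} (hγ : 0 < γ)
    (hB : ∀ x ξ, γ / 2 * ‖ξ‖ ^ 2 ≤ inner ℝ (B x ξ) ξ) (v : H1 d) :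
    γ / 4 * ‖v‖ ^ 2 ≤ inner ℝ (divOperator h v) v + (M ^ 2 / γ + γ / 4) * ‖H1.toL2 d v‖ ^ 2 := by
  rw [inner_divOperator, L2.inner_def, H1.norm_sq v]
  have n1 : ‖H1.toL2 d v‖ ^ 2 = ∫ x, ‖H1.toL2 d v x‖ ^ 2 := by
    rw [integral_norm_sq_eq (Lp.memLp _), Lp.toLp_coeFn]
  have n2 : ‖H1.gradL d v‖ ^ 2 = ∫ x, ‖H1.gradL d v x‖ ^ 2 := by
    rw [integral_norm_sq_eq (Lp.memLp _), Lp.toLp_coeFn]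
  have i1 : Integrable (fun x => M ^ 2 / γ * ‖H1.toL2 d v x‖ ^ 2) volume :=
    (integrable_norm_sq (Lp.memLp _)).const_mul _
  have i2 : Integrable (fun x => γ / 4 * ‖H1.gradL d v x‖ ^ 2) volume :=
    (integrable_norm_sq (Lp.memLp _)).const_mul _
  have key : ∫ x, (γ / 4 * ‖H1.gradL d v x‖ ^ 2 - M ^ 2 / γ * ‖H1.toL2 d v x‖ ^ 2) ≤
      ∫ x, inner ℝ (flux h v x) (H1.gradL d v x) := by
    refine integral_mono_ae (i2.sub i1) (L2.integrable_inner _ _) ?_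
    filter_upwards [coeFn_flux h v] with x hx
    rw [hx, inner_add_left, inner_smul_left, RCLike.conj_to_real]
    set r := H1.toL2 d v x
    set ξ := H1.gradL d v x
    have h1 := hB x ξ
    have h2 : -(‖r‖ * (M * ‖ξ‖)) ≤ r * inner ℝ (c x) ξ := by
      refine neg_le_of_abs_le ?_
      rw [abs_mul, Real.norm_eq_abs]
      refine mul_le_mul_of_nonneg_left ((abs_real_inner_le_norm _ _).trans ?_) (abs_nonneg _)
      exact mul_le_mul_of_nonneg_right (h.le_c x) (norm_nonneg _)
    have h3 : ‖r‖ * (M * ‖ξ‖) ≤ γ / 4 * ‖ξ‖ ^ 2 + M ^ 2 / γ * ‖r‖ ^ 2 := by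
      have h4 : 0 ≤ (γ / 2 * ‖ξ‖ - M * ‖r‖) ^ 2 / γ := by positivity
      have h5 : (γ / 2 * ‖ξ‖ - M * ‖r‖) ^ 2 / γ =
          γ / 4 * ‖ξ‖ ^ 2 + M ^ 2 / γ * ‖r‖ ^ 2 - ‖r‖ * (M * ‖ξ‖) := by field_simp; ring
      linarith
    linarith
  rw [integral_sub i2 i1, integral_const_mul, integral_const_mul, ← n1, ← n2] at key
  linarith

/-- For fixed `v` the flux differences tend to zero almost everywhere and their squares are
dominated by a multiple of `|v|² + |∇v|²`. The convergence is strong, not in operator norm, since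
the coefficients converge only almost everywhere. -/
theorem tendsto_flux {cn : ℕ → Space d → Space d} {Bn : ℕ → Space d → Space d →L[ℝ] Space d}
    (hn : ∀ n, BddCoeff (cn n) (Bn n) M) (h : BddCoeff c B M)
    (hc : ∀ᵐ x, Tendsto (fun n => cn n x) atTop (𝓝 (c x)))
    (hB : ∀ᵐ x, Tendsto (fun n => Bn n x) atTop (𝓝 (B x))) (v : H1 d) :
    Tendsto (fun n => divOperator (hn n) v) atTop (𝓝 (divOperator h v)) := by
  refine ((H1.gradL d).adjoint.continuous.tendsto _).comp ?_
  have m1 : ∀ n, MemLp (fun x => flux (hn n) v x - flux h v x) 2 volume := fun n =>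
    (Lp.memLp _).sub (Lp.memLp _)
  have e : ∀ n, ‖flux (hn n) v - flux h v‖ ^ 2 = ∫ x, ‖flux (hn n) v x - flux h v x‖ ^ 2 := by
    intro n
    rw [integral_norm_sq_eq (m1 n)]
    congr 2
    refine Lp.ext ?_
    filter_upwards [(m1 n).coeFn_toLp, Lp.coeFn_sub (flux (hn n) v) (flux h v)] with x h1 h2
    rw [h1, h2]; rfl
  rw [tendsto_iff_norm_sub_tendsto_zero]
  have hsq : Tendsto (fun n => ‖flux (hn n) v - flux h v‖ ^ 2) atTop (𝓝 0) := by
    simp_rw [e]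
    have hr := Lp.memLp (H1.toL2 d v)
    have hξ := Lp.memLp (H1.gradL d v)
    rw [← integral_zero (Space d) ℝ (μ := volume)]
    refine tendsto_integral_of_dominated_convergence
      (fun x => 8 * M ^ 2 * ‖H1.toL2 d v x‖ ^ 2 + 8 * M ^ 2 * ‖H1.gradL d v x‖ ^ 2)
      (fun n => (integrable_norm_sq (m1 n)).aestronglyMeasurable)
      (((integrable_norm_sq hr).const_mul _).add ((integrable_norm_sq hξ).const_mul _))
      (fun n => ?_) ?_
    · filter_upwards [coeFn_flux (hn n) v, coeFn_flux h v] with x h1 h2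
      rw [h1, h2, Real.norm_of_nonneg (by positivity)]
      set r := H1.toL2 d v x
      set ξ := H1.gradL d v x
      have hb : ∀ {c : Space d → Space d} {B : Space d → Space d →L[ℝ] Space d},
          BddCoeff c B M → ‖r • c x + B x ξ‖ ≤ M * ‖r‖ + M * ‖ξ‖ := by
        intro c B h
        refine (norm_add_le _ _).trans ?_
        rw [norm_smul, mul_comm]
        exact add_le_add (mul_le_mul_of_nonneg_right (h.le_c x) (norm_nonneg _))
          ((B x).le_of_opNorm_le (h.le_B x) _)
      have h3 : ‖r • cn n x + Bn n x ξ - (r • c x + B x ξ)‖ ≤ 2 * (M * ‖r‖ + M * ‖ξ‖) := by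
        refine (norm_sub_le _ _).trans ?_
        linarith [hb (hn n), hb h]
      have h4 := pow_le_pow_left₀ (norm_nonneg _) h3 2
      nlinarith [sq_nonneg (M * ‖r‖ - M * ‖ξ‖)]
    · have hall : ∀ᵐ x, ∀ n, flux (hn n) v x = H1.toL2 d v x • cn n x + Bn n x (H1.gradL d v x) :=
        ae_all_iff.2 fun n => coeFn_flux (hn n) v
      filter_upwards [hall, coeFn_flux h v, hc, hB] with x h1 h2 h3 h4
      simp_rw [h1, h2]
      have h5 := ((h3.const_smul (H1.toL2 d v x)).add
        (((ContinuousLinearMap.apply ℝ (Space d) (H1.gradL d v x)).continuous.tendsto _).comp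
          h4)).sub_const
        (H1.toL2 d v x • c x + B x (H1.gradL d v x))
      simp only [ContinuousLinearMap.apply_apply, sub_self, Function.comp_apply] at h5
      have h6 := h5.norm.pow 2
      simpa using h6
  have := hsq.sqrt
  simpa [Real.sqrt_sq] using this

theorem isElliptic_divOperator {c : ℝ × Space d → Space d}
    {B : ℝ × Space d → Space d →L[ℝ] Space d} (h : BddCoeff c B M) {γ : ℝ} (hγ : 0 < γ)
    (hB : ∀ p ξ, γ / 2 * ‖ξ‖ ^ 2 ≤ inner ℝ (B p ξ) ξ) :
    IsElliptic (H1.toL2 d) (fun t => divOperator (h.slice t)) (2 * M) (M ^ 2 / γ + γ / 4)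
      (γ / 4) where
  meas v := by
    refine (H1.gradL d).adjoint.continuous.comp_stronglyMeasurable ?_
    refine stronglyMeasurable_toLp
      (F := fun t x => H1.toL2 d v x • c (t, x) + B (t, x) (H1.gradL d v x)) ?_
      (fun t => (h.slice t).memLp v)
    exact (((Lp.stronglyMeasurable (H1.toL2 d v)).comp_measurable measurable_snd).smul h.meas_c).add
      (stronglyMeasurable_clm_apply h.meas_B ((Lp.stronglyMeasurable (H1.gradL d v)).comp_measurable
        measurable_snd))
  norm_le t := norm_divOperator_le _
  coercive t v := divOperator_coercive _ hγ (fun x ξ => hB (t, x) ξ) v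

end Flux

/-! ### Strong convergence of operators along a fixed function. -/

section OperatorConvergence

variable {V : Type*} [NormedAddCommGroup V] [InnerProductSpace ℝ V] [SecondCountableTopology V]

/-- Because `w` does not vary with `n`, strong convergence at almost every time and the common bound
`M` allow dominated convergence. -/
theorem tendsto_integral_norm_sub_sq {An : ℕ → ℝ → V →L[ℝ] V} {A : ℝ → V →L[ℝ] V} {M : ℝ}
    (hnm : ∀ n v, StronglyMeasurable fun t => An n t v) (hm : ∀ v, StronglyMeasurable fun t => A t v)
    (hnM : ∀ n t, ‖An n t‖ ≤ M) (hM : ∀ t, ‖A t‖ ≤ M) {μ : Measure ℝ} {w : ℝ → V}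
    (hw : MemLp w 2 μ) (hlim : ∀ᵐ t ∂μ, ∀ v, Tendsto (fun n => An n t v) atTop (𝓝 (A t v))) :
    Tendsto (fun n => ∫ t, ‖An n t (w t) - A t (w t)‖ ^ 2 ∂μ) atTop (𝓝 0) := by
  rw [← integral_zero ℝ ℝ (μ := μ)]
  refine tendsto_integral_of_dominated_convergence (fun t => 4 * M ^ 2 * ‖w t‖ ^ 2) (fun n => ?_)
    ((integrable_norm_sq hw).const_mul _) (fun n => Eventually.of_forall fun t => ?_) ?_
  · exact (integrable_norm_sq ((memLp_apply (hnm n) (hnM n) hw).sub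
      (memLp_apply hm hM hw))).aestronglyMeasurable
  · rw [Real.norm_of_nonneg (by positivity)]
    have h1 : ‖An n t (w t) - A t (w t)‖ ≤ 2 * (M * ‖w t‖) := by
      refine (norm_sub_le _ _).trans ?_
      have h2 := (An n t).le_of_opNorm_le (hnM n t) (w t)
      have h3 := (A t).le_of_opNorm_le (hM t) (w t)
      linarith
    have h4 := pow_le_pow_left₀ (norm_nonneg _) h1 2
    nlinarith
  · filter_upwards [hlim] with t ht
    have := ((ht (w t)).sub_const (A t (w t))).norm.pow 2
    simpa using this

end OperatorConvergence

/-! ### Integrals of Sobolev kernels against bounded functions of bounded support. -/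

section Kernel

variable {d : ℕ} {ℓ : ℝ≥0∞}

/-- `x ↦ ∫ k (x - x') φ x' dx'`. -/
def kernelInt (k φ : Space d → ℝ) (x : Space d) : ℝ := ∫ x', k (x - x') * φ x'

/-- `φ` is measurable, bounded by `M` and vanishes outside the ball of radius `R`. -/
structure BddSupp (R M : ℝ) (φ : Space d → ℝ) : Prop where
  meas : AEStronglyMeasurable φ volume
  bdd : ∀ᵐ x, ‖φ x‖ ≤ M
  supp : ∀ x, R < ‖x‖ → φ x = 0

theorem memLp_comp_sub_left {k : Space d → ℝ} (hk : MemLp k ℓ volume) (x : Space d) :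
    MemLp (fun x' => k (x - x')) ℓ volume :=
  hk.comp_measurePreserving (Measure.measurePreserving_sub_left volume x)

theorem integrableOn_comp_sub_left (hℓ : 1 ≤ ℓ) {k : Space d → ℝ} (hk : MemLp k ℓ volume)
    (x : Space d) (R : ℝ) : IntegrableOn (fun x' => k (x - x')) (Metric.closedBall 0 R) volume :=
  ((memLp_comp_sub_left hk x).locallyIntegrable hℓ).integrableOn_isCompact
    (isCompact_closedBall _ _)

/-- Hölder on a ball of finite volume; translation invariance makes the constant independent of `x`.
-/
theorem exists_integral_comp_sub_left_le (d : ℕ) (hℓ : 1 ≤ ℓ) (R : ℝ) :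
    ∃ C : ℝ, 0 ≤ C ∧ ∀ k : Space d → ℝ, MemLp k ℓ volume → ∀ x,
      ∫ x' in Metric.closedBall 0 R, ‖k (x - x')‖ ≤ C * (eLpNorm k ℓ volume).toReal := by
  set μ : Measure (Space d) := volume.restrict (Metric.closedBall 0 R) with hμ
  have hfin : μ univ ^ (1 / (1 : ℝ≥0∞).toReal - 1 / ℓ.toReal) ≠ ∞ := by
    refine ENNReal.rpow_ne_top_of_nonneg ?_ ?_
    · rw [ENNReal.toReal_one, sub_nonneg]
      by_cases h : ℓ = ∞
      · simp [h]
      · have : 1 ≤ ℓ.toReal := by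
          have := ENNReal.toReal_mono h hℓ
          simpa using this
        rw [div_one]
        exact div_le_one_of_le₀ this (by linarith)
    · rw [hμ, Measure.restrict_apply_univ]
      exact (isCompact_closedBall (0 : Space d) R).measure_lt_top.ne
  refine ⟨(μ univ ^ (1 / (1 : ℝ≥0∞).toReal - 1 / ℓ.toReal)).toReal, ENNReal.toReal_nonneg,
    fun k hk x => ?_⟩
  have hkx := memLp_comp_sub_left hk x
  have h1 := eLpNorm_le_eLpNorm_mul_rpow_measure_univ (μ := μ) hℓ hkx.1.restrict
  have h2 : eLpNorm (fun x' => k (x - x')) ℓ μ ≤ eLpNorm k ℓ volume := by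
    refine (eLpNorm_mono_measure _ Measure.restrict_le_self).trans_eq ?_
    exact eLpNorm_comp_measurePreserving hk.1 (Measure.measurePreserving_sub_left volume x)
  rw [integral_norm_eq_lintegral_enorm hkx.1.restrict, ← eLpNorm_one_eq_lintegral_enorm,
    ← ENNReal.toReal_mul]
  refine ENNReal.toReal_mono (ENNReal.mul_ne_top hfin hk.2.ne) ?_
  rw [mul_comm]
  exact h1.trans (by gcongr)

variable {R M : ℝ} {φ : Space d → ℝ}

theorem BddSupp.norm_le (hφ : BddSupp R M φ) (k : Space d → ℝ) (x : Space d) :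
    ∀ᵐ x', ‖k (x - x') * φ x'‖ ≤
      (Metric.closedBall 0 R).indicator (fun x' => ‖k (x - x')‖ * M) x' := by
  filter_upwards [hφ.bdd] with x' h
  by_cases hx : x' ∈ Metric.closedBall 0 R
  · rw [indicator_of_mem hx, norm_mul]
    exact mul_le_mul_of_nonneg_left h (norm_nonneg _)
  · rw [indicator_of_notMem hx, hφ.supp x' (by simpa using hx), mul_zero, norm_zero]

theorem integrable_indicator_kernel (hℓ : 1 ≤ ℓ) {k : Space d → ℝ} (hk : MemLp k ℓ volume)
    (x : Space d) (R M : ℝ) :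
    Integrable ((Metric.closedBall 0 R).indicator fun x' => ‖k (x - x')‖ * M) volume :=
  (integrable_indicator_iff measurableSet_closedBall).2
    ((integrableOn_comp_sub_left hℓ hk x R).norm.mul_const M)

theorem BddSupp.integrable (hφ : BddSupp R M φ) (hℓ : 1 ≤ ℓ) {k : Space d → ℝ}
    (hk : MemLp k ℓ volume) (x : Space d) : Integrable (fun x' => k (x - x') * φ x') volume :=
  (integrable_indicator_kernel hℓ hk x R M).mono' ((memLp_comp_sub_left hk x).1.mul hφ.meas)
    (hφ.norm_le k x)

theorem exists_kernelInt_le (d : ℕ) (hℓ : 1 ≤ ℓ) (R M : ℝ) (hM : 0 ≤ M) :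
    ∃ C : ℝ, 0 ≤ C ∧ ∀ k : Space d → ℝ, MemLp k ℓ volume → ∀ φ, BddSupp R M φ → ∀ x,
      ‖kernelInt k φ x‖ ≤ C * (eLpNorm k ℓ volume).toReal := by
  obtain ⟨C, hC0, hC⟩ := exists_integral_comp_sub_left_le d hℓ R
  refine ⟨C * M, by positivity, fun k hk φ hφ x => ?_⟩
  refine (norm_integral_le_of_norm_le (integrable_indicator_kernel hℓ hk x R M)
    (hφ.norm_le k x)).trans ?_
  rw [integral_indicator measurableSet_closedBall, integral_mul_const]
  calc _ ≤ C * (eLpNorm k ℓ volume).toReal * M := mul_le_mul_of_nonneg_right (hC k hk x) hM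
    _ = _ := by ring

theorem BddSupp.integrable_self (hφ : BddSupp R M φ) : Integrable φ volume := by
  refine Integrable.mono' (g := (Metric.closedBall 0 R).indicator fun _ => M)
    ((integrable_indicator_iff measurableSet_closedBall).2 (integrableOn_const
      (isCompact_closedBall (0 : Space d) R).measure_lt_top.ne)) hφ.meas ?_
  filter_upwards [hφ.bdd] with x h
  by_cases hx : x ∈ Metric.closedBall 0 R
  · rwa [indicator_of_mem hx]
  · rw [indicator_of_notMem hx, hφ.supp x (by simpa using hx), norm_zero]

/-- Continuous compactly supported kernels are dense in `L^ℓ` for finite `ℓ`, and the error they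
cause is uniform in `x`. -/
theorem continuous_kernelInt (hφ : BddSupp R M φ) (hM : 0 ≤ M) (hℓ : 1 ≤ ℓ) (hℓ' : ℓ ≠ ∞)
    {k : Space d → ℝ} (hk : MemLp k ℓ volume) : Continuous (kernelInt k φ) := by
  obtain ⟨C, hC0, hC⟩ := exists_kernelInt_le d hℓ R M hM
  refine continuous_of_uniform_approx_of_continuous fun u hu => ?_
  obtain ⟨ε, hε, hεu⟩ := Metric.mem_uniformity_dist.1 hu
  obtain ⟨g, hgc, hg, hgcont, hgm⟩ := hk.exists_hasCompactSupport_eLpNorm_sub_le hℓ'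
    (ε := ENNReal.ofReal (ε / (2 * (C + 1)))) (by
      rw [ne_eq, ENNReal.ofReal_eq_zero, not_le]; positivity)
  refine ⟨kernelInt g φ, ?_, fun x => hεu ?_⟩
  · obtain ⟨D, hD⟩ := hgcont.bounded_above_of_compact_support hgc
    refine continuous_of_dominated (bound := fun x' => D * ‖φ x'‖) (fun x => ?_) (fun x => ?_)
      (hφ.integrable_self.norm.const_mul D) (Eventually.of_forall fun x' => ?_)
    · exact (hgcont.comp (continuous_const.sub continuous_id)).aestronglyMeasurable.mul hφ.meas
    · refine Eventually.of_forall fun x' => ?_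
      rw [norm_mul]
      exact mul_le_mul_of_nonneg_right (hD _) (norm_nonneg _)
    · fun_prop
  · have e : kernelInt k φ x - kernelInt g φ x = kernelInt (k - g) φ x := by
      simp only [kernelInt, Pi.sub_apply, sub_mul]
      rw [integral_sub (hφ.integrable hℓ hk x) (hφ.integrable hℓ hgm x)]
    rw [Real.dist_eq, e, ← Real.norm_eq_abs]
    have h1 := hC (k - g) (hk.sub hgm) φ hφ x
    have h2 : (eLpNorm (k - g) ℓ volume).toReal ≤ ε / (2 * (C + 1)) :=
      ENNReal.toReal_le_of_le_ofReal (by positivity) hg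
    calc _ ≤ C * (ε / (2 * (C + 1))) := h1.trans (by gcongr)
      _ ≤ (C + 1) * (ε / (2 * (C + 1))) := by gcongr; linarith
      _ = ε / 2 := by field_simp
      _ < ε := half_lt_self hε

theorem BddSupp.mollify (hφ : BddSupp R M φ) (n : ℕ) : BddSupp (R + 1) M (mollify n φ) where
  meas := (contDiff_mollify hφ.integrable_self.locallyIntegrable n).continuous.aestronglyMeasurable
  bdd := Eventually.of_forall fun x => norm_mollify_le hφ.bdd n x
  supp _ hx := mollify_eq_zero hφ.supp n hx

theorem tendsto_kernelInt_mollify (hφ : BddSupp R M φ) (hℓ : 1 ≤ ℓ) {k : Space d → ℝ}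
    (hk : MemLp k ℓ volume) (x : Space d) :
    Tendsto (fun n => kernelInt k (FPControl.mollify n φ) x) atTop (𝓝 (kernelInt k φ x)) := by
  refine tendsto_integral_of_dominated_convergence _
    (fun n => (memLp_comp_sub_left hk x).1.mul (hφ.mollify n).meas)
    (integrable_indicator_kernel hℓ hk x (R + 1) M) (fun n => (hφ.mollify n).norm_le k x) ?_
  filter_upwards [ae_tendsto_mollify hφ.integrable_self.locallyIntegrable] with x' h
  exact h.const_mul _

/-- Differentiation of the convolution first falls on `φ`. The reflected translate `t ↦ φ (x - t)`
is a test function, and the definition of the weak gradient moves the derivative to `K`. -/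
theorem hasFDerivAt_kernelInt_smooth {K : Space d → ℝ} {g : Space d → Space d}
    (hK : HasWeakGradient K g) (hKl : LocallyIntegrable K volume)
    (hφ : ContDiff ℝ (⊤ : ℕ∞) φ) (hc : HasCompactSupport φ)
    (x : Space d) :
    HasFDerivAt (kernelInt K φ)
      (∑ i, kernelInt (fun z => g z i) φ x • (EuclideanSpace.proj (𝕜 := ℝ) i : Space d →L[ℝ] ℝ)) x := by
  have hφ1 : ContDiff ℝ 1 φ := hφ.of_le (by exact_mod_cast le_top)
  have e0 : kernelInt K φ = (K ⋆[ContinuousLinearMap.mul ℝ ℝ, volume] φ) := by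
    funext x
    rw [convolution_eq_swap]
    rfl
  have h := hc.hasFDerivAt_convolution_right (ContinuousLinearMap.mul ℝ ℝ) hKl hφ1 x
  rw [e0]
  convert! h using 1
  refine ContinuousLinearMap.coe_injective
    ((EuclideanSpace.basisFun (Fin d) ℝ).toBasis.ext fun i => ?_)
  have e1 : (EuclideanSpace.basisFun (Fin d) ℝ).toBasis i = EuclideanSpace.single i (1 : ℝ) := by
    simp
  simp only [e1, ContinuousLinearMap.coe_coe]
  rw [convolution_precompR_apply _ hKl (hc.fderiv (𝕜 := ℝ)) (hφ1.continuous_fderiv one_ne_zero)]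
  have e2 : (∑ j, kernelInt (fun z => g z j) φ x •
      (EuclideanSpace.proj (𝕜 := ℝ) j : Space d →L[ℝ] ℝ)) (EuclideanSpace.single i 1) =
        kernelInt (fun z => g z i) φ x := by
    simp
  rw [e2]
  have hχ : ContDiff ℝ (⊤ : ℕ∞) fun t => φ (x - t) := hφ.comp (contDiff_const.sub contDiff_id)
  have hχc : HasCompactSupport fun t => φ (x - t) :=
    hc.comp_homeomorph (Homeomorph.subLeft x)
  have e3 : ∀ t, partialDeriv i (fun t => φ (x - t)) t = -fderiv ℝ φ (x - t) (EuclideanSpace.single i 1) := by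
    intro t
    have h1 : HasFDerivAt (fun t => φ (x - t)) ((fderiv ℝ φ (x - t)).comp
        (-ContinuousLinearMap.id ℝ (Space d))) t :=
      ((hφ1.differentiable one_ne_zero (x - t)).hasFDerivAt).comp t ((hasFDerivAt_id t).const_sub x)
    rw [partialDeriv, h1.fderiv]
    simp
  have h2 := (hK i).2.2 _ hχ hχc
  simp_rw [e3, mul_neg, integral_neg, neg_inj] at h2
  have e4 : (K ⋆[ContinuousLinearMap.mul ℝ ℝ, volume] fun a =>
      fderiv ℝ φ a (EuclideanSpace.single i 1)) x =
        ∫ t, K t * fderiv ℝ φ (x - t) (EuclideanSpace.single i 1) := rfl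
  rw [e4, h2, kernelInt, ← integral_sub_left_eq_self _ volume x]
  simp

/-- The fundamental theorem along segments survives pointwise limits, unlike differentiability
itself; with `L` continuous it gives the derivative back. -/
theorem hasFDerivAt_of_sub_eq_integral {F : Space d → ℝ} {L : Space d → Space d →L[ℝ] ℝ}
    (hL : Continuous L) (h : ∀ x y, F (x + y) - F x = ∫ s in (0 : ℝ)..1, L (x + s • y) y)
    (x : Space d) : HasFDerivAt F (L x) x := by
  rw [hasFDerivAt_iff_isLittleO_nhds_zero, Asymptotics.isLittleO_iff]
  intro ε hε
  obtain ⟨δ, hδ, hδε⟩ := Metric.continuousAt_iff.1 (hL.continuousAt (x := x)) ε hε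
  filter_upwards [Metric.ball_mem_nhds (0 : Space d) hδ] with y hy
  rw [mem_ball_zero_iff] at hy
  have hi : IntervalIntegrable (fun s : ℝ => L (x + s • y) y) volume 0 1 :=
    Continuous.intervalIntegrable (by fun_prop) _ _
  have e : F (x + y) - F x - L x y = ∫ s in (0 : ℝ)..1, (L (x + s • y) y - L x y) := by
    rw [intervalIntegral.integral_sub hi intervalIntegrable_const, ← h,
      intervalIntegral.integral_const]
    simp
  rw [e]
  refine (intervalIntegral.norm_integral_le_of_norm_le_const (C := ε * ‖y‖) fun s hs => ?_).trans_eq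
    (by simp)
  rw [uIoc_of_le zero_le_one] at hs
  rw [← _root_.sub_apply]
  refine ContinuousLinearMap.le_of_opNorm_le _ ?_ y
  rw [← dist_eq_norm]
  refine (hδε ?_).le
  rw [dist_eq_norm, add_sub_cancel_left, norm_smul, Real.norm_of_nonneg hs.1.le]
  calc s * ‖y‖ ≤ 1 * ‖y‖ := by gcongr; exact hs.2
    _ < δ := by rwa [one_mul]

/-- The gradient of `kernelInt K φ` is obtained by integrating the weak gradient of `K`. -/
theorem hasFDerivAt_kernelInt (hφ : BddSupp R M φ) (hM : 0 ≤ M) (hℓ : 1 ≤ ℓ) (hℓ' : ℓ ≠ ∞)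
    {K : Space d → ℝ} {g : Space d → Space d} (hK : HasWeakGradient K g)
    (hKm : MemLp K ℓ volume) (hg : MemLp g ℓ volume) (x : Space d) :
    HasFDerivAt (kernelInt K φ)
      (∑ i, kernelInt (fun z => g z i) φ x • (EuclideanSpace.proj (𝕜 := ℝ) i : Space d →L[ℝ] ℝ)) x := by
  have hgi : ∀ i, MemLp (fun z => g z i) ℓ volume := fun i =>
    hg.continuousLinearMap_comp (EuclideanSpace.proj (𝕜 := ℝ) i)
  obtain ⟨C, hC0, hC⟩ := exists_kernelInt_le d hℓ (R + 1) M hM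
  have hcont : ∀ {R : ℝ} {ψ : Space d → ℝ}, BddSupp R M ψ →
      Continuous fun x => ∑ i, kernelInt (fun z => g z i) ψ x •
        (EuclideanSpace.proj (𝕜 := ℝ) i : Space d →L[ℝ] ℝ) := fun hψ =>
    continuous_finsetSum _ fun i _ =>
      (continuous_kernelInt hψ hM hℓ hℓ' (hgi i)).smul continuous_const
  -- The density `φ` is mollified, not the kernel. The segment identity holds for each mollification
  -- and passes to the limit, dominated by the bound for radius `R + 1`, since mollifying enlarges
  -- the support by at most one.
  refine hasFDerivAt_of_sub_eq_integral (hcont hφ) (fun x y => ?_) x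
  have hsm : ∀ n, kernelInt K (FPControl.mollify n φ) (x + y) - kernelInt K (FPControl.mollify n φ) x =
      ∫ s in (0 : ℝ)..1, (∑ i, kernelInt (fun z => g z i) (FPControl.mollify n φ) (x + s • y) •
        (EuclideanSpace.proj (𝕜 := ℝ) i : Space d →L[ℝ] ℝ)) y := by
    intro n
    have hd : ∀ s : ℝ, HasDerivAt (fun s : ℝ => kernelInt K (FPControl.mollify n φ) (x + s • y))
        ((∑ i, kernelInt (fun z => g z i) (FPControl.mollify n φ) (x + s • y) •
          (EuclideanSpace.proj (𝕜 := ℝ) i : Space d →L[ℝ] ℝ)) y) s := by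
      intro s
      have h1 := hasFDerivAt_kernelInt_smooth hK (hKm.locallyIntegrable hℓ)
        (contDiff_mollify hφ.integrable_self.locallyIntegrable n)
        (hasCompactSupport_mollify hφ.supp n) (x + s • y)
      have h2 : HasDerivAt (fun s : ℝ => x + s • y) y s := by
        simpa using ((hasDerivAt_id s).smul_const y).const_add x
      exact h1.comp_hasDerivAt s h2
    have hci : Continuous fun s : ℝ => (∑ i, kernelInt (fun z => g z i) (FPControl.mollify n φ) (x + s • y) •
        (EuclideanSpace.proj (𝕜 := ℝ) i : Space d →L[ℝ] ℝ)) y :=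
      ((hcont (hφ.mollify n)).comp (by fun_prop)).clm_apply continuous_const
    rw [intervalIntegral.integral_eq_sub_of_hasDerivAt (fun s _ => hd s)
      (hci.intervalIntegrable _ _)]
    simp
  have hl := (tendsto_kernelInt_mollify hφ hℓ hKm (x + y)).sub
    (tendsto_kernelInt_mollify hφ hℓ hKm x)
  refine tendsto_nhds_unique hl ?_
  simp_rw [hsm]
  refine intervalIntegral.tendsto_integral_filter_of_dominated_convergence
    (fun _ => ∑ i, C * (eLpNorm (fun z => g z i) ℓ volume).toReal * ‖y‖)
    (Eventually.of_forall fun n => ?_) (Eventually.of_forall fun n =>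
      Eventually.of_forall fun s _ => ?_) intervalIntegrable_const
    (Eventually.of_forall fun s _ => ?_)
  · exact (((hcont (hφ.mollify n)).comp (by fun_prop)).clm_apply
      continuous_const).aestronglyMeasurable
  · rw [_root_.sum_apply]
    refine (norm_sum_le _ _).trans (Finset.sum_le_sum fun i _ => ?_)
    rw [_root_.smul_apply, norm_smul]
    exact mul_le_mul (hC _ (hgi i) _ (hφ.mollify n) _) (PiLp.norm_apply_le y i)
      (norm_nonneg _) (by positivity)
  · simp_rw [_root_.sum_apply, _root_.smul_apply]
    exact tendsto_finsetSum _ fun i _ =>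
      (tendsto_kernelInt_mollify hφ hℓ (hgi i) (x + s • y)).smul_const _

end Kernel

/-! ### Admissible controls and weak convergence. -/

section Control

variable {d : ℕ} {ω : Set (Space d)} {M₀ : ℝ}

theorem BddSupp.extend (hω : MeasurableSet ω) {R : ℝ} (hR : ω ⊆ Metric.closedBall 0 R)
    (hM : 0 ≤ M₀) {u : L2On ω} (hu : u ∈ admissible ω M₀) : BddSupp R M₀ (extend u) where
  meas := ((Lp.stronglyMeasurable u).indicator hω).aestronglyMeasurable
  bdd := by
    have h := (ae_restrict_iff' hω).1 (show ∀ᵐ x ∂(volume.restrict ω), u x ∈ Icc 0 M₀ from hu)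
    filter_upwards [h] with x hx
    by_cases hxω : x ∈ ω
    · rw [FPControl.extend, indicator_of_mem hxω, Real.norm_of_nonneg (hx hxω).1]
      exact (hx hxω).2
    · rwa [FPControl.extend, indicator_of_notMem hxω, norm_zero]
  supp x hx := indicator_of_notMem (fun h => by
    have := hR h
    rw [mem_closedBall_zero_iff] at this
    linarith) _

theorem S_eq_setIntegral (hω : MeasurableSet ω) (k : Space d → ℝ) (u : L2On ω) (x : Space d) :
    S k u x = ∫ x' in ω, k (x - x') * u x' := by
  rw [S, ← integral_indicator hω]
  congr 1
  funext x'
  by_cases h : x' ∈ ω <;> simp [extend, h]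

theorem S_nonneg (hω : MeasurableSet ω) {K : Space d → ℝ} (hK : ∀ x, 0 ≤ K x) {u : L2On ω}
    (hu : u ∈ admissible ω M₀) (x : Space d) : 0 ≤ S K u x := by
  rw [S_eq_setIntegral hω]
  refine integral_nonneg_of_ae ?_
  filter_upwards [show ∀ᵐ x ∂(volume.restrict ω), u x ∈ Icc 0 M₀ from hu] with x' h
  exact mul_nonneg (hK _) h.1

/-- Weak convergence tests against L², whereas `K` and its gradient may be merely integrable on `ω`.
The uniform bound `M₀` permits replacing `f` by a bounded continuous function close in L¹. -/
theorem tendsto_setIntegral_mul_of_weak [IsFiniteMeasure (volume.restrict ω)]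
    {un : ℕ → L2On ω} {u : L2On ω} (hn : ∀ n, un n ∈ admissible ω M₀) (hu : u ∈ admissible ω M₀)
    (hM : 0 ≤ M₀)
    (hw : ∀ f : L2On ω, Tendsto (fun n => inner ℝ f (un n)) atTop (𝓝 (inner ℝ f u)))
    {f : Space d → ℝ} (hf : Integrable f (volume.restrict ω)) :
    Tendsto (fun n => ∫ x in ω, f x * un n x) atTop (𝓝 (∫ x in ω, f x * u x)) := by
  have hbd : ∀ {v : L2On ω}, v ∈ admissible ω M₀ → ∀ᵐ x ∂(volume.restrict ω), ‖v x‖ ≤ M₀ := by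
    intro v hv
    filter_upwards [show ∀ᵐ x ∂(volume.restrict ω), v x ∈ Icc 0 M₀ from hv] with x h
    rw [Real.norm_of_nonneg h.1]; exact h.2
  have hint : ∀ {v : L2On ω}, v ∈ admissible ω M₀ → ∀ {f : Space d → ℝ},
      Integrable f (volume.restrict ω) → Integrable (fun x => f x * v x) (volume.restrict ω) := by
    intro v hv f hf
    exact hf.mul_bdd (c := M₀) (Lp.stronglyMeasurable v).aestronglyMeasurable (hbd hv)
  rw [Metric.tendsto_atTop]
  intro ε hε
  -- Two replacement errors and one weak convergence error each cost `ε / 4`; `M₀ + 1` avoids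
  -- division by zero.
  obtain ⟨g, hg, hgi⟩ := hf.exists_boundedContinuous_integral_sub_le
    (ε := ε / (4 * (M₀ + 1))) (by positivity)
  have hg2 : MemLp g 2 (volume.restrict ω) :=
    MemLp.of_bound g.continuous.aestronglyMeasurable ‖g‖ (Eventually.of_forall g.norm_coe_le_norm)
  have hgl : ∀ v : L2On ω, inner ℝ hg2.toLp v = ∫ x in ω, g x * v x := by
    intro v
    rw [L2.inner_def]
    refine integral_congr_ae ?_
    filter_upwards [hg2.coeFn_toLp] with x hx
    rw [hx]
    simp [mul_comm]
  have hdiff : ∀ {v : L2On ω}, v ∈ admissible ω M₀ →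
      ‖(∫ x in ω, f x * v x) - ∫ x in ω, g x * v x‖ ≤ ε / 4 := by
    intro v hv
    rw [← integral_sub (hint hv hf) (hint hv hgi)]
    refine (norm_integral_le_of_norm_le ((hf.sub hgi).norm.mul_const M₀) ?_).trans ?_
    · filter_upwards [hbd hv] with x hx
      rw [← sub_mul, norm_mul]
      exact mul_le_mul_of_nonneg_left hx (norm_nonneg _)
    · rw [integral_mul_const]
      calc _ ≤ ε / (4 * (M₀ + 1)) * M₀ := mul_le_mul_of_nonneg_right hg hM
        _ ≤ ε / (4 * (M₀ + 1)) * (M₀ + 1) := by gcongr; linarith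
        _ = ε / 4 := by field_simp
  obtain ⟨N, hN⟩ := Metric.tendsto_atTop.1 (hw hg2.toLp) (ε / 4) (by positivity)
  refine ⟨N, fun n hnN => ?_⟩
  have h1 := hN n hnN
  rw [hgl, hgl, Real.dist_eq] at h1
  have h2 := hdiff (hn n)
  have h3 := hdiff hu
  rw [Real.norm_eq_abs] at h2 h3
  rw [Real.dist_eq]
  rw [abs_lt] at *
  rw [abs_le] at h2 h3
  constructor <;> linarith

theorem tendsto_S_of_weak (hω : MeasurableSet ω) (hωb : Bornology.IsBounded ω) {ℓ : ℝ≥0∞}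
    (hℓ : 1 ≤ ℓ) {k : Space d → ℝ} (hk : MemLp k ℓ volume)
    {un : ℕ → L2On ω} {u : L2On ω} (hn : ∀ n, un n ∈ admissible ω M₀) (hu : u ∈ admissible ω M₀)
    (hM : 0 ≤ M₀)
    (hw : ∀ f : L2On ω, Tendsto (fun n => inner ℝ f (un n)) atTop (𝓝 (inner ℝ f u)))
    (x : Space d) : Tendsto (fun n => S k (un n) x) atTop (𝓝 (S k u x)) := by
  have : IsFiniteMeasure (volume.restrict ω) :=
    ⟨by rw [Measure.restrict_apply_univ]; exact hωb.measure_lt_top⟩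
  obtain ⟨R, hR⟩ := hωb.subset_closedBall (0 : Space d)
  simp_rw [S_eq_setIntegral hω]
  exact tendsto_setIntegral_mul_of_weak hn hu hM hw
    ((integrableOn_comp_sub_left hℓ hk x R).mono_set hR)

end Control

/-! ### Diffusion coefficients along `S K u`. -/

section Diffusion

variable {d N : ℕ} {T : ℝ}

/-- The set `[0,T] × ℝ^d × [0,∞)`. -/
abbrev dataDomain (d : ℕ) (T : ℝ) : Set (ℝ × Space d × ℝ) := Icc 0 T ×ˢ univ ×ˢ Ici 0

theorem uniqueDiffOn_dataDomain (hT : 0 < T) : UniqueDiffOn ℝ (dataDomain d T) :=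
  (uniqueDiffOn_Icc hT).prod (uniqueDiffOn_univ.prod (uniqueDiffOn_Ici 0))

/-- Truncation of the time to `[0,T]`. -/
def clampTime (T t : ℝ) : ℝ := max 0 (min T t)

theorem clampTime_mem (hT : 0 < T) (t : ℝ) : clampTime T t ∈ Icc 0 T :=
  ⟨le_max_left _ _, max_le hT.le (min_le_left _ _)⟩

theorem clampTime_eq {t : ℝ} (ht : t ∈ Icc 0 T) : clampTime T t = t := by
  rw [clampTime, min_eq_right ht.2, max_eq_right ht.1]

theorem continuous_clampTime : Continuous (clampTime T) := by
  unfold clampTime; fun_prop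

/-- The point `(t, x, F x)`, with the time truncated. -/
def dataPoint (T : ℝ) (F : Space d → ℝ) (p : ℝ × Space d) : ℝ × Space d × ℝ :=
  (clampTime T p.1, p.2, F p.2)

/-- Clamping the time makes the coefficients bounded, continuous and elliptic at every real time, as
`IsElliptic` demands; inside `[0,T]` it changes nothing. -/
theorem dataPoint_mem (hT : 0 < T) {F : Space d → ℝ} (hF : ∀ x, 0 ≤ F x) (p : ℝ × Space d) :
    dataPoint T F p ∈ dataDomain d T :=
  ⟨clampTime_mem hT _, mem_univ _, hF _⟩

theorem continuous_dataPoint {F : Space d → ℝ} (hF : Continuous F) :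
    Continuous (dataPoint T F) := by
  unfold dataPoint
  exact (continuous_clampTime.comp continuous_fst).prodMk
    (continuous_snd.prodMk (hF.comp continuous_snd))

/-- A `C¹` function on the data domain, bounded with its derivative. -/
structure BddC1 (T : ℝ) (q : ℝ × Space d × ℝ → ℝ) (C : ℝ) : Prop where
  contDiffOn : ContDiffOn ℝ 1 q (dataDomain d T)
  le : ∀ p ∈ dataDomain d T, ‖q p‖ ≤ C
  fderiv_le : ∀ p ∈ dataDomain d T, ‖fderivWithin ℝ q (dataDomain d T) p‖ ≤ C

theorem exists_bddC1_diffusion (hT : 0 < T) {σ : ℝ × Space d × ℝ → Matrix (Fin d) (Fin N) ℝ}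
    (hσ : ∀ i l, MemCb2 T (fun p => σ p i l)) :
    ∃ C, 0 ≤ C ∧ ∀ i j, BddC1 T (diffusion σ i j) C := by
  choose hcd C' hC' using hσ
  set C := ∑ i, ∑ l, |C' i l| with hC
  have hle : ∀ i l, C' i l ≤ C := fun i l => (le_abs_self _).trans
    ((Finset.single_le_sum (f := fun l => |C' i l|) (fun _ _ => abs_nonneg _)
      (Finset.mem_univ l)).trans (Finset.single_le_sum (f := fun i => ∑ l, |C' i l|)
        (fun _ _ => Finset.sum_nonneg fun _ _ => abs_nonneg _) (Finset.mem_univ i)))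
  have hC0 : 0 ≤ C := Finset.sum_nonneg fun _ _ => Finset.sum_nonneg fun _ _ => abs_nonneg _
  have h0 : ∀ i l, ∀ p ∈ dataDomain d T, ‖σ p i l‖ ≤ C := fun i l p hp => by
    have := hC' i l 0 (by norm_num) p hp
    rw [norm_iteratedFDerivWithin_zero] at this
    exact this.trans (hle i l)
  have h1 : ∀ i l, ∀ p ∈ dataDomain d T,
      ‖fderivWithin ℝ (fun p => σ p i l) (dataDomain d T) p‖ ≤ C := fun i l p hp => by
    have := hC' i l 1 (by norm_num) p hp
    rw [norm_iteratedFDerivWithin_one _ (uniqueDiffOn_dataDomain hT p hp)] at this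
    exact this.trans (hle i l)
  have hdiff : ∀ i l, ∀ p ∈ dataDomain d T,
      DifferentiableWithinAt ℝ (fun p => σ p i l) (dataDomain d T) p := fun i l p hp =>
    (hcd i l).differentiableOn (by norm_num) p hp
  -- There are `N` products; each is at most `C²`, and its derivative at most `2 C²` by the product
  -- rule.
  refine ⟨N * (2 * C ^ 2), by positivity, fun i j => ⟨?_, fun p hp => ?_, fun p hp => ?_⟩⟩
  · refine ContDiffOn.sum fun l _ => ?_
    exact ((hcd i l).of_le (by norm_num)).mul ((hcd j l).of_le (by norm_num))
  · refine (norm_sum_le _ _).trans ((Finset.sum_le_card_nsmul _ _ (2 * C ^ 2) fun l _ => ?_).trans_eq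
      (by simp))
    rw [norm_mul]
    have := mul_le_mul (h0 i l p hp) (h0 j l p hp) (norm_nonneg _) hC0
    nlinarith
  · have e : fderivWithin ℝ (diffusion σ i j) (dataDomain d T) p = ∑ l,
        (σ p i l • fderivWithin ℝ (fun p => σ p j l) (dataDomain d T) p +
          σ p j l • fderivWithin ℝ (fun p => σ p i l) (dataDomain d T) p) := by
      have hu := uniqueDiffOn_dataDomain (d := d) hT p hp
      have := fderivWithin_fun_sum (u := Finset.univ) (A := fun l p => σ p i l * σ p j l) hu
        (fun l _ => (hdiff i l p hp).mul (hdiff j l p hp))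
      unfold diffusion
      rw [this]
      exact Finset.sum_congr rfl fun l _ => fderivWithin_fun_mul hu (hdiff i l p hp) (hdiff j l p hp)
    rw [e]
    refine (norm_sum_le _ _).trans ((Finset.sum_le_card_nsmul _ _ (2 * C ^ 2) fun l _ => ?_).trans_eq
      (by simp))
    refine (norm_add_le _ _).trans ?_
    rw [norm_smul, norm_smul]
    have k1 := mul_le_mul (h0 i l p hp) (h1 j l p hp) (norm_nonneg _) hC0
    have k2 := mul_le_mul (h0 j l p hp) (h1 i l p hp) (norm_nonneg _) hC0
    linarith

variable {q : ℝ × Space d × ℝ → ℝ} {C CL : ℝ} {F : Space d → ℝ} {L : Space d → Space d →L[ℝ] ℝ}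

/-- `∂_j (q(t, x, F x))` expressed by the chain rule, `L` being the derivative of `F`. -/
def chainDeriv (T : ℝ) (q : ℝ × Space d × ℝ → ℝ) (F : Space d → ℝ) (L : Space d → Space d →L[ℝ] ℝ)
    (j : Fin d) (p : ℝ × Space d) : ℝ :=
  fderivWithin ℝ q (dataDomain d T) (dataPoint T F p)
    (0, EuclideanSpace.single j 1, L p.2 (EuclideanSpace.single j 1))

theorem BddC1.continuous_comp (hq : BddC1 T q C) (hT : 0 < T) (hF : Continuous F)
    (hF0 : ∀ x, 0 ≤ F x) : Continuous fun p => q (dataPoint T F p) :=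
  hq.contDiffOn.continuousOn.comp_continuous (continuous_dataPoint hF) (dataPoint_mem hT hF0)

theorem BddC1.continuous_fderivWithin_comp (hq : BddC1 T q C) (hT : 0 < T) (hF : Continuous F)
    (hF0 : ∀ x, 0 ≤ F x) :
    Continuous fun p => fderivWithin ℝ q (dataDomain d T) (dataPoint T F p) :=
  (hq.contDiffOn.continuousOn_fderivWithin (uniqueDiffOn_dataDomain hT) le_rfl).comp_continuous
    (continuous_dataPoint hF) (dataPoint_mem hT hF0)

theorem BddC1.continuous_chainDeriv (hq : BddC1 T q C) (hT : 0 < T) (hF : Continuous F)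
    (hF0 : ∀ x, 0 ≤ F x) (hL : Continuous L) (j : Fin d) : Continuous (chainDeriv T q F L j) :=
  (hq.continuous_fderivWithin_comp hT hF hF0).clm_apply (continuous_const.prodMk
    (continuous_const.prodMk ((hL.comp continuous_snd).clm_apply continuous_const)))

theorem BddC1.norm_chainDeriv_le (hq : BddC1 T q C) (hT : 0 < T) (hC : 0 ≤ C)
    (hF0 : ∀ x, 0 ≤ F x) (hL : ∀ x, ‖L x‖ ≤ CL) (j : Fin d) (p : ℝ × Space d) :
    ‖chainDeriv T q F L j p‖ ≤ C * (1 + CL) := by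
  refine (ContinuousLinearMap.le_of_opNorm_le _ (hq.fderiv_le _ (dataPoint_mem hT hF0 p)) _).trans ?_
  gcongr
  have hCL : 0 ≤ CL := (norm_nonneg _).trans (hL 0)
  have h1 : ‖L p.2 (EuclideanSpace.single j 1)‖ ≤ CL := by
    have := (L p.2).le_of_opNorm_le (hL p.2) (EuclideanSpace.single j 1)
    simpa using this
  rw [Prod.norm_def, Prod.norm_def]
  simp only [norm_zero, PiLp.norm_single, norm_one]
  refine max_le (by linarith) (max_le (by linarith) (by linarith))

/-- The inner map never leaves the data domain, so the chain rule gives a full derivative even where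
`F x = 0` or the time is an endpoint. -/
theorem BddC1.hasFDerivAt_comp (hq : BddC1 T q C) (hT : 0 < T) (hF0 : ∀ x, 0 ≤ F x)
    (hFL : ∀ x, HasFDerivAt F (L x) x) (t : ℝ) (x : Space d) :
    HasFDerivAt (fun x => q (dataPoint T F (t, x)))
      ((fderivWithin ℝ q (dataDomain d T) (dataPoint T F (t, x))).comp
        ((0 : Space d →L[ℝ] ℝ).prod ((ContinuousLinearMap.id ℝ (Space d)).prod (L x)))) x := by
  have h1 := (hq.contDiffOn.differentiableOn one_ne_zero _
    (dataPoint_mem hT hF0 (t, x))).hasFDerivWithinAt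
  have h2 : HasFDerivAt (fun x => dataPoint T F (t, x))
      ((0 : Space d →L[ℝ] ℝ).prod ((ContinuousLinearMap.id ℝ (Space d)).prod (L x))) x :=
    (hasFDerivAt_const (clampTime T t) x).prodMk ((hasFDerivAt_id x).prodMk (hFL x))
  exact h1.comp_hasFDerivAt x h2 (Eventually.of_forall fun y => dataPoint_mem hT hF0 (t, y))

theorem BddC1.contDiff_comp (hq : BddC1 T q C) (hT : 0 < T) (hF0 : ∀ x, 0 ≤ F x)
    (hL : Continuous L) (hFL : ∀ x, HasFDerivAt F (L x) x) (t : ℝ) :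
    ContDiff ℝ 1 fun x => q (dataPoint T F (t, x)) := by
  have hF : Continuous F := continuous_iff_continuousAt.2 fun x => (hFL x).continuousAt
  have hF1 : ContDiff ℝ 1 F := contDiff_one_iff_hasFDerivAt.2 ⟨L, hL, hFL⟩
  exact hq.contDiffOn.comp_contDiff ((contDiff_const (c := clampTime T t)).prodMk (contDiff_id.prodMk hF1))
    (fun x => dataPoint_mem hT hF0 (t, x))

theorem BddC1.partialDeriv_comp (hq : BddC1 T q C) (hT : 0 < T) (hF0 : ∀ x, 0 ≤ F x)
    (hFL : ∀ x, HasFDerivAt F (L x) x) (t : ℝ) (j : Fin d) (x : Space d) :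
    partialDeriv j (fun x => q (dataPoint T F (t, x))) x = chainDeriv T q F L j (t, x) := by
  rw [partialDeriv, (hq.hasFDerivAt_comp hT hF0 hFL t x).fderiv]
  rfl

theorem BddC1.tendsto_comp (hq : BddC1 T q C) (hT : 0 < T) {Fn : ℕ → Space d → ℝ}
    (hFn0 : ∀ n x, 0 ≤ Fn n x) (hF0 : ∀ x, 0 ≤ F x)
    (hlim : ∀ x, Tendsto (fun n => Fn n x) atTop (𝓝 (F x))) (p : ℝ × Space d) :
    Tendsto (fun n => q (dataPoint T (Fn n) p)) atTop (𝓝 (q (dataPoint T F p))) := by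
  have h1 : Tendsto (fun n => dataPoint T (Fn n) p) atTop (𝓝[dataDomain d T] (dataPoint T F p)) :=
    tendsto_nhdsWithin_iff.2 ⟨tendsto_const_nhds.prodMk_nhds
      (tendsto_const_nhds.prodMk_nhds (hlim p.2)),
      Eventually.of_forall fun n => dataPoint_mem hT (hFn0 n) p⟩
  exact (hq.contDiffOn.continuousOn _ (dataPoint_mem hT hF0 p)).tendsto.comp h1

theorem BddC1.tendsto_chainDeriv (hq : BddC1 T q C) (hT : 0 < T) {Fn : ℕ → Space d → ℝ}
    {Ln : ℕ → Space d → Space d →L[ℝ] ℝ}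
    (hFn0 : ∀ n x, 0 ≤ Fn n x) (hF0 : ∀ x, 0 ≤ F x)
    (hlim : ∀ x, Tendsto (fun n => Fn n x) atTop (𝓝 (F x)))
    (hLlim : ∀ x y, Tendsto (fun n => Ln n x y) atTop (𝓝 (L x y))) (j : Fin d) (p : ℝ × Space d) :
    Tendsto (fun n => chainDeriv T q (Fn n) (Ln n) j p) atTop (𝓝 (chainDeriv T q F L j p)) := by
  have h1 : Tendsto (fun n => dataPoint T (Fn n) p) atTop (𝓝[dataDomain d T] (dataPoint T F p)) :=
    tendsto_nhdsWithin_iff.2 ⟨tendsto_const_nhds.prodMk_nhds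
      (tendsto_const_nhds.prodMk_nhds (hlim p.2)),
      Eventually.of_forall fun n => dataPoint_mem hT (hFn0 n) p⟩
  have h2 := (hq.contDiffOn.continuousOn_fderivWithin (uniqueDiffOn_dataDomain hT) le_rfl _
    (dataPoint_mem hT hF0 p)).tendsto.comp h1
  have h3 : Tendsto (fun n => ((0 : ℝ), (EuclideanSpace.single j (1 : ℝ) : Space d),
      Ln n p.2 (EuclideanSpace.single j 1))) atTop
      (𝓝 ((0 : ℝ), (EuclideanSpace.single j (1 : ℝ) : Space d), L p.2 (EuclideanSpace.single j 1))) :=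
    tendsto_const_nhds.prodMk_nhds (tendsto_const_nhds.prodMk_nhds (hLlim _ _))
  exact (isBoundedBilinearMap_apply.continuous.tendsto _).comp (h2.prodMk_nhds h3)

end Diffusion

/-! ### The drift along `S K u`. -/

section Drift

variable {d : ℕ} {T : ℝ} {b : ℝ × Space d × ℝ → Space d} {C : ℝ} {F : Space d → ℝ}

/-- `b(t, x, F x)` for `0 < t < T`, set to `0` where it exceeds the bound `C`. -/
def drift (T : ℝ) (b : ℝ × Space d × ℝ → Space d) (C : ℝ) (F : Space d → ℝ) (p : ℝ × Space d) :
    Space d :=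
  {v : Space d | ‖v‖ ≤ C}.indicator id
    ((Ioo 0 T ×ˢ univ ×ˢ Ici 0 : Set (ℝ × Space d × ℝ)).indicator b (p.1, p.2, F p.2))

theorem measurable_drift (hb : Measurable
    ((Ioo 0 T ×ˢ univ ×ˢ Ici 0 : Set (ℝ × Space d × ℝ)).domRestrict b)) (hF : Continuous F) :
    Measurable (drift T b C F) := by
  have hS : MeasurableSet (Ioo 0 T ×ˢ univ ×ˢ Ici 0 : Set (ℝ × Space d × ℝ)) :=
    measurableSet_Ioo.prod (MeasurableSet.univ.prod measurableSet_Ici)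
  have h1 : Measurable ((Ioo 0 T ×ˢ univ ×ˢ Ici 0 : Set (ℝ × Space d × ℝ)).indicator b) := by
    refine measurable_of_restrict_of_restrict_compl hS ?_ ?_
    · have e : (Ioo 0 T ×ˢ univ ×ˢ Ici 0 : Set (ℝ × Space d × ℝ)).domRestrict
          ((Ioo 0 T ×ˢ univ ×ˢ Ici 0 : Set (ℝ × Space d × ℝ)).indicator b) =
          (Ioo 0 T ×ˢ univ ×ˢ Ici 0 : Set (ℝ × Space d × ℝ)).domRestrict b :=
        funext fun p => indicator_of_mem p.2 b
      rw [e]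
      exact hb
    · have e : (Ioo 0 T ×ˢ univ ×ˢ Ici 0 : Set (ℝ × Space d × ℝ))ᶜ.domRestrict
          ((Ioo 0 T ×ˢ univ ×ˢ Ici 0 : Set (ℝ × Space d × ℝ)).indicator b) = fun _ => 0 :=
        funext fun p => indicator_of_notMem p.2 b
      rw [e]
      exact measurable_const
  have h2 : Measurable ({v : Space d | ‖v‖ ≤ C}.indicator id) :=
    measurable_id.indicator (measurableSet_le measurable_norm measurable_const)
  exact h2.comp (h1.comp (measurable_fst.prodMk
    (measurable_snd.prodMk (hF.measurable.comp measurable_snd))))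

theorem norm_drift_le (hC : 0 ≤ C) (p : ℝ × Space d) : ‖drift T b C F p‖ ≤ C := by
  unfold drift
  set v := (Ioo 0 T ×ˢ univ ×ˢ Ici 0 : Set (ℝ × Space d × ℝ)).indicator b (p.1, p.2, F p.2)
  by_cases h : v ∈ {v : Space d | ‖v‖ ≤ C}
  · rw [indicator_of_mem h]; exact h
  · rw [indicator_of_notMem h, norm_zero]; exact hC

theorem drift_eq {p : ℝ × Space d} (hp : p.1 ∈ Ioo 0 T) (hF : 0 ≤ F p.2)
    (hb : ∀ s ∈ Ici (0 : ℝ), ‖b (p.1, p.2, s)‖ ≤ C) : drift T b C F p = b (p.1, p.2, F p.2) := by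
  unfold drift
  rw [indicator_of_mem (show (p.1, p.2, F p.2) ∈ (Ioo 0 T ×ˢ univ ×ˢ Ici 0 : Set _) from
    ⟨hp, mem_univ _, hF⟩)]
  exact indicator_of_mem (show b (p.1, p.2, F p.2) ∈ {v : Space d | ‖v‖ ≤ C} from hb _ hF) _

/-- A bounded drift that is continuous in the last variable is bounded for all its values. -/
theorem exists_drift_bound (hb_bdd : MemLp b ∞ (volume.restrict (Ioo 0 T ×ˢ univ ×ˢ Ici 0)))
    (hb_cont : ∀ᵐ p : ℝ × Space d ∂(volume.restrict (Ioo 0 T ×ˢ univ)),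
      ContinuousOn (fun s => b (p.1, p.2, s)) (Ici 0)) :
    ∃ C, 0 ≤ C ∧ ∀ᵐ p : ℝ × Space d ∂(volume.restrict (Ioo 0 T ×ˢ univ)),
      ∀ s ∈ Ici (0 : ℝ), ‖b (p.1, p.2, s)‖ ≤ C := by
  have hS : MeasurableSet (Ioo 0 T ×ˢ univ ×ˢ Ici 0 : Set (ℝ × Space d × ℝ)) :=
    measurableSet_Ioo.prod (MeasurableSet.univ.prod measurableSet_Ici)
  set C := (eLpNormEssSup b (volume.restrict (Ioo 0 T ×ˢ univ ×ˢ Ici 0))).toReal with hC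
  refine ⟨C, ENNReal.toReal_nonneg, ?_⟩
  have h1 : ∀ᵐ p : ℝ × Space d × ℝ, p ∈ Ioo 0 T ×ˢ univ ×ˢ Ici 0 → ‖b p‖ ≤ C := by
    rw [← ae_restrict_iff' hS]
    have hfin : eLpNormEssSup b (volume.restrict (Ioo 0 T ×ˢ univ ×ˢ Ici 0)) ≠ ∞ := by
      have := hb_bdd.2.ne
      rwa [eLpNorm_exponent_top] at this
    filter_upwards [ae_le_eLpNormEssSup (f := b)
      (μ := volume.restrict (Ioo 0 T ×ˢ univ ×ˢ Ici 0))] with p hp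
    rw [← toReal_enorm]
    exact ENNReal.toReal_mono hfin hp
  have h2 : ∀ᵐ p : (ℝ × Space d) × ℝ ∂((volume : Measure (ℝ × Space d)).prod volume),
      (p.1.1, p.1.2, p.2) ∈ (Ioo 0 T ×ˢ univ ×ˢ Ici 0 : Set (ℝ × Space d × ℝ)) →
        ‖b (p.1.1, p.1.2, p.2)‖ ≤ C :=
    (volume_preserving_prodAssoc (α₁ := ℝ) (β₁ := Space d) (γ₁ := ℝ)).quasiMeasurePreserving.ae h1
  have h3 := Measure.ae_ae_of_ae_prod h2
  filter_upwards [hb_cont, ae_restrict_of_ae h3,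
    ae_restrict_mem (measurableSet_Ioo.prod MeasurableSet.univ)] with p hcont hp hmem s hs
  have hs' : (0 : ℝ) < s + 1 := by have : (0 : ℝ) ≤ s := hs; linarith
  -- The essential bound holds for almost every `s`, but the graph of `S K u` is a null set, so
  -- every `s` is needed. The bound is written as an equality of two functions continuous in `s`,
  -- which extends from almost all points to all.
  have hEq : EqOn (fun s => max ‖b (p.1, p.2, s)‖ C) (fun _ => C) (Icc 0 (s + 1)) := by
    refine Measure.eqOn_Icc_of_ae_eq volume hs'.ne ?_
      ((hcont.mono Icc_subset_Ici_self).norm.sup continuousOn_const) continuousOn_const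
    filter_upwards [ae_restrict_of_ae hp, ae_restrict_mem measurableSet_Icc] with r h1 h2
    exact max_eq_right (h1 ⟨hmem.1, mem_univ _, h2.1⟩)
  have := hEq ⟨hs, by linarith⟩
  simp only [max_eq_right_iff] at this
  exact this

theorem tendsto_drift {Fn : ℕ → Space d → ℝ} (hFn0 : ∀ n x, 0 ≤ Fn n x) (hF0 : ∀ x, 0 ≤ F x)
    (hlim : ∀ x, Tendsto (fun n => Fn n x) atTop (𝓝 (F x))) {p : ℝ × Space d} (hp : p.1 ∈ Ioo 0 T)
    (hb : ∀ s ∈ Ici (0 : ℝ), ‖b (p.1, p.2, s)‖ ≤ C)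
    (hc : ContinuousOn (fun s => b (p.1, p.2, s)) (Ici 0)) :
    Tendsto (fun n => drift T b C (Fn n) p) atTop (𝓝 (drift T b C F p)) := by
  simp_rw [drift_eq hp (hFn0 _ _) hb, drift_eq hp (hF0 _) hb]
  exact (hc _ (hF0 p.2)).tendsto.comp (tendsto_nhdsWithin_iff.2 ⟨hlim p.2,
    Eventually.of_forall fun n => hFn0 n p.2⟩)

end Drift

/-! ### Coefficients of the flux, their bounds and their convergence. -/

section Coefficients

variable {d N : ℕ} {T : ℝ} {b : ℝ × Space d × ℝ → Space d} {Cb Cq CL γ : ℝ}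
  {σ : ℝ × Space d × ℝ → Matrix (Fin d) (Fin N) ℝ} {F : Space d → ℝ}
  {L : Space d → Space d →L[ℝ] ℝ}

/-- The elementary matrix `ξ ↦ ξ_j e_i`. -/
def elemCLM (i j : Fin d) : Space d →L[ℝ] Space d :=
  (EuclideanSpace.proj j : Space d →L[ℝ] ℝ).smulRight (EuclideanSpace.single i (1 : ℝ))

theorem elemCLM_apply (i j : Fin d) (ξ : Space d) :
    elemCLM i j ξ = ξ j • EuclideanSpace.single i (1 : ℝ) := rfl

theorem norm_elemCLM_le (i j : Fin d) : ‖(elemCLM i j : Space d →L[ℝ] Space d)‖ ≤ 1 :=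
  ContinuousLinearMap.opNorm_le_bound _ zero_le_one fun ξ => by
    rw [elemCLM_apply, norm_smul, PiLp.norm_single, norm_one, mul_one, one_mul]
    exact PiLp.norm_apply_le ξ j

theorem inner_single_right (ξ : Space d) (i : Fin d) :
    inner ℝ (EuclideanSpace.single i (1 : ℝ)) ξ = ξ i := by
  simp [EuclideanSpace.inner_single_left]

/-- The first order coefficient `-b + ½ (∂_j q_{ij})_i` of the flux. -/
def coefC (T : ℝ) (b : ℝ × Space d × ℝ → Space d) (Cb : ℝ)
    (σ : ℝ × Space d × ℝ → Matrix (Fin d) (Fin N) ℝ) (F : Space d → ℝ)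
    (L : Space d → Space d →L[ℝ] ℝ) (p : ℝ × Space d) : Space d :=
  -drift T b Cb F p + (1 / 2 : ℝ) • ∑ i, ∑ j,
    chainDeriv T (diffusion σ i j) F L j p • EuclideanSpace.single i (1 : ℝ)

/-- The second order coefficient `½ (q_{ij})` of the flux. -/
def coefB (T : ℝ) (σ : ℝ × Space d × ℝ → Matrix (Fin d) (Fin N) ℝ) (F : Space d → ℝ)
    (p : ℝ × Space d) : Space d →L[ℝ] Space d :=
  (1 / 2 : ℝ) • ∑ i, ∑ j, diffusion σ i j (dataPoint T F p) • elemCLM i j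

theorem norm_double_sum_le {E : Type*} [SeminormedAddCommGroup E] {f : Fin d → Fin d → E} {C : ℝ}
    (h : ∀ i j, ‖f i j‖ ≤ C) : ‖∑ i, ∑ j, f i j‖ ≤ d * (d * C) := by
  refine (norm_sum_le _ _).trans ((Finset.sum_le_card_nsmul _ _ (d * C) fun i _ => ?_).trans_eq
    (by simp))
  exact (norm_sum_le _ _).trans ((Finset.sum_le_card_nsmul _ _ C fun j _ => h i j).trans_eq
    (by simp))

theorem bddCoeff_coef (hT : 0 < T) (hb : Measurable
      ((Ioo 0 T ×ˢ univ ×ˢ Ici 0 : Set (ℝ × Space d × ℝ)).domRestrict b)) (hCb : 0 ≤ Cb)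
    (hq : ∀ i j, BddC1 T (diffusion σ i j) Cq) (hCq : 0 ≤ Cq) (hF0 : ∀ x, 0 ≤ F x)
    (hF : Continuous F) (hL : Continuous L) (hLb : ∀ x, ‖L x‖ ≤ CL) :
    BddCoeff (coefC T b Cb σ F L) (coefB T σ F) (Cb + d * (d * (Cq * (1 + CL)))) where
  meas_c := by
    refine ((measurable_drift hb hF).stronglyMeasurable.neg).add ?_
    have hc : Continuous fun p : ℝ × Space d => ∑ i, ∑ j,
        chainDeriv T (diffusion σ i j) F L j p • (EuclideanSpace.single i (1 : ℝ) : Space d) :=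
      continuous_finsetSum _ fun i _ => continuous_finsetSum _ fun j _ =>
        ((hq i j).continuous_chainDeriv hT hF hF0 hL j).smul continuous_const
    exact (hc.const_smul (1 / 2 : ℝ)).stronglyMeasurable
  meas_B := by
    have hc : Continuous fun p : ℝ × Space d => ∑ i, ∑ j,
        diffusion σ i j (dataPoint T F p) • (elemCLM i j : Space d →L[ℝ] Space d) :=
      continuous_finsetSum _ fun i _ => continuous_finsetSum _ fun j _ =>
        ((hq i j).continuous_comp hT hF hF0).smul continuous_const
    exact (hc.const_smul (1 / 2 : ℝ)).stronglyMeasurable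
  le_c p := by
    have hCL : 0 ≤ CL := (norm_nonneg _).trans (hLb 0)
    refine (norm_add_le _ _).trans (add_le_add ?_ ?_)
    · rw [norm_neg]; exact norm_drift_le hCb p
    · rw [norm_smul]
      have h1 : ‖∑ i, ∑ j, chainDeriv T (diffusion σ i j) F L j p •
          (EuclideanSpace.single i (1 : ℝ) : Space d)‖ ≤ d * (d * (Cq * (1 + CL))) :=
        norm_double_sum_le fun i j => by
          rw [norm_smul, PiLp.norm_single, norm_one, mul_one]
          exact (hq i j).norm_chainDeriv_le hT hCq hF0 hLb j p
      have h2 : ‖(1 / 2 : ℝ)‖ ≤ 1 := by norm_num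
      exact (mul_le_mul h2 h1 (norm_nonneg _) zero_le_one).trans_eq (one_mul _)
  le_B p := by
    have hCL : 0 ≤ CL := (norm_nonneg _).trans (hLb 0)
    have h1 : ‖∑ i, ∑ j, diffusion σ i j (dataPoint T F p) • elemCLM i j‖ ≤
        d * (d * (Cq * (1 + CL))) :=
      norm_double_sum_le fun i j => by
        rw [norm_smul]
        refine (mul_le_mul ((hq i j).le _ (dataPoint_mem hT hF0 p)) (norm_elemCLM_le i j)
          (norm_nonneg _) hCq).trans ?_
        nlinarith
    have h2 : ‖(1 / 2 : ℝ)‖ ≤ 1 := by norm_num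
    rw [coefB, norm_smul]
    have := (mul_le_mul h2 h1 (norm_nonneg _) zero_le_one).trans_eq (one_mul _)
    linarith

theorem inner_coefB (p : ℝ × Space d) (ξ η : Space d) :
    inner ℝ (coefB T σ F p ξ) η =
      (1 / 2) * ∑ i, ∑ j, diffusion σ i j (dataPoint T F p) * ξ j * η i := by
  rw [coefB, smul_apply, real_inner_smul_left, sum_apply,
    sum_inner]
  congr 1
  refine Finset.sum_congr rfl fun i _ => ?_
  rw [sum_apply, sum_inner]
  refine Finset.sum_congr rfl fun j _ => ?_
  rw [smul_apply, elemCLM_apply, real_inner_smul_left, real_inner_smul_left,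
    inner_single_right, mul_assoc]

theorem inner_coefC (p : ℝ × Space d) (η : Space d) :
    inner ℝ (coefC T b Cb σ F L p) η = -inner ℝ (drift T b Cb F p) η +
      (1 / 2) * ∑ i, ∑ j, chainDeriv T (diffusion σ i j) F L j p * η i := by
  rw [coefC, inner_add_left, inner_neg_left, real_inner_smul_left, sum_inner]
  congr 2
  refine Finset.sum_congr rfl fun i _ => ?_
  rw [sum_inner]
  refine Finset.sum_congr rfl fun j _ => ?_
  rw [real_inner_smul_left, inner_single_right]

theorem coefB_coercive (hT : 0 < T) (hF0 : ∀ x, 0 ≤ F x)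
    (hσ : ∀ t ∈ Icc 0 T, ∀ x : Space d, ∀ s : ℝ, 0 ≤ s → ∀ ξ : Space d,
        γ * ‖ξ‖ ^ 2 ≤ ∑ i, ∑ j, diffusion σ i j (t, x, s) * ξ i * ξ j) (p : ℝ × Space d)
    (ξ : Space d) : γ / 2 * ‖ξ‖ ^ 2 ≤ inner ℝ (coefB T σ F p ξ) ξ := by
  have h := hσ _ (clampTime_mem hT p.1) p.2 _ (hF0 p.2) ξ
  have e : inner ℝ (coefB T σ F p ξ) ξ = (1 / 2) *
      ∑ i, ∑ j, diffusion σ i j (clampTime T p.1, p.2, F p.2) * ξ i * ξ j := by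
    rw [inner_coefB]
    congr 1
    exact Finset.sum_congr rfl fun i _ => Finset.sum_congr rfl fun j _ => by
      rw [dataPoint]; ring
  rw [e]
  linarith

theorem tendsto_coefC (hT : 0 < T) (hq : ∀ i j, BddC1 T (diffusion σ i j) Cq)
    {Fn : ℕ → Space d → ℝ} {Ln : ℕ → Space d → Space d →L[ℝ] ℝ}
    (hFn0 : ∀ n x, 0 ≤ Fn n x) (hF0 : ∀ x, 0 ≤ F x)
    (hlim : ∀ x, Tendsto (fun n => Fn n x) atTop (𝓝 (F x)))
    (hLlim : ∀ x y, Tendsto (fun n => Ln n x y) atTop (𝓝 (L x y))) {p : ℝ × Space d}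
    (hp : p.1 ∈ Ioo 0 T) (hb : ∀ s ∈ Ici (0 : ℝ), ‖b (p.1, p.2, s)‖ ≤ Cb)
    (hc : ContinuousOn (fun s => b (p.1, p.2, s)) (Ici 0)) :
    Tendsto (fun n => coefC T b Cb σ (Fn n) (Ln n) p) atTop (𝓝 (coefC T b Cb σ F L p)) := by
  refine (tendsto_drift hFn0 hF0 hlim hp hb hc).neg.add (Tendsto.const_smul ?_ _)
  exact tendsto_finsetSum _ fun i _ => tendsto_finsetSum _ fun j _ =>
    ((hq i j).tendsto_chainDeriv hT hFn0 hF0 hlim hLlim j p).smul_const _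

theorem tendsto_coefB (hT : 0 < T) (hq : ∀ i j, BddC1 T (diffusion σ i j) Cq)
    {Fn : ℕ → Space d → ℝ} (hFn0 : ∀ n x, 0 ≤ Fn n x) (hF0 : ∀ x, 0 ≤ F x)
    (hlim : ∀ x, Tendsto (fun n => Fn n x) atTop (𝓝 (F x))) (p : ℝ × Space d) :
    Tendsto (fun n => coefB T σ (Fn n) p) atTop (𝓝 (coefB T σ F p)) := by
  refine Tendsto.const_smul ?_ _
  exact tendsto_finsetSum _ fun i _ => tendsto_finsetSum _ fun j _ =>
    ((hq i j).tendsto_comp hT hFn0 hF0 hlim p).smul_const _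

end Coefficients

/-! ### Transfer between H⁻¹ and H¹ by the Riesz map. -/

section Riesz

variable {V : Type*} [NormedAddCommGroup V] [InnerProductSpace ℝ V]

/-- The Riesz map `v ↦ ⟨v, ·⟩`. -/
def riesz (V : Type*) [NormedAddCommGroup V] [InnerProductSpace ℝ V] : V →L[ℝ] (V →L[ℝ] ℝ) :=
  LinearMap.mkContinuous
    { toFun := fun v => innerSL ℝ v
      map_add' := fun v w => map_add _ v w
      map_smul' := fun a v => by
        ext φ
        exact real_inner_smul_left v φ a } 1
    (fun v => by
      change ‖innerSL ℝ v‖ ≤ _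
      rw [innerSL_apply_norm, one_mul])

theorem riesz_apply (v φ : V) : riesz V v φ = inner ℝ v φ := rfl

theorem riesz_injective : Function.Injective (riesz V) := fun v w h => by
  refine ext_inner_right ℝ fun φ => ?_
  exact DFunLike.congr_fun h φ

theorem intervalIntegral_riesz [CompleteSpace V] {f : ℝ → V} {a b : ℝ}
    (hf : IntervalIntegrable f volume a b) :
    ∫ t in a..b, riesz V (f t) = riesz V (∫ t in a..b, f t) :=
  (riesz V).intervalIntegral_comp_comm hf

theorem memLp_riesz {f : ℝ → V} {μ : Measure ℝ} (hf : MemLp f 2 μ) :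
    MemLp (fun t => riesz V (f t)) 2 μ :=
  hf.continuousLinearMap_comp (riesz V)

end Riesz

/-! ### Equivalence of weak and variational solutions. -/

section WeakForm

variable {d N : ℕ} {T : ℝ} {b : ℝ × Space d × ℝ → Space d} {Cb Cq CL M : ℝ}
  {σ : ℝ × Space d × ℝ → Matrix (Fin d) (Fin N) ℝ} {F : Space d → ℝ}
  {L : Space d → Space d →L[ℝ] ℝ}

/-- The weak derivative `∂_j (q_{ij} r)` by the product rule. -/
def diffusionDeriv (T : ℝ) (σ : ℝ × Space d × ℝ → Matrix (Fin d) (Fin N) ℝ) (F : Space d → ℝ)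
    (L : Space d → Space d →L[ℝ] ℝ) (t : ℝ) (r : H1 d) (i j : Fin d) (x : Space d) : ℝ :=
  chainDeriv T (diffusion σ i j) F L j (t, x) * H1.toL2 d r x +
    diffusion σ i j (dataPoint T F (t, x)) * H1.grad r x j

theorem hasWeakPartial_diffusionDeriv (hT : 0 < T) (hq : ∀ i j, BddC1 T (diffusion σ i j) Cq)
    (hF0 : ∀ x, 0 ≤ F x) (hL : Continuous L) (hFL : ∀ x, HasFDerivAt F (L x) x) (t : ℝ)
    (r : H1 d) (i j : Fin d) :
    HasWeakPartial j (fun x => diffusion σ i j (dataPoint T F (t, x)) * H1.toL2 d r x)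
      (diffusionDeriv T σ F L t r i j) := by
  have h := HasWeakPartial.contDiff_mul (r.2 j) ((hq i j).contDiff_comp hT hF0 hL hFL t)
  simp_rw [(hq i j).partialDeriv_comp hT hF0 hFL t j] at h
  exact h

theorem H1.memLp_grad_apply (r : H1 d) (j : Fin d) : MemLp (fun x => H1.grad r x j) 2 volume :=
  (Lp.memLp (H1.grad r)).continuousLinearMap_comp (EuclideanSpace.proj (𝕜 := ℝ) j)

theorem memLp_diffusionDeriv (hT : 0 < T) (hq : ∀ i j, BddC1 T (diffusion σ i j) Cq)
    (hCq : 0 ≤ Cq) (hF0 : ∀ x, 0 ≤ F x) (hF : Continuous F) (hL : Continuous L)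
    (hLb : ∀ x, ‖L x‖ ≤ CL) (t : ℝ) (r : H1 d) (i j : Fin d) :
    MemLp (diffusionDeriv T σ F L t r i j) 2 volume := by
  have hc : Continuous fun x : Space d => (t, x) := by fun_prop
  refine MemLp.add ?_ ?_
  · refine (Lp.memLp (H1.toL2 d r)).of_le_mul (c := Cq * (1 + CL))
      ((((hq i j).continuous_chainDeriv hT hF hF0 hL j).comp hc).aestronglyMeasurable.mul
        (Lp.aestronglyMeasurable _)) (Eventually.of_forall fun x => ?_)
    rw [norm_mul]
    exact mul_le_mul_of_nonneg_right ((hq i j).norm_chainDeriv_le hT hCq hF0 hLb j (t, x))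
      (norm_nonneg _)
  · refine (H1.memLp_grad_apply r j).of_le_mul (c := Cq)
      ((((hq i j).continuous_comp hT hF hF0).comp hc).aestronglyMeasurable.mul
        (H1.memLp_grad_apply r j).1) (Eventually.of_forall fun x => ?_)
    rw [norm_mul]
    exact mul_le_mul_of_nonneg_right ((hq i j).le _ (dataPoint_mem hT hF0 (t, x))) (norm_nonneg _)

theorem inner_flux_eq (t : ℝ) (r φ : H1 d) (x : Space d) :
    inner ℝ (H1.toL2 d r x • coefC T b Cb σ F L (t, x) + coefB T σ F (t, x) (H1.gradL d r x))
      (H1.grad φ x) = -inner ℝ (H1.toL2 d r x • drift T b Cb F (t, x)) (H1.grad φ x) +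
        (1 / 2) * ∑ i, ∑ j, diffusionDeriv T σ F L t r i j x * H1.grad φ x i := by
  rw [inner_add_left, real_inner_smul_left, real_inner_smul_left, inner_coefB, inner_coefC,
    H1.gradL_apply]
  simp only [diffusionDeriv, add_mul, Finset.sum_add_distrib, mul_add, Finset.mul_sum]
  rw [← add_assoc]
  congr 2
  · ring
  · exact Finset.sum_congr rfl fun i _ => Finset.sum_congr rfl fun j _ => by ring

/-- The operator `divOperator` applied to `r`, tested with `φ`, is minus the right hand side of the
weak formulation. -/
theorem inner_divOperator_coef (hT : 0 < T) (hb : Measurable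
      ((Ioo 0 T ×ˢ univ ×ˢ Ici 0 : Set (ℝ × Space d × ℝ)).domRestrict b)) (hCb : 0 ≤ Cb)
    (hq : ∀ i j, BddC1 T (diffusion σ i j) Cq) (hCq : 0 ≤ Cq) (hF0 : ∀ x, 0 ≤ F x)
    (hF : Continuous F) (hL : Continuous L) (hLb : ∀ x, ‖L x‖ ≤ CL)
    (h : BddCoeff (coefC T b Cb σ F L) (coefB T σ F) M) {t : ℝ}
    (hdr : ∀ᵐ x, drift T b Cb F (t, x) = b (t, x, F x)) (r φ : H1 d) :
    -inner ℝ (divOperator (h.slice t) r) φ =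
      (∫ x, inner ℝ (H1.toL2 d r x • b (t, x, F x)) (H1.grad φ x)) -
        (1 / 2) * ∑ i, ∑ j, ∫ x, diffusionDeriv T σ F L t r i j x * H1.grad φ x i := by
  have e1 : (∫ x, inner ℝ (H1.toL2 d r x • b (t, x, F x)) (H1.grad φ x)) =
      ∫ x, inner ℝ (H1.toL2 d r x • drift T b Cb F (t, x)) (H1.grad φ x) := by
    refine integral_congr_ae ?_
    filter_upwards [hdr] with x hx
    rw [hx]
  have m1 : MemLp (fun x => H1.toL2 d r x • drift T b Cb F (t, x)) 2 volume := by
    have hd : Measurable fun x => drift T b Cb F (t, x) :=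
      (measurable_drift hb hF).comp measurable_prodMk_left
    refine (Lp.memLp (H1.toL2 d r)).of_le_mul (c := Cb)
      ((Lp.aestronglyMeasurable (H1.toL2 d r)).smul hd.aestronglyMeasurable) (Eventually.of_forall fun x => ?_)
    rw [norm_smul, mul_comm]
    exact mul_le_mul_of_nonneg_right (norm_drift_le hCb _) (norm_nonneg _)
  have i1 : Integrable (fun x => inner ℝ (H1.toL2 d r x • drift T b Cb F (t, x)) (H1.grad φ x))
      volume := integrable_inner_of_memLp m1 (Lp.memLp (H1.grad φ))
  have i2 : ∀ i j, Integrable (fun x => diffusionDeriv T σ F L t r i j x * H1.grad φ x i) volume :=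
    fun i j => (memLp_diffusionDeriv hT hq hCq hF0 hF hL hLb t r i j).integrable_mul
      (H1.memLp_grad_apply φ i)
  have i3 : ∀ i, Integrable (fun x => ∑ j, diffusionDeriv T σ F L t r i j x * H1.grad φ x i)
      volume := fun i => integrable_finsetSum _ fun j _ => i2 i j
  rw [inner_divOperator, L2.inner_def, e1]
  have e2 : ∫ x, inner ℝ (flux (h.slice t) r x) (H1.gradL d φ x) = ∫ x,
      (-inner ℝ (H1.toL2 d r x • drift T b Cb F (t, x)) (H1.grad φ x) +
        (1 / 2) * ∑ i, ∑ j, diffusionDeriv T σ F L t r i j x * H1.grad φ x i) := by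
    refine integral_congr_ae ?_
    filter_upwards [coeFn_flux (h.slice t) r] with x hx
    rw [hx, ← inner_flux_eq]
    rfl
  rw [e2, integral_add i1.fun_neg ((integrable_finsetSum _ fun i _ => i3 i).const_mul _),
    integral_neg, integral_const_mul, integral_finsetSum _ fun i _ => i3 i,
    Finset.sum_congr rfl fun i _ => integral_finsetSum _ fun j _ => i2 i j]
  ring

theorem toHNeg_eq (f : L2 d) : toHNeg f = riesz (H1 d) ((H1.toL2 d).adjoint f) := by
  ext φ
  rw [riesz_apply, ContinuousLinearMap.adjoint_inner_left]
  rfl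

theorem ae_drift_eq (hF0 : ∀ x, 0 ≤ F x)
    (hbd : ∀ᵐ p : ℝ × Space d ∂(volume.restrict (Ioo 0 T ×ˢ univ)),
      ∀ s ∈ Ici (0 : ℝ), ‖b (p.1, p.2, s)‖ ≤ Cb) :
    ∀ᵐ t ∂(volume.restrict (Ioo 0 T)), ∀ᵐ x, drift T b Cb F (t, x) = b (t, x, F x) := by
  rw [Measure.volume_eq_prod, ← Measure.prod_restrict, Measure.restrict_univ] at hbd
  filter_upwards [Measure.ae_ae_of_ae_prod hbd, ae_restrict_mem measurableSet_Ioo] with t ht htm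
  filter_upwards [ht] with x hx
  exact drift_eq (p := (t, x)) htm (hF0 x) hx

set_option maxHeartbeats 1000000 in
/-- Weak solutions are the variational solutions of the abstract problem. -/
theorem isWeakSolution_iff {ω : Set (Space d)} {K : Space d → ℝ} {u : L2On ω} (hT : 0 < T)
    (hb : Measurable ((Ioo 0 T ×ˢ univ ×ˢ Ici 0 : Set (ℝ × Space d × ℝ)).domRestrict b))
    (hCb : 0 ≤ Cb) (hq : ∀ i j, BddC1 T (diffusion σ i j) Cq) (hCq : 0 ≤ Cq)
    (hF0 : ∀ x, 0 ≤ S K u x) (hL : Continuous L) (hFL : ∀ x, HasFDerivAt (S K u) (L x) x)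
    (hLb : ∀ x, ‖L x‖ ≤ CL)
    (hbd : ∀ᵐ p : ℝ × Space d ∂(volume.restrict (Ioo 0 T ×ˢ univ)),
      ∀ s ∈ Ici (0 : ℝ), ‖b (p.1, p.2, s)‖ ≤ Cb)
    (h : BddCoeff (coefC T b Cb σ (S K u) L) (coefB T σ (S K u)) M)
    {κ c : ℝ} (hA : IsElliptic (H1.toL2 d) (fun t => divOperator (h.slice t)) (2 * M) κ c)
    {ρ₀ : Space d → ℝ} (hρ₀ : MemLp ρ₀ 2 volume) (ρ : ℝ → L2 d) :
    IsWeakSolution T K b σ ρ₀ u ρ ↔ ∃ w, IsVariationalSolution (H1.toL2 d)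
      (fun t => divOperator (h.slice t)) T hρ₀.toLp ρ w := by
  have hF : Continuous (S K u) := continuous_iff_continuousAt.2 fun x => (hFL x).continuousAt
  have hpt : ∀ᵐ t ∂(volume.restrict (Ioo 0 T)), ∀ r φ : H1 d,
      -inner ℝ (divOperator (h.slice t) r) φ =
      (∫ x, inner ℝ (H1.toL2 d r x • b (t, x, S K u x)) (H1.grad φ x)) -
        (1 / 2) * ∑ i, ∑ j, ∫ x, diffusionDeriv T σ (S K u) L t r i j x * H1.grad φ x i := by
    filter_upwards [ae_drift_eq hF0 hbd] with t ht
    exact inner_divOperator_coef hT hb hCb hq hCq hF0 hF hL hLb h ht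
  have hwp : ∀ t ∈ Ioo 0 T, ∀ r : H1 d, ∀ i j,
      HasWeakPartial j (fun x => diffusion σ i j (t, x, S K u x) * H1.toL2 d r x)
        (diffusionDeriv T σ (S K u) L t r i j) := by
    intro t ht r i j
    have := hasWeakPartial_diffusionDeriv hT hq hF0 hL hFL t r i j
    simpa only [dataPoint, clampTime_eq (Ioo_subset_Icc_self ht)] using this
  have hint : ∀ {w : ℝ → H1 d}, MemLp w 2 (volume.restrict (Ioo 0 T)) → ∀ t ∈ Icc 0 T,
      ∫ τ in (0 : ℝ)..t, riesz (H1 d) (-divOperator (h.slice τ) (w τ)) =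
        riesz (H1 d) (∫ τ in (0 : ℝ)..t, -divOperator (h.slice τ) (w τ)) := by
    intro w hw t ht
    refine intervalIntegral_riesz ?_
    have h1 := ((memLp_apply hA.meas hA.norm_le hw).integrable one_le_two).neg
    rw [intervalIntegrable_iff_integrableOn_Ioo_of_le ht.1]
    exact IntegrableOn.mono_set h1 (Ioo_subset_Ioo_right ht.2)
  have hcongr : ∀ {g : ℝ → HNeg d} {w : ℝ → H1 d}, (∀ᵐ t ∂(volume.restrict (Ioo 0 T)),
      g t = riesz (H1 d) (-divOperator (h.slice t) (w t))) → ∀ t ∈ Icc 0 T,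
      ∫ τ in (0 : ℝ)..t, g τ =
        ∫ τ in (0 : ℝ)..t, riesz (H1 d) (-divOperator (h.slice τ) (w τ)) := by
    intro g w hg t ht
    rw [intervalIntegral.integral_of_le ht.1, intervalIntegral.integral_of_le ht.1,
      integral_Ioc_eq_integral_Ioo, integral_Ioc_eq_integral_Ioo]
    exact integral_congr_ae (ae_restrict_of_ae_restrict_of_subset (Ioo_subset_Ioo_right ht.2) hg)
  have hinit : (ρ 0 : Space d → ℝ) =ᵐ[volume] ρ₀ ↔ ρ 0 = hρ₀.toLp :=
    ⟨fun h0 => Lp.ext (h0.trans hρ₀.coeFn_toLp.symm), fun h0 => h0 ▸ hρ₀.coeFn_toLp⟩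
  constructor
  · rintro ⟨⟨g, ⟨hcont, ⟨w, hw, hwρ⟩, hg, hgeq⟩, hweak⟩, h0⟩
    have hgw : ∀ᵐ t ∂(volume.restrict (Ioo 0 T)),
        g t = riesz (H1 d) (-divOperator (h.slice t) (w t)) := by
      filter_upwards [hweak, hwρ, hpt, ae_restrict_mem measurableSet_Ioo] with t h1 h2 h3 h4
      obtain ⟨D, hD, hDφ⟩ := h1
      ext φ
      rw [hDφ φ, riesz_apply, inner_neg_left, h3 (w t) φ, ← h2]
      congr 2
      refine Finset.sum_congr rfl fun i _ => Finset.sum_congr rfl fun j _ => ?_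
      refine integral_congr_ae ?_
      -- The product rule provides a weak derivative of the same function; uniqueness identifies it
      -- with the `D i j` of the weak solution.
      have h5 := hwp t h4 (w t) i j
      rw [h2] at h5
      filter_upwards [(hD i j).2.ae_unique h5] with x hx
      rw [hx]
    refine ⟨w, hcont, hw, hwρ, hinit.1 h0, fun t ht => riesz_injective ?_⟩
    have e := hgeq t ht
    rw [hcongr hgw t ht, hint hw t ht, toHNeg_eq, toHNeg_eq, hinit.1 h0, ← map_add] at e
    exact e
  · rintro ⟨w, hs⟩
    refine ⟨⟨fun t => riesz (H1 d) (-divOperator (h.slice t) (w t)), ⟨hs.cont, ⟨w, hs.memLp, hs.ae_eq⟩,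
      ?_, fun t ht => ?_⟩, ?_⟩, hinit.2 hs.init⟩
    · exact memLp_riesz (memLp_apply hA.meas hA.norm_le hs.memLp).neg
    · rw [hint hs.memLp t ht, toHNeg_eq, toHNeg_eq, ← map_add, hs.init, hs.eqn t ht]
    · filter_upwards [hs.ae_eq, hpt, ae_restrict_mem measurableSet_Ioo] with t h2 h3 h4
      refine ⟨diffusionDeriv T σ (S K u) L t (w t), fun i j => ⟨?_, ?_⟩, fun φ => ?_⟩
      · exact memLp_diffusionDeriv hT hq hCq hF0 hF hL hLb t (w t) i j
      · rw [← h2]; exact hwp t h4 (w t) i j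
      · rw [riesz_apply, inner_neg_left, h3 (w t) φ, ← h2]

end WeakForm

/-! ### The map from controls to elliptic operators. -/

section StateOperator

variable {d N : ℕ} {ω : Set (Space d)} {M₀ : ℝ} {ℓ : ℝ≥0∞}

/-- The derivative of `S K u`, where `g` is the weak gradient of `K`. -/
def gradS (g : Space d → Space d) (u : L2On ω) (x : Space d) : Space d →L[ℝ] ℝ :=
  ∑ i, S (fun z => g z i) u x • (EuclideanSpace.proj i : Space d →L[ℝ] ℝ)

theorem memLp_coord {g : Space d → Space d} (hg : MemLp g ℓ volume) (i : Fin d) :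
    MemLp (fun z => g z i) ℓ volume :=
  hg.continuousLinearMap_comp (EuclideanSpace.proj (𝕜 := ℝ) i)

theorem norm_proj_le (i : Fin d) : ‖(EuclideanSpace.proj i : Space d →L[ℝ] ℝ)‖ ≤ 1 :=
  ContinuousLinearMap.opNorm_le_bound _ zero_le_one fun y => by
    rw [one_mul]; exact PiLp.norm_apply_le y i

/-- One bound for all controls gives ellipticity constants independent of the control, so that
Gronwall's factor is the same along a sequence. -/
theorem exists_norm_gradS_le (hω : MeasurableSet ω) (hωb : Bornology.IsBounded ω) (hM : 0 ≤ M₀)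
    (hℓ : 1 ≤ ℓ) {g : Space d → Space d} (hg : MemLp g ℓ volume) :
    ∃ C, ∀ u ∈ admissible ω M₀, ∀ x, ‖gradS g u x‖ ≤ C := by
  obtain ⟨R, hR⟩ := hωb.subset_closedBall (0 : Space d)
  obtain ⟨C, hC0, hC⟩ := exists_kernelInt_le d hℓ R M₀ hM
  refine ⟨∑ i, C * (eLpNorm (fun z => g z i) ℓ volume).toReal * 1, fun u hu x => ?_⟩
  refine (norm_sum_le _ _).trans (Finset.sum_le_sum fun i _ => ?_)
  rw [norm_smul]
  exact mul_le_mul (hC _ (memLp_coord hg i) _ (BddSupp.extend hω hR hM hu) x) (norm_proj_le i)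
    (norm_nonneg _) (by positivity)

theorem continuous_gradS (hω : MeasurableSet ω) (hωb : Bornology.IsBounded ω) (hM : 0 ≤ M₀)
    (hℓ : 1 ≤ ℓ) (hℓ' : ℓ ≠ ∞) {g : Space d → Space d} (hg : MemLp g ℓ volume) {u : L2On ω}
    (hu : u ∈ admissible ω M₀) : Continuous (gradS g u) := by
  obtain ⟨R, hR⟩ := hωb.subset_closedBall (0 : Space d)
  exact continuous_finsetSum _ fun i _ => (continuous_kernelInt (BddSupp.extend hω hR hM hu) hM hℓ
    hℓ' (memLp_coord hg i)).smul continuous_const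

theorem hasFDerivAt_S (hω : MeasurableSet ω) (hωb : Bornology.IsBounded ω) (hM : 0 ≤ M₀)
    (hℓ : 1 ≤ ℓ) (hℓ' : ℓ ≠ ∞) {K : Space d → ℝ} {g : Space d → Space d}
    (hK : HasWeakGradient K g) (hKm : MemLp K ℓ volume) (hg : MemLp g ℓ volume) {u : L2On ω}
    (hu : u ∈ admissible ω M₀) (x : Space d) : HasFDerivAt (S K u) (gradS g u x) x := by
  obtain ⟨R, hR⟩ := hωb.subset_closedBall (0 : Space d)
  exact hasFDerivAt_kernelInt (BddSupp.extend hω hR hM hu) hM hℓ hℓ' hK hKm hg x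

/-- The state equation is governed by elliptic operators that depend continuously on the control
for the weak topology of `L²(ω)`. -/
theorem exists_state_operator {T : ℝ} (hT : 0 < T) (hM : 0 ≤ M₀) (hω : MeasurableSet ω)
    (hωb : Bornology.IsBounded ω) (hℓ : 1 ≤ ℓ) (hℓ' : ℓ ≠ ∞) {K : Space d → ℝ} (hK : MemW1p ℓ K)
    (hK0 : ∀ x, 0 ≤ K x) {b : ℝ × Space d × ℝ → Space d}
    (hb : Measurable ((Ioo 0 T ×ˢ univ ×ˢ Ici 0 : Set (ℝ × Space d × ℝ)).domRestrict b))
    (hb_bdd : MemLp b ∞ (volume.restrict (Ioo 0 T ×ˢ univ ×ˢ Ici 0)))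
    (hb_cont : ∀ᵐ p : ℝ × Space d ∂(volume.restrict (Ioo 0 T ×ˢ univ)),
      ContinuousOn (fun s => b (p.1, p.2, s)) (Ici 0))
    {σ : ℝ × Space d × ℝ → Matrix (Fin d) (Fin N) ℝ} (hσ : ∀ i l, MemCb2 T (fun p => σ p i l))
    {γ : ℝ} (hγ : 0 < γ) (hσ_elliptic : ∀ t ∈ Icc 0 T, ∀ x : Space d, ∀ s : ℝ, 0 ≤ s →
      ∀ ξ : Space d, γ * ‖ξ‖ ^ 2 ≤ ∑ i, ∑ j, diffusion σ i j (t, x, s) * ξ i * ξ j)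
    {ρ₀ : Space d → ℝ} (hρ₀ : MemLp ρ₀ 2 volume) :
    ∃ (A : admissible ω M₀ → ℝ → H1 d →L[ℝ] H1 d) (M κ c : ℝ), 0 < κ ∧ 0 < c ∧
      (∀ u, IsElliptic (H1.toL2 d) (A u) M κ c) ∧
      (∀ (u : admissible ω M₀) (ρ : ℝ → L2 d), IsWeakSolution T K b σ ρ₀ u.1 ρ ↔
        ∃ w, IsVariationalSolution (H1.toL2 d) (A u) T hρ₀.toLp ρ w) ∧
      ∀ (un : ℕ → admissible ω M₀) (u : admissible ω M₀),
        (∀ f : L2On ω, Tendsto (fun n => inner ℝ f (un n).1) atTop (𝓝 (inner ℝ f u.1))) →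
        ∀ᵐ t ∂(volume.restrict (Ioo 0 T)), ∀ v,
          Tendsto (fun n => A (un n) t v) atTop (𝓝 (A u t v)) := by
  obtain ⟨hKm, g, hg, hKg⟩ := hK
  obtain ⟨CL, hCL⟩ := exists_norm_gradS_le hω hωb hM hℓ hg
  obtain ⟨Cq, hCq, hq⟩ := exists_bddC1_diffusion hT hσ
  obtain ⟨Cb, hCb, hbd⟩ := exists_drift_bound hb_bdd hb_cont
  have hF0 : ∀ u : admissible ω M₀, ∀ x, 0 ≤ S K u.1 x := fun u => S_nonneg hω hK0 u.2
  have hFL : ∀ u : admissible ω M₀, ∀ x, HasFDerivAt (S K u.1) (gradS g u.1 x) x :=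
    fun u => hasFDerivAt_S hω hωb hM hℓ hℓ' hKg hKm hg u.2
  have hF : ∀ u : admissible ω M₀, Continuous (S K u.1) := fun u =>
    continuous_iff_continuousAt.2 fun x => (hFL u x).continuousAt
  have hL : ∀ u : admissible ω M₀, Continuous (gradS g u.1) := fun u =>
    continuous_gradS hω hωb hM hℓ hℓ' hg u.2
  have hco : ∀ u : admissible ω M₀, BddCoeff (coefC T b Cb σ (S K u.1) (gradS g u.1))
      (coefB T σ (S K u.1)) (Cb + d * (d * (Cq * (1 + CL)))) := fun u =>
    bddCoeff_coef hT hb hCb hq hCq (hF0 u) (hF u) (hL u) (hCL u.1 u.2)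
  set M := Cb + d * (d * (Cq * (1 + CL)))
  have hell : ∀ u : admissible ω M₀, IsElliptic (H1.toL2 d)
      (fun t => divOperator ((hco u).slice t)) (2 * M) (M ^ 2 / γ + γ / 4) (γ / 4) := fun u =>
    isElliptic_divOperator (hco u) hγ (coefB_coercive hT (hF0 u) hσ_elliptic)
  refine ⟨fun u t => divOperator ((hco u).slice t), 2 * M, M ^ 2 / γ + γ / 4, γ / 4, by positivity,
    by positivity, hell, fun u ρ => isWeakSolution_iff hT hb hCb hq hCq (hF0 u) (hL u) (hFL u)
      (hCL u.1 u.2) hbd (hco u) (hell u) hρ₀ ρ, fun un u hw => ?_⟩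
  have hlim : ∀ x, Tendsto (fun n => S K (un n).1 x) atTop (𝓝 (S K u.1 x)) :=
    tendsto_S_of_weak hω hωb hℓ hKm (fun n => (un n).2) u.2 hM hw
  have hLlim : ∀ x y, Tendsto (fun n => gradS g (un n).1 x y) atTop (𝓝 (gradS g u.1 x y)) := by
    intro x y
    simp_rw [gradS, sum_apply, smul_apply]
    exact tendsto_finsetSum _ fun i _ => (tendsto_S_of_weak hω hωb hℓ (memLp_coord hg i)
      (fun n => (un n).2) u.2 hM hw x).smul_const _
  -- The exceptional set depends only on `b`, not on `v` or on the controls; Fubini leaves almost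
  -- every time, and there almost every `x`.
  have hall := hbd.and hb_cont
  rw [Measure.volume_eq_prod, ← Measure.prod_restrict, Measure.restrict_univ] at hall
  filter_upwards [Measure.ae_ae_of_ae_prod hall, ae_restrict_mem measurableSet_Ioo] with t ht htm v
  refine tendsto_flux (fun n => (hco (un n)).slice t) ((hco u).slice t) ?_
    (Eventually.of_forall fun x => tendsto_coefB hT hq (fun n => hF0 (un n)) (hF0 u) hlim (t, x)) v
  filter_upwards [ht] with x hx
  exact tendsto_coefC hT hq (fun n => hF0 (un n)) (hF0 u) hlim hLlim (p := (t, x)) htm hx.1 hx.2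

end StateOperator

/-! ### Uniform convergence of the states. -/

section Stability

variable {V H : Type*} [NormedAddCommGroup V] [InnerProductSpace ℝ V] [CompleteSpace V]
  [SecondCountableTopology V] [NormedAddCommGroup H] [InnerProductSpace ℝ H] [CompleteSpace H]
  {ι : V →L[ℝ] H} {M κ c T : ℝ}

/-- Variational solutions depend continuously on the operator, uniformly in time. -/
theorem IsVariationalSolution.exists_tendsto_norm_sub_le {An : ℕ → ℝ → V →L[ℝ] V}
    {A : ℝ → V →L[ℝ] V} (hAn : ∀ n, IsElliptic ι (An n) M κ c) (hA : IsElliptic ι A M κ c)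
    (hc : 0 < c) (hκ : 0 < κ) (hT : 0 < T) {ρ₀ : H} {ρn : ℕ → ℝ → H} {wn : ℕ → ℝ → V} {ρ : ℝ → H}
    {w : ℝ → V} (hn : ∀ n, IsVariationalSolution ι (An n) T ρ₀ (ρn n) (wn n))
    (h : IsVariationalSolution ι A T ρ₀ ρ w)
    (hlim : ∀ᵐ t ∂(volume.restrict (Ioo 0 T)), ∀ v,
      Tendsto (fun n => An n t v) atTop (𝓝 (A t v))) :
    ∃ ε : ℕ → ℝ, Tendsto ε atTop (𝓝 0) ∧ ∀ n, ∀ t ∈ Icc 0 T, ‖ρn n t - ρ t‖ ≤ ε n := by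
  -- The operators are compared along `w`, the limit solution, which does not depend on `n`.
  have h1 := tendsto_integral_norm_sub_sq (fun n => (hAn n).meas) hA.meas
    (fun n => (hAn n).norm_le) hA.norm_le h.memLp hlim
  have h2 := ((h1.div_const (2 * c)).mul_const (Real.exp (2 * κ * T))).sqrt
  rw [zero_div, zero_mul, Real.sqrt_zero] at h2
  refine ⟨_, h2, fun n t ht => Real.le_sqrt_of_sq_le ?_⟩
  exact IsVariationalSolution.norm_sub_sq_le (hAn n) hA hc hκ hT (hn n) h ht

end Stability

/-! ### Weak compactness and the direct method. -/

section Minimization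

variable {E : Type*} [NormedAddCommGroup E] [InnerProductSpace ℝ E] [CompleteSpace E]

/-- Bounded sequences in a separable Hilbert space have weakly convergent subsequences. -/
theorem exists_subseq_tendsto_inner [TopologicalSpace.SeparableSpace E] {un : ℕ → E} {R : ℝ}
    (hR : ∀ n, ‖un n‖ ≤ R) : ∃ (u : E) (ns : ℕ → ℕ), StrictMono ns ∧
      ∀ f, Tendsto (fun n => inner ℝ f (un (ns n))) atTop (𝓝 (inner ℝ f u)) := by
  obtain ⟨y, -, ns, hns, hlim⟩ := WeakDual.isSeqCompact_closedBall ℝ E 0 R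
    (x := fun n => StrongDual.toWeakDual (InnerProductSpace.toDual ℝ E (un n))) (fun n => by
      change InnerProductSpace.toDual ℝ E (un n) ∈ Metric.closedBall 0 R
      rw [mem_closedBall_zero_iff, LinearIsometryEquiv.norm_map]
      exact hR n)
  refine ⟨(InnerProductSpace.toDual ℝ E).symm (WeakDual.toStrongDual y), ns, hns, fun f => ?_⟩
  have h := ((WeakDual.eval_continuous f).tendsto y).comp hlim
  have e : inner ℝ f ((InnerProductSpace.toDual ℝ E).symm (WeakDual.toStrongDual y)) = y f := by
    rw [real_inner_comm, InnerProductSpace.toDual_symm_apply]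
    rfl
  rw [e]
  refine h.congr fun n => ?_
  rw [real_inner_comm]
  rfl

/-- Closed convex sets are weakly sequentially closed. -/
theorem mem_of_tendsto_inner {C : Set E} (hC : Convex ℝ C) (hC' : IsClosed C) {un : ℕ → E} {u : E}
    (hn : ∀ᶠ n in atTop, un n ∈ C)
    (hw : ∀ f, Tendsto (fun n => inner ℝ f (un n)) atTop (𝓝 (inner ℝ f u))) : u ∈ C := by
  by_contra hu
  obtain ⟨f, r, hfr, hrf⟩ := geometric_hahn_banach_point_closed hC hC' hu
  have h := hw ((InnerProductSpace.toDual ℝ E).symm f)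
  simp_rw [InnerProductSpace.toDual_symm_apply] at h
  have := ge_of_tendsto h (hn.mono fun n hn => (hrf _ hn).le)
  linarith

/-- The direct method for a cost that is the sum of a weakly continuous function of the state and
of a penalty of the control with closed convex sublevel sets. -/
theorem exists_minimizer [TopologicalSpace.SeparableSpace E] {X : Type*} {U : Set E} {R : ℝ}
    (hR : ∀ u ∈ U, ‖u‖ ≤ R) (hU : Convex ℝ U) (hU' : IsClosed U) (hne : U.Nonempty)
    {sol : E → X → Prop} (hsol : ∀ u ∈ U, ∃ x, sol u x) {Λ : X → ℝ} {φ : E → ℝ}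
    (hφ : ∀ c, Convex ℝ {u ∈ U | φ u ≤ c}) (hφ' : ∀ c, IsClosed {u ∈ U | φ u ≤ c})
    (hΛ : ∀ (un : ℕ → E) (u : E) (xn : ℕ → X) (x : X), (∀ n, un n ∈ U) → u ∈ U →
      (∀ n, sol (un n) (xn n)) → sol u x →
      (∀ f, Tendsto (fun n => inner ℝ f (un n)) atTop (𝓝 (inner ℝ f u))) →
      Tendsto (fun n => Λ (xn n)) atTop (𝓝 (Λ x))) :
    ∃ u' ∈ U, ∀ x', sol u' x' → ∀ u ∈ U, ∀ x, sol u x → Λ x' + φ u' ≤ Λ x + φ u := by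
  -- The infimum is taken in the extended reals, so no lower bound on the cost has to be known.
  set V : Set EReal := {r | ∃ u ∈ U, ∃ x, sol u x ∧ r = ((Λ x + φ u : ℝ) : EReal)} with hV
  have hVne : V.Nonempty := by
    obtain ⟨u, hu⟩ := hne
    obtain ⟨x, hx⟩ := hsol u hu
    exact ⟨_, u, hu, x, hx, rfl⟩
  obtain ⟨r, -, hr, hrV⟩ := exists_seq_tendsto_sInf hVne (OrderBot.bddBelow V)
  choose un hun xn hxn hrn using hrV
  obtain ⟨u', ns, hns, hw⟩ := exists_subseq_tendsto_inner fun n => hR _ (hun n)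
  have hu' : u' ∈ U := mem_of_tendsto_inner hU hU' (Eventually.of_forall fun n => hun (ns n)) hw
  refine ⟨u', hu', fun x' hx' u hu x hx => ?_⟩
  suffices h : ((Λ x' + φ u' : ℝ) : EReal) ≤ sInf V from
    EReal.coe_le_coe_iff.1 (h.trans (sInf_le ⟨u, hu, x, hx, rfl⟩))
  by_contra! hlt
  obtain ⟨m, hm1, hm2⟩ := EReal.lt_iff_exists_real_btwn.1 hlt
  rw [EReal.coe_lt_coe_iff] at hm2
  have h1 := hΛ _ u' _ x' (fun n => hun (ns n)) hu' (fun n => hxn (ns n)) hx' hw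
  have h2 := (hr.comp hns.tendsto_atTop).eventually_lt_const hm1
  -- With `m` strictly between the infimum and the value at `u'`, eventually the total is below `m`
  -- and the state part above `Λ x' - δ`. The penalties then lie in the sublevel `m - Λ x' + δ`,
  -- which is weakly closed, yet `φ u' = m - Λ x' + 2δ`.
  set δ := (Λ x' + φ u' - m) / 2 with hδ
  have h3 := h1.eventually_const_lt (show Λ x' - δ < Λ x' by linarith)
  have h4 : u' ∈ {u ∈ U | φ u ≤ m - (Λ x' - δ)} := by
    refine mem_of_tendsto_inner (hφ _) (hφ' _) ?_ hw
    filter_upwards [h2, h3] with n hn2 hn3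
    refine ⟨hun _, ?_⟩
    rw [Function.comp_apply, hrn, EReal.coe_lt_coe_iff] at hn2
    linarith
  linarith [h4.2]

end Minimization

/-! ### Closed convex sublevel sets of the penalty. -/

section Penalty

variable {α : Type*} [MeasurableSpace α] {μ : Measure α} {M₀ : ℝ} {h : ℝ → ℝ}

theorem integrable_comp_of_mem_Icc [IsFiniteMeasure μ] (hM : 0 ≤ M₀)
    (hh : ContinuousOn h (Icc 0 M₀)) {u : α → ℝ} (hu : AEStronglyMeasurable u μ)
    (hu' : ∀ᵐ x ∂μ, u x ∈ Icc 0 M₀) : Integrable (fun x => h (u x)) μ := by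
  obtain ⟨C, hC⟩ := isCompact_Icc.exists_bound_of_continuousOn hh
  -- Nothing is known about `h` off `[0,M₀]`; measurability is obtained through a continuous
  -- extension that agrees with it at almost every value of `u`.
  have hc : Continuous (IccExtend hM ((Icc 0 M₀).domRestrict h)) :=
    (continuousOn_iff_continuous_domRestrict.1 hh).Icc_extend'
  refine Integrable.of_bound ((hc.comp_aestronglyMeasurable hu).congr ?_) C ?_
  · filter_upwards [hu'] with x hx
    rw [IccExtend_of_mem hM _ hx]
    rfl
  · filter_upwards [hu'] with x hx using hC _ hx

/-- L² convergence gives an almost everywhere convergent subsequence, and `h` is bounded on the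
compact interval, so dominated convergence applies. -/
theorem isClosed_integral_comp_le [IsFiniteMeasure μ] (hM : 0 ≤ M₀)
    (hh : ContinuousOn h (Icc 0 M₀)) (c : ℝ) :
    IsClosed {u : Lp ℝ 2 μ | (∀ᵐ x ∂μ, u x ∈ Icc 0 M₀) ∧ ∫ x, h (u x) ∂μ ≤ c} := by
  refine IsSeqClosed.isClosed fun un u hun hlim => ?_
  obtain ⟨ns, -, hns⟩ := (tendstoInMeasure_of_tendsto_Lp hlim).exists_seq_tendsto_ae
  have hall : ∀ᵐ x ∂μ, ∀ n, un n x ∈ Icc 0 M₀ := ae_all_iff.2 fun n => (hun n).1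
  have hu : ∀ᵐ x ∂μ, u x ∈ Icc 0 M₀ := by
    filter_upwards [hns, hall] with x h1 h2
    exact isClosed_Icc.mem_of_tendsto h1 (Eventually.of_forall fun n => h2 _)
  refine ⟨hu, ?_⟩
  obtain ⟨C, hC⟩ := isCompact_Icc.exists_bound_of_continuousOn hh
  have ht : Tendsto (fun n => ∫ x, h (un (ns n) x) ∂μ) atTop (𝓝 (∫ x, h (u x) ∂μ)) := by
    refine tendsto_integral_of_dominated_convergence (fun _ => C)
      (fun n => (integrable_comp_of_mem_Icc hM hh (Lp.aestronglyMeasurable _) (hun _).1).1)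
      (integrable_const _) (fun n => ?_) ?_
    · filter_upwards [hall] with x hx using hC _ (hx _)
    · filter_upwards [hns, hall, hu] with x h1 h2 h3
      exact (hh _ h3).tendsto.comp (tendsto_nhdsWithin_iff.2
        ⟨h1, Eventually.of_forall fun n => h2 _⟩)
  exact le_of_tendsto ht (Eventually.of_forall fun n => (hun _).2)

theorem convex_integral_comp_le [IsFiniteMeasure μ] (hM : 0 ≤ M₀)
    (hh : ContinuousOn h (Icc 0 M₀)) (hconv : ConvexOn ℝ (Icc 0 M₀) h) (c : ℝ) :
    Convex ℝ {u : Lp ℝ 2 μ | (∀ᵐ x ∂μ, u x ∈ Icc 0 M₀) ∧ ∫ x, h (u x) ∂μ ≤ c} := by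
  rintro u ⟨hu, huc⟩ v ⟨hv, hvc⟩ a b ha hb hab
  have e : ∀ᵐ x ∂μ, (a • u + b • v : Lp ℝ 2 μ) x = a • u x + b • v x := by
    filter_upwards [Lp.coeFn_add (a • u) (b • v), Lp.coeFn_smul a u, Lp.coeFn_smul b v]
      with x h1 h2 h3
    rw [h1, Pi.add_apply, h2, h3, Pi.smul_apply, Pi.smul_apply]
  have hm : ∀ᵐ x ∂μ, (a • u + b • v : Lp ℝ 2 μ) x ∈ Icc 0 M₀ := by
    filter_upwards [e, hu, hv] with x h1 h2 h3
    rw [h1]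
    exact convex_Icc 0 M₀ h2 h3 ha hb hab
  refine ⟨hm, ?_⟩
  have iu := integrable_comp_of_mem_Icc hM hh (Lp.aestronglyMeasurable u) hu
  have iv := integrable_comp_of_mem_Icc hM hh (Lp.aestronglyMeasurable v) hv
  calc ∫ x, h ((a • u + b • v : Lp ℝ 2 μ) x) ∂μ ≤ ∫ x, (a * h (u x) + b * h (v x)) ∂μ := by
        refine integral_mono_ae (integrable_comp_of_mem_Icc hM hh (Lp.aestronglyMeasurable _) hm)
          ((iu.const_mul a).add (iv.const_mul b)) ?_
        filter_upwards [e, hu, hv] with x h1 h2 h3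
        rw [h1]
        exact hconv.2 h2 h3 ha hb hab
    _ = a * (∫ x, h (u x) ∂μ) + b * ∫ x, h (v x) ∂μ := by
        rw [integral_add (iu.const_mul a) (iv.const_mul b), integral_const_mul, integral_const_mul]
    _ ≤ a * c + b * c := by gcongr
    _ = c := by rw [← add_mul, hab, one_mul]

end Penalty

/-! ### Continuity of the state part of the cost. -/

section TimeSections

variable {d : ℕ} {T : ℝ}

/-- A square integrable function on `(0,T) × ℝ^d` is a square integrable function of time with
values in `L²(ℝ^d)`. -/
theorem exists_memLp_section {G : ℝ × Space d → ℝ}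
    (hG : MemLp G 2 (volume.restrict (Ioo 0 T ×ˢ univ))) :
    ∃ g : ℝ → L2 d, MemLp g 2 (volume.restrict (Ioo 0 T)) ∧
      ∀ᵐ t ∂(volume.restrict (Ioo 0 T)), (g t : Space d → ℝ) =ᵐ[volume] fun x => G (t, x) := by
  have hμ : (volume : Measure (ℝ × Space d)).restrict (Ioo 0 T ×ˢ univ) =
      (volume.restrict (Ioo 0 T)).prod volume := by
    rw [Measure.volume_eq_prod, ← Measure.prod_restrict, Measure.restrict_univ]
  rw [hμ] at hG
  set G' := hG.1.mk G with hG'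
  have hm : StronglyMeasurable G' := hG.1.stronglyMeasurable_mk
  have hae := Measure.ae_ae_of_ae_prod hG.1.ae_eq_mk
  have h2 : (∫⁻ t in Ioo 0 T, ∫⁻ x, ‖G' (t, x)‖ₑ ^ (2 : ℝ)) < ∞ := by
    rw [← lintegral_prod _ (hm.enorm.pow_const _).aemeasurable]
    have := (eLpNorm_lt_top_iff_lintegral_rpow_enorm_lt_top two_ne_zero (by norm_num)).1
      (hG.ae_eq hG.1.ae_eq_mk).2
    simpa using this
  have hN : Measurable fun t => ∫⁻ x, ‖G' (t, x)‖ₑ ^ (2 : ℝ) :=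
    Measurable.lintegral_prod_right' (hm.enorm.pow_const _)
  -- Times whose slice is not square integrable form a null set; zero is substituted there so that
  -- every slice defines an element of L².
  set A : Set ℝ := {t | ∫⁻ x, ‖G' (t, x)‖ₑ ^ (2 : ℝ) < ∞} with hA
  have hAm : MeasurableSet A := measurableSet_lt hN measurable_const
  set F : ℝ → Space d → ℝ := fun t x => (A ×ˢ univ).indicator G' (t, x) with hF
  have hFm : StronglyMeasurable (Function.uncurry F) :=
    hm.indicator (hAm.prod MeasurableSet.univ)
  have hFA : ∀ t ∈ A, F t = fun x => G' (t, x) := fun t ht => funext fun x =>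
    indicator_of_mem (show (t, x) ∈ A ×ˢ univ from ⟨ht, mem_univ _⟩) _
  have hFA' : ∀ t ∉ A, F t = 0 := fun t ht => funext fun x =>
    indicator_of_notMem (fun h => ht h.1) _
  have hFL : ∀ t, MemLp (F t) 2 volume := by
    intro t
    by_cases ht : t ∈ A
    · rw [hFA t ht]
      refine ⟨(hm.comp_measurable measurable_prodMk_left).aestronglyMeasurable,
        (eLpNorm_lt_top_iff_lintegral_rpow_enorm_lt_top two_ne_zero (by norm_num)).2 ?_⟩
      have ht' : ∫⁻ x, ‖G' (t, x)‖ₑ ^ (2 : ℝ) < ∞ := ht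
      simpa using ht'
    · rw [hFA' t ht]
      exact MemLp.zero
  have hle : ∀ t, ‖(hFL t).toLp‖ₑ ^ (2 : ℝ) ≤ ∫⁻ x, ‖G' (t, x)‖ₑ ^ (2 : ℝ) := by
    intro t
    rw [Lp.enorm_toLp, eLpNorm_eq_lintegral_rpow_enorm_toReal (by norm_num) (by norm_num),
      ENNReal.toReal_ofNat, ← ENNReal.rpow_mul]
    norm_num
    refine lintegral_mono fun x => ?_
    by_cases ht : t ∈ A
    · rw [hFA t ht]
    · rw [hFA' t ht]; simp
  refine ⟨fun t => (hFL t).toLp, ⟨(stronglyMeasurable_toLp hFm hFL).aestronglyMeasurable,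
    (eLpNorm_lt_top_iff_lintegral_rpow_enorm_lt_top two_ne_zero (by norm_num)).2 ?_⟩, ?_⟩
  · rw [ENNReal.toReal_ofNat]
    exact (lintegral_mono hle).trans_lt h2
  · filter_upwards [hae, ae_lt_top hN h2.ne] with t h3 h4
    refine (hFL t).coeFn_toLp.trans ?_
    rw [hFA t h4]
    exact EventuallyEq.symm h3

theorem integral_mul_eq_inner_of_ae_eq {f : Space d → ℝ} {g : L2 d} (hg : (g : Space d → ℝ) =ᵐ[volume] f)
    (ρ : L2 d) : ∫ x, f x * ρ x = inner ℝ g ρ := by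
  rw [L2.inner_def]
  refine integral_congr_ae ?_
  filter_upwards [hg] with x hx
  rw [hx]
  simp [mul_comm]

/-- The state part of the cost is continuous for uniform convergence in time. -/
theorem tendsto_stateCost (hT : 0 < T) {G : ℝ × Space d → ℝ} {GT : Space d → ℝ}
    (hG : MemLp G 2 (volume.restrict (Ioo 0 T ×ˢ univ))) (hGT : MemLp GT 2 volume)
    {ρn : ℕ → ℝ → L2 d} {ρ : ℝ → L2 d} (hn : ∀ n, ContinuousOn (ρn n) (Icc 0 T))
    (hρ : ContinuousOn ρ (Icc 0 T)) {ε : ℕ → ℝ} (hε : Tendsto ε atTop (𝓝 0))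
    (h : ∀ n, ∀ t ∈ Icc 0 T, ‖ρn n t - ρ t‖ ≤ ε n) :
    Tendsto (fun n => (∫ t in (0 : ℝ)..T, ∫ x, G (t, x) * ρn n t x) + ∫ x, GT x * ρn n T x) atTop
      (𝓝 ((∫ t in (0 : ℝ)..T, ∫ x, G (t, x) * ρ t x) + ∫ x, GT x * ρ T x)) := by
  have hlim : ∀ t ∈ Icc 0 T, Tendsto (fun n => ρn n t) atTop (𝓝 (ρ t)) := fun t ht => by
    rw [tendsto_iff_norm_sub_tendsto_zero]
    exact squeeze_zero (fun _ => norm_nonneg _) (fun n => h n t ht) hε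
  refine Tendsto.add ?_ ?_
  · obtain ⟨g, hg, hgG⟩ := exists_memLp_section hG
    have e : ∀ r : ℝ → L2 d, ∫ t in (0 : ℝ)..T, ∫ x, G (t, x) * r t x =
        ∫ t in Ioo 0 T, inner ℝ (g t) (r t) := by
      intro r
      rw [intervalIntegral.integral_of_le hT.le, integral_Ioc_eq_integral_Ioo]
      refine integral_congr_ae ?_
      filter_upwards [hgG] with t ht using integral_mul_eq_inner_of_ae_eq ht _
    simp_rw [e]
    -- All `ρn n` are bounded by `C + B`: the bound of the limit plus that of the errors `ε n`.
    obtain ⟨C, hC⟩ := isCompact_Icc.exists_bound_of_continuousOn hρ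
    obtain ⟨B, hB⟩ := hε.bddAbove_range
    refine tendsto_integral_of_dominated_convergence (fun t => ‖g t‖ * (C + B)) (fun n => ?_)
      ((hg.integrable one_le_two).norm.mul_const _) (fun n => ?_) ?_
    · exact hg.1.inner (((hn n).mono Ioo_subset_Icc_self).aestronglyMeasurable measurableSet_Ioo)
    · filter_upwards [ae_restrict_mem measurableSet_Ioo] with t ht
      refine (norm_inner_le_norm _ _).trans (mul_le_mul_of_nonneg_left ?_ (norm_nonneg _))
      have h1 := hC t (Ioo_subset_Icc_self ht)
      have h2 := h n t (Ioo_subset_Icc_self ht)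
      have h3 : ε n ≤ B := hB (mem_range_self n)
      have h4 := norm_add_le (ρ t) (ρn n t - ρ t)
      rw [add_sub_cancel] at h4
      linarith
    · filter_upwards [ae_restrict_mem measurableSet_Ioo] with t ht
      exact tendsto_const_nhds.inner (hlim t (Ioo_subset_Icc_self ht))
  · simp_rw [integral_mul_eq_inner_of_ae_eq hGT.coeFn_toLp]
    exact tendsto_const_nhds.inner (hlim T ⟨hT.le, le_rfl⟩)

end TimeSections

/-! ### The extended-real cost. -/

section Cost

variable {d : ℕ} {ω : Set (Space d)} {T M₀ : ℝ} {G : ℝ × Space d → ℝ} {GT : Space d → ℝ}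
  {h : ℝ → ℝ}

theorem setLIntegral_extend (hω : MeasurableSet ω) (u : L2On ω) :
    ∫⁻ x in ω, ENNReal.ofReal (h (extend u x)) = ∫⁻ x in ω, ENNReal.ofReal (h (u x)) := by
  refine lintegral_congr_ae ?_
  filter_upwards [ae_restrict_mem hω] with x hx
  rw [extend, indicator_of_mem hx]

theorem cost_eq_coe [IsFiniteMeasure (volume.restrict ω)] (hω : MeasurableSet ω) (hM : 0 ≤ M₀)
    (hh : ContinuousOn h (Icc 0 M₀)) (hh0 : ∀ s ∈ Icc 0 M₀, 0 ≤ h s) {u : L2On ω}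
    (hu : u ∈ admissible ω M₀) (ρ : ℝ → L2 d) :
    cost T G GT h ω u ρ = (((∫ t in (0 : ℝ)..T, ∫ x, G (t, x) * ρ t x) + (∫ x, GT x * ρ T x) +
      ∫ x in ω, h (u x) : ℝ) : EReal) := by
  have hu' : ∀ᵐ x ∂(volume.restrict ω), u x ∈ Icc 0 M₀ := hu
  have h0 : ∀ᵐ x ∂(volume.restrict ω), 0 ≤ h (u x) := by
    filter_upwards [hu'] with x hx using hh0 _ hx
  rw [cost, setLIntegral_extend hω, ← ofReal_integral_eq_lintegral_ofReal
    (integrable_comp_of_mem_Icc hM hh (Lp.aestronglyMeasurable u) hu') h0,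
    EReal.coe_ennreal_ofReal, max_eq_left (integral_nonneg_of_ae h0), ← EReal.coe_add]

/-- Off `ω` the extended control vanishes, so the two costs differ by a term, possibly infinite,
that does not depend on the control. -/
theorem cost_univ_eq (hω : MeasurableSet ω) (u : L2On ω) (ρ : ℝ → L2 d) :
    cost T G GT h univ u ρ =
      cost T G GT h ω u ρ + ((∫⁻ _ in ωᶜ, ENNReal.ofReal (h 0) : ℝ≥0∞) : EReal) := by
  have e : ∫⁻ x in ωᶜ, ENNReal.ofReal (h (extend u x)) =
      ∫⁻ _ in ωᶜ, ENNReal.ofReal (h 0) := by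
    refine setLIntegral_congr_fun hω.compl fun x hx => ?_
    simp only [extend, indicator_of_notMem hx]
  rw [cost, cost, Measure.restrict_univ, ← lintegral_add_compl _ hω, e, EReal.coe_ennreal_add,
    add_assoc]

end Cost

end FPControl

end

/-! ### Well-posedness of the state equation and existence of an optimal control. -/

theorem mainTheorem1 {d N : ℕ} (hd : 0 < d)
    (T M₀ : ℝ) (hT : 0 < T) (hM₀ : 0 < M₀)
    (ω : Set (FPControl.Space d)) (hω : IsOpen ω) (hωb : Bornology.IsBounded ω)
    (ℓ : ℝ≥0∞) (hℓ1 : 1 ≤ ℓ) (hℓ2 : ℓ ≤ 2)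
    (K : FPControl.Space d → ℝ) (hK : FPControl.MemW1p ℓ K) (hK0 : ∀ x, 0 ≤ K x)
    (b : ℝ × FPControl.Space d × ℝ → FPControl.Space d)
    (hb_borel : Measurable
      ((Ioo 0 T ×ˢ univ ×ˢ Ici 0 : Set (ℝ × FPControl.Space d × ℝ)).domRestrict b))
    (hb_bdd : MemLp b ∞ (volume.restrict (Ioo 0 T ×ˢ univ ×ˢ Ici 0)))
    (hb_cont : ∀ᵐ p : ℝ × FPControl.Space d ∂(volume.restrict (Ioo 0 T ×ˢ univ)),
      ContinuousOn (fun s => b (p.1, p.2, s)) (Ici 0))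
    (σ : ℝ × FPControl.Space d × ℝ → Matrix (Fin d) (Fin N) ℝ)
    (hσ : ∀ i l, FPControl.MemCb2 T (fun p => σ p i l))
    (γ : ℝ) (hγ : 0 < γ)
    (hσ_elliptic : ∀ t ∈ Icc 0 T, ∀ x : FPControl.Space d, ∀ s : ℝ, 0 ≤ s →
      ∀ ξ : FPControl.Space d,
        γ * ‖ξ‖ ^ 2 ≤ ∑ i, ∑ j, FPControl.diffusion σ i j (t, x, s) * ξ i * ξ j)
    (ρ₀ : FPControl.Space d → ℝ) (hρ₀_L2 : MemLp ρ₀ 2 volume) (hρ₀_L1 : Integrable ρ₀ volume)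
    (hρ₀_nonneg : ∀ᵐ x, 0 ≤ ρ₀ x) (hρ₀_mass : ∫ x, ρ₀ x = 1)
    (G : ℝ × FPControl.Space d → ℝ)
    (hG : MemLp G 2 (volume.restrict (Ioo 0 T ×ˢ univ)))
    (hG_nonneg : ∀ᵐ p ∂(volume.restrict (Ioo 0 T ×ˢ univ)), 0 ≤ G p)
    (GT : FPControl.Space d → ℝ) (hGT : MemLp GT 2 volume) (hGT_nonneg : ∀ᵐ x, 0 ≤ GT x)
    (h : ℝ → ℝ) (hh_nonneg : ∀ s ∈ Icc 0 M₀, 0 ≤ h s) (hh_convex : ConvexOn ℝ (Icc 0 M₀) h)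
    (hh_cont : ContinuousOn h (Icc 0 M₀))
    (α : ℝ) (hα : 0 < α) (hh_coercive : ∀ s ∈ Icc 0 M₀, α / 2 * |s| ^ 2 ≤ h s) :
    -- every admissible control has exactly one weak solution `ρ^u` on `[0,T]`
    (∀ u ∈ FPControl.admissible ω M₀,
      (∃ ρ, FPControl.IsWeakSolution T K b σ ρ₀ u ρ) ∧
      ∀ ρ ρ', FPControl.IsWeakSolution T K b σ ρ₀ u ρ →
        FPControl.IsWeakSolution T K b σ ρ₀ u ρ' → EqOn ρ ρ' (Icc 0 T)) ∧
    -- there is an optimal control, with the penalty integrated over `ℝ^d` and also over `ω`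
    ∃ u' ∈ FPControl.admissible ω M₀, ∀ ρ', FPControl.IsWeakSolution T K b σ ρ₀ u' ρ' →
      ∀ u ∈ FPControl.admissible ω M₀, ∀ ρ, FPControl.IsWeakSolution T K b σ ρ₀ u ρ →
        FPControl.cost T G GT h univ u' ρ' ≤ FPControl.cost T G GT h univ u ρ ∧
        FPControl.cost T G GT h ω u' ρ' ≤ FPControl.cost T G GT h ω u ρ := by
  classical
  have hℓ' : ℓ ≠ ∞ := (hℓ2.trans_lt (by norm_num)).ne
  have hωm := hω.measurableSet
  have : IsFiniteMeasure (volume.restrict ω) :=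
    ⟨by rw [Measure.restrict_apply_univ]; exact hωb.measure_lt_top⟩
  have : Fact ((2 : ℝ≥0∞) ≠ ∞) := ⟨by norm_num⟩
  obtain ⟨A, M, κ, c, hκ, hc, hA, hsol, hlim⟩ := FPControl.exists_state_operator hT hM₀.le hωm hωb
    hℓ1 hℓ' hK hK0 hb_borel hb_bdd hb_cont hσ hγ hσ_elliptic hρ₀_L2
  have hex : ∀ u ∈ FPControl.admissible ω M₀, ∃ ρ, FPControl.IsWeakSolution T K b σ ρ₀ u ρ := by
    intro u hu
    obtain ⟨ρ, w, hρ⟩ := FPControl.exists_isVariationalSolution (hA ⟨u, hu⟩) hc hκ.le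
      FPControl.adjoint_toL2_injective hT hρ₀_L2.toLp
    exact ⟨ρ, (hsol ⟨u, hu⟩ ρ).2 ⟨w, hρ⟩⟩
  refine ⟨fun u hu => ⟨hex u hu, fun ρ ρ' hρ hρ' t ht => ?_⟩, ?_⟩
  · obtain ⟨w, hw⟩ := (hsol ⟨u, hu⟩ ρ).1 hρ
    obtain ⟨w', hw'⟩ := (hsol ⟨u, hu⟩ ρ').1 hρ'
    -- Uniqueness is the stability estimate with equal operators, whose right side is zero.
    have h1 := hw.norm_sub_sq_le (hA _) (hA _) hc hκ hT hw' ht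
    simp only [sub_self, norm_zero, ne_eq, OfNat.ofNat_ne_zero, not_false_eq_true, zero_pow,
      integral_zero, zero_div, zero_mul] at h1
    have h2 : ‖ρ t - ρ' t‖ = 0 := pow_eq_zero_iff two_ne_zero |>.1 (h1.antisymm (sq_nonneg _))
    exact sub_eq_zero.1 (norm_eq_zero.1 h2)
  have hUeq : ∀ c, {u ∈ FPControl.admissible ω M₀ | ∫ x in ω, h (u x) ≤ c} =
      {u : FPControl.L2On ω | (∀ᵐ x ∂(volume.restrict ω), u x ∈ Icc 0 M₀) ∧
        ∫ x in ω, h (u x) ≤ c} := fun _ => rfl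
  -- Writing the admissible set as a sublevel set of the zero penalty lets the penalty lemmas prove
  -- it closed and convex.
  have hU0 : FPControl.admissible ω M₀ =
      {u : FPControl.L2On ω | (∀ᵐ x ∂(volume.restrict ω), u x ∈ Icc 0 M₀) ∧
        ∫ x in ω, (fun _ : ℝ => (0 : ℝ)) (u x) ≤ 0} := by
    ext u
    simp [FPControl.admissible]
  obtain ⟨u', hu', hmin⟩ := FPControl.exists_minimizer (U := FPControl.admissible ω M₀)
    (sol := FPControl.IsWeakSolution T K b σ ρ₀)
    (Λ := fun ρ => (∫ t in (0 : ℝ)..T, ∫ x, G (t, x) * ρ t x) + ∫ x, GT x * ρ T x)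
    (φ := fun u => ∫ x in ω, h (u x))
    (R := measureUnivNNReal (volume.restrict ω) ^ (2 : ℝ≥0∞).toReal⁻¹ * M₀)
    (fun u hu => Lp.norm_le_of_ae_bound hM₀.le (by
      filter_upwards [show ∀ᵐ x ∂(volume.restrict ω), u x ∈ Icc 0 M₀ from hu] with x hx
      rw [Real.norm_of_nonneg hx.1]
      exact hx.2))
    (hU0 ▸ FPControl.convex_integral_comp_le hM₀.le continuousOn_const
      (convexOn_const 0 (convex_Icc 0 M₀)) 0)
    (hU0 ▸ FPControl.isClosed_integral_comp_le hM₀.le continuousOn_const 0)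
    ⟨0, by
      change ∀ᵐ x ∂(volume.restrict ω), (0 : FPControl.L2On ω) x ∈ Icc 0 M₀
      filter_upwards [Lp.coeFn_zero ℝ 2 (volume.restrict ω)] with x hx
      rw [hx]
      exact ⟨le_rfl, hM₀.le⟩⟩
    hex (fun c => hUeq c ▸ FPControl.convex_integral_comp_le hM₀.le hh_cont hh_convex c)
    (fun c => hUeq c ▸ FPControl.isClosed_integral_comp_le hM₀.le hh_cont c) (by
      intro un u ρn ρ hun hu hρn hρ hw
      choose wn hwn using fun n => (hsol ⟨un n, hun n⟩ (ρn n)).1 (hρn n)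
      obtain ⟨w, hw'⟩ := (hsol ⟨u, hu⟩ ρ).1 hρ
      obtain ⟨ε, hε, hle⟩ := FPControl.IsVariationalSolution.exists_tendsto_norm_sub_le
        (fun n => hA ⟨un n, hun n⟩) (hA ⟨u, hu⟩) hc hκ hT hwn hw'
        (hlim (fun n => ⟨un n, hun n⟩) ⟨u, hu⟩ hw)
      exact FPControl.tendsto_stateCost hT hG hGT (fun n => (hwn n).cont) hw'.cont hε hle)
  refine ⟨u', hu', fun ρ' hρ' u hu ρ hρ => ?_⟩
  have hle : FPControl.cost T G GT h ω u' ρ' ≤ FPControl.cost T G GT h ω u ρ := by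
    rw [FPControl.cost_eq_coe hωm hM₀.le hh_cont hh_nonneg hu',
      FPControl.cost_eq_coe hωm hM₀.le hh_cont hh_nonneg hu, EReal.coe_le_coe_iff]
    exact hmin ρ' hρ' u hu ρ hρ
  refine ⟨?_, hle⟩
  rw [FPControl.cost_univ_eq hωm, FPControl.cost_univ_eq hωm]
  exact add_le_add_left hle _
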